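/- **Setting.** Let $d\ge 3$, $n_1,\dots,n_d\ge 1$, $N=n_3\cdots n_d$. Real tensors $X\in\mathbb R^{n_1\times\cdots\times n_d}$ carry the entrywise inner product and the Frobenius norm $\|\cdot\|_F$. For $i=(i_3,\dots,i_d)$ let $\bar X^{(i)}\in\mathbb C^{n_1\times n_2}$ be the $i$-th frontal slice of the discrete Fourier transform of $X$ along dimensions $3,\dots,d$, and let $\bar X$ be the block diagonal matrix with these $N$ blocks. $\sigma_j(\cdot)$ is the $j$-th largest singular value and $\#\sigma_1(M)$ the multiplicity of $\sigma_1(M)$ (with $\#\sigma_1(0)=0$). The tensor nuclear norm is $\|X\|_*=\frac1N\sum_i\sum_j\sigma_j(\bar X^{(i)})$, $B=\{X:\|X\|_*\le 1\}$, and $\Pi_B$ is the Euclidean projection onto $B$. The rank-$r$ truncated projection of $P$ onto $B$ takes a t-SVD of $P$ (real tensors $U,V$ with unitary Fourier slices, $\bar P^{(i)}=\bar U^{(i)}\mathrm{diag}(\sigma_j(\bar P^{(i)}))\bar V^{(i)\mathsf H}$ for all $i$), finds $\sigma\ge0$ with $\frac1N\sum_i\sum_{j\le r}\max\{0,\sigma_j(\bar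 P^{(i)})-\sigma\}=1$ (or $\sigma=0$ if the sum at $\sigma=0$ is at most $1$), and returns the tensor $Z$ with $\bar Z^{(i)}=\sum_{j\le r}\max\{0,\sigma_j(\bar P^{(i)})-\sigma\}\,\bar u^{(i)}_j\bar v_j^{(i)\mathsf H}$, where $\bar u_j^{(i)},\bar v_j^{(i)}$ are the columns of $\bar U^{(i)},\bar V^{(i)}$. **Assumptions.** Let $f(X)=g(\mathcal A(X))+\langle C,X\rangle$, where $g:\mathbb R^m\to\mathbb R$ is $\alpha$-strongly convex, $\alpha>0$, and $\mathcal A:\mathbb R^{n_1\times\cdots\times n_d}\to\mathbb R^m$ is linear, and let $f$ be $\beta$-smooth, $\beta>0$ (differentiable on the whole space with $\beta$-Lipschitz gradient with respect to $\|\cdot\|_F$). Let $X^*$ be the unique minimizer of $f$ over $B$, and let it satisfy strict complementarity: $\mathrm{rank}(\bar X^*)<N\min\{n_1,n_2\}$ and $\sigma_1(\bar G)-\sigma_{\mathrm{rank}(\bar X^*)+1}(\bar G)>0$, where $G=\nabla f(X^*)$. **Notation.** $\mu=\max_i\#\sigma_1(\bar G^{(i)})$, $\nu=\#\{i:\bar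 G^{(i)}\ne0\}$, $\delta(r)=\sigma_1(\bar G)-\max_i\sigma_{r+1}(\bar G^{(i)})$, and $$R_0(r)=\frac{1}{2\beta\sqrt N}\max\left\{\frac{\delta(r)}{1+\frac{\sqrt{\mu\nu}}{\#\sigma_1(\bar G)}},\ \frac{\delta(r-\mu+1)}{\frac1{\sqrt\mu}+\frac{\sqrt{\mu\nu}}{\#\sigma_1(\bar G)}}\right\}.$$ **Method.** Nesterov's restarted fast gradient method with parameter $K\in\mathbb N$ starts at $X_1\in B$ and for $t=1,2,\dots$ sets $X_{t,1}=Y_{t,1}=X_t$, $\theta_1=1$; for $s=1,\dots,K$: $X_{t,s+1}=\Pi_B[Y_{t,s}-\frac1\beta\nabla f(Y_{t,s})]$, $\theta_{s+1}=\frac{1+\sqrt{1+4\theta_s^2}}2$, $Y_{t,s+1}=X_{t,s+1}+\frac{\theta_s-1}{\theta_{s+1}}(X_{t,s+1}-X_{t,s})$; then $X_{t+1}=X_{t,K+1}$. **Theorem.** There is a constant $\gamma$ with $0<\gamma\le 2e^2\beta$ such that $f(X)-f(X^*)\ge\gamma\|X-X^*\|_F^2$ for all $X\in B$. For every such $\gamma$,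 with $K=\lceil\sqrt{2\beta}\,e/\sqrt\gamma\rceil$, every integer $r$ with $\mu\le r<\min\{n_1,n_2\}$, and every $X_1\in B$ with $$\|X_1-X^*\|_F\le\frac{\sqrt2\min\{\gamma,\sqrt\gamma\}}{3\sqrt\beta}R_0(r),$$ replacing all projections $\Pi_B$ in the method by rank-$r$ truncated projections (with any choice of the t-SVDs) does not change the iterates $X_t,X_{t,s},Y_{t,s}$, and for all $t\ge1$ $$f(X_t)-f(X^*)\le\exp\left(-\frac{\sqrt{2\gamma}}{\sqrt\beta\,e}(t-1)\right)\big(f(X_1)-f(X^*)\big).$$ -/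

import Mathlib

open scoped InnerProductSpace Gradient

noncomputable section

namespace TNN

/-- Index set of the frontal slices of a tensor: the tuples `(i₃, …, i_d)`, where
`n 0, …, n (k-1)` are the dimensions `n₃, …, n_d` and `d = k + 2`. Indices start at `0`. -/
abbrev SliceIdx {k : ℕ} (n : Fin k → ℕ) : Type := (j : Fin k) → Fin (n j)

/-- Real tensors of size `n₁ × n₂ × n₃ × ⋯ × n_d`. The `EuclideanSpace` inner product and norm are
the tensor inner product and the Frobenius norm. -/
abbrev Tensor (n₁ n₂ : ℕ) {k : ℕ} (n : Fin k → ℕ) : Type :=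
  EuclideanSpace ℝ (Fin n₁ × Fin n₂ × SliceIdx n)

variable {n₁ n₂ k : ℕ} {n : Fin k → ℕ}

/-- `N = n₃ ⋯ n_d`, the number of frontal slices. -/
def numSlices (n : Fin k → ℕ) : ℕ := ∏ j, n j

/-- The frontal slice with index `i` of the discrete Fourier transform of `X` along all dimensions
but the first two. -/
def fslice (X : Tensor n₁ n₂ n) (i : SliceIdx n) : Matrix (Fin n₁) (Fin n₂) ℂ :=
  Matrix.of fun a b => ∑ l : SliceIdx n, (X (a, b, l) : ℂ) *
    ∏ j, Complex.exp (-(2 * Real.pi * Complex.I * ((i j : ℕ) : ℂ) * ((l j : ℕ) : ℂ)) / (n j : ℂ))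

/-- The block diagonal matrix whose diagonal blocks are the frontal slices of the Fourier transform
of `X`. -/
def bdiag (X : Tensor n₁ n₂ n) :
    Matrix (Fin n₁ × SliceIdx n) (Fin n₂ × SliceIdx n) ℂ :=
  Matrix.blockDiagonal (fslice X)

/-- `sval A j` is the `(j+1)`-st largest singular value of `A` (zero beyond the size of `A`). -/
def sval {p q : Type*} [Fintype p] [Fintype q] [DecidableEq q] (A : Matrix p q ℂ) (j : ℕ) : ℝ :=
  (Matrix.toEuclideanLin A).singularValues j

/-- Multiplicity of the largest singular value of `A`, with the convention that it is `0` for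
`A = 0`. -/
def topMult {p q : Type*} [Fintype p] [Fintype q] [DecidableEq q] (A : Matrix p q ℂ) : ℕ :=
  {j : ℕ | sval A j = sval A 0 ∧ sval A j ≠ 0}.ncard

/-- The tensor nuclear norm: the average over the frontal slices of the Fourier transform of the
sums of their singular values. -/
def tnn (X : Tensor n₁ n₂ n) : ℝ :=
  (1 / (numSlices n : ℝ)) *
    ∑ i : SliceIdx n, ∑ j ∈ Finset.range (min n₁ n₂), sval (fslice X i) j

/-- The unit ball of the tensor nuclear norm. -/
def ball (n₁ n₂ : ℕ) (n : Fin k → ℕ) : Set (Tensor n₁ n₂ n) := {X | tnn X ≤ 1}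

/-- `Z` is the Euclidean projection of `P` onto the unit ball of the tensor nuclear norm. -/
def IsProj (P Z : Tensor n₁ n₂ n) : Prop :=
  Z ∈ ball n₁ n₂ n ∧ ∀ W ∈ ball n₁ n₂ n, ‖P - Z‖ ≤ ‖P - W‖

/-- The `n₁ × n₂` matrix with diagonal entries `c 0, c 1, …`. -/
def rectDiag (n₁ n₂ : ℕ) (c : ℕ → ℝ) : Matrix (Fin n₁) (Fin n₂) ℂ :=
  Matrix.of fun a b => if (a : ℕ) = (b : ℕ) then (c a : ℂ) else 0

/-- `U`, `V` are the (real) orthogonal tensor factors of a t-SVD of `P`, expressed in the Fourier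
domain, where the t-product is the slice-wise matrix product: the slices of `U` and `V` are unitary
and give a singular value decomposition of each slice of `P`, singular values in decreasing
order. -/
def IsTSVD (P : Tensor n₁ n₂ n) (U : Tensor n₁ n₁ n) (V : Tensor n₂ n₂ n) : Prop :=
  ∀ i : SliceIdx n,
    fslice U i ∈ Matrix.unitaryGroup (Fin n₁) ℂ ∧
    fslice V i ∈ Matrix.unitaryGroup (Fin n₂) ℂ ∧
    fslice P i = fslice U i * rectDiag n₁ n₂ (sval (fslice P i)) * (fslice V i).conjTranspose

/-- `Z` is an output of the rank-`r` truncated projection of `P` onto the unit ball of the tensor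
nuclear norm: only the `r` leading singular triples of every Fourier slice of `P` (for some choice
of a t-SVD of `P`) are kept, and their singular values are soft-thresholded at a level `σ ≥ 0` for
which the thresholded values have average sum `1` (or at `σ = 0` if that sum is already at
most `1`). -/
def IsTruncProj (r : ℕ) (P Z : Tensor n₁ n₂ n) : Prop :=
  ∃ (U : Tensor n₁ n₁ n) (V : Tensor n₂ n₂ n) (σ : ℝ), IsTSVD P U V ∧ 0 ≤ σ ∧
    ((1 / (numSlices n : ℝ)) *
        ∑ i : SliceIdx n, ∑ j ∈ Finset.range r, max 0 (sval (fslice P i) j - σ) = 1 ∨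
      σ = 0 ∧ (1 / (numSlices n : ℝ)) *
        ∑ i : SliceIdx n, ∑ j ∈ Finset.range r, sval (fslice P i) j ≤ 1) ∧
    ∀ i : SliceIdx n, fslice Z i =
      fslice U i *
        rectDiag n₁ n₂ (fun j => if j < r then max 0 (sval (fslice P i) j - σ) else 0) *
        (fslice V i).conjTranspose

/-- `f` is `β`-smooth: differentiable with a `β`-Lipschitz gradient. -/
def IsSmooth (β : ℝ) (f : Tensor n₁ n₂ n → ℝ) : Prop :=
  Differentiable ℝ f ∧ ∀ X Y, ‖∇ f X - ∇ f Y‖ ≤ β * ‖X - Y‖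

/-- `Xs` is the unique minimizer of `f` over the unit ball of the tensor nuclear norm. -/
def IsUniqueMinimizer (f : Tensor n₁ n₂ n → ℝ) (Xs : Tensor n₁ n₂ n) : Prop :=
  Xs ∈ ball n₁ n₂ n ∧ ∀ X ∈ ball n₁ n₂ n, X ≠ Xs → f Xs < f X

/-- Strict complementarity of the optimal solution `Xs`. With `ρ` the average rank of `Xs`, so that
`ρ N = (bdiag Xs).rank`, it requires `ρ < min {n₁, n₂}` and
`σ₁ - σ_{ρN+1} > 0` for the block diagonal Fourier matrix of the gradient at `Xs`. -/
def StrictComplementarity (f : Tensor n₁ n₂ n → ℝ) (Xs : Tensor n₁ n₂ n) : Prop :=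
  (bdiag Xs).rank < min n₁ n₂ * numSlices n ∧
    0 < sval (bdiag (∇ f Xs)) 0 - sval (bdiag (∇ f Xs)) (bdiag Xs).rank

/-- Quadratic growth of `f` over the unit ball of the tensor nuclear norm, with constant `γ`. -/
def QuadraticGrowth (f : Tensor n₁ n₂ n → ℝ) (Xs : Tensor n₁ n₂ n) (γ : ℝ) : Prop :=
  ∀ X ∈ ball n₁ n₂ n, γ * ‖X - Xs‖ ^ 2 ≤ f X - f Xs

/-- The largest multiplicity of the top singular value among the Fourier slices of `G`. -/
def maxTopMult (G : Tensor n₁ n₂ n) : ℕ :=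
  Finset.univ.sup fun i : SliceIdx n => topMult (fslice G i)

/-- The number of nonzero diagonal blocks of `bdiag G`. -/
def nnzb (G : Tensor n₁ n₂ n) : ℕ := {i : SliceIdx n | fslice G i ≠ 0}.ncard

/-- The generalized complementarity measure `δ(r)` of an optimal solution with gradient `G`:
the largest singular value of `bdiag G` minus the largest `(r+1)`-st singular value among the
slices. -/
def genGap (G : Tensor n₁ n₂ n) (r : ℕ) : ℝ :=
  sval (bdiag G) 0 - ⨆ i : SliceIdx n, sval (fslice G i) r

/-- The radius `R₀(r)` for step size `1/β`, where `G` is the gradient at the optimal solution. -/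
def radius (β : ℝ) (G : Tensor n₁ n₂ n) (r : ℕ) : ℝ :=
  1 / (2 * β * √(numSlices n : ℝ)) *
    max
      (genGap G r /
        (1 + √((maxTopMult G : ℝ) * (nnzb G : ℝ)) / (topMult (bdiag G) : ℝ)))
      (genGap G (r - maxTopMult G + 1) /
        (1 / √(maxTopMult G : ℝ) +
          √((maxTopMult G : ℝ) * (nnzb G : ℝ)) / (topMult (bdiag G) : ℝ)))

/-- The sequence `θ₁ = 1`, `θ_{s+1} = (1 + √(1 + 4 θ_s²)) / 2` (the value at `0` is not used). -/
def theta : ℕ → ℝ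
  | 0 => 1
  | 1 => 1
  | s + 2 => (1 + √(1 + 4 * theta (s + 1) ^ 2)) / 2

/-- `X`, `x`, `y` are the outer iterates `X_t`, and the inner iterates `X_{t,s}`, `Y_{t,s}`, of
Nesterov's restarted fast gradient method with step size `1/β` and `K` inner steps, started at `X₁`,
where `proj P Z` says that `Z` may be returned as the projection of `P`. Only the values at `t ≥ 1`
and `1 ≤ s ≤ K + 1` are constrained. -/
structure IsRestartedFGM (proj : Tensor n₁ n₂ n → Tensor n₁ n₂ n → Prop)
    (f : Tensor n₁ n₂ n → ℝ) (β : ℝ) (K : ℕ) (X₁ : Tensor n₁ n₂ n)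
    (X : ℕ → Tensor n₁ n₂ n) (x y : ℕ → ℕ → Tensor n₁ n₂ n) : Prop where
  init : X 1 = X₁
  restart_x : ∀ t, 1 ≤ t → x t 1 = X t
  restart_y : ∀ t, 1 ≤ t → y t 1 = X t
  step : ∀ t, 1 ≤ t → ∀ s, 1 ≤ s → s ≤ K →
    proj (y t s - (1 / β) • ∇ f (y t s)) (x t (s + 1))
  momentum : ∀ t, 1 ≤ t → ∀ s, 1 ≤ s → s ≤ K →
    y t (s + 1) =
      x t (s + 1) + ((theta s - 1) / theta (s + 1)) • (x t (s + 1) - x t s)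
  next : ∀ t, 1 ≤ t → X (t + 1) = x t (K + 1)

end TNN

end

/-! The dual norm of the tensor nuclear norm is the largest operator norm of a Fourier slice
(`mem_ball_iff`). Optimality of X* therefore says that Q = -G/σ₁(Ḡ) has slices of norm at most one
and ⟪Q, X*⟫ = 1 (`isCertificate_of_inner_nonneg`). Equality in trace duality forces Q to send right
singular vectors of each slice of X* to left ones, so Q is isometric on the orthogonal complement of
the kernel of that slice. Strict complementarity makes it a strict contraction on the kernel
(`IsCertificate.norm_apply_ker`).

Quadratic growth (`exists_quadraticGrowth`): let F be the span of the face exposed by Q. A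
perturbation W ⊥ F raises the dual norm of Q only to second order, so the squared distance of a
point X of B to F is at most a constant times ⟪Q, X* - X⟫. Inside F, X* is relatively interior to
the face. A direction of F killed by both A and ⟪Q, ·⟫ would thus give a second minimizer, so (A,
⟪Q, ·⟫) is injective on F. Strong convexity of g and the first-order term control these two
quantities.

Truncation (`isProj_iff_isTruncProj_of_dist_le`): the projection soft-thresholds the slices, so
truncation is harmless once the threshold exceeds every discarded singular value. It does if, at
some level s at or above all of these, the thresholded sum is still at least N
(`IsTruncProj.isProj`). For P near X* - G/β = X* + κQ, κ = σ₁(Ḡ)/β, Weyl's inequality bounds the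
discarded values, and testing P against Q on the support of X* bounds the sum from below. Weyl with
the index split r = j + (r - j) gives the two entries of R₀: j = r and j = r - μ + 1.

Method (`IsRestartedFGM.invariant`): gradient steps of length 1/β are nonexpansive, so it suffices
that every extrapolated point stays within 2R₀ of X*. This follows by induction from the O(1/s²)
value bound and quadratic growth; the same two facts make each epoch of K steps contract the value
gap by e⁻². -/

noncomputable section

namespace TNN

open Module

set_option linter.unusedSectionVars false

variable {n₁ n₂ k : ℕ} {n : Fin k → ℕ}

/-! ### Singular values via min-max, Weyl's inequality and the Frobenius inner product. -/

section SingularValues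

variable {𝕜 : Type*} [RCLike 𝕜]
  {E : Type*} [NormedAddCommGroup E] [InnerProductSpace 𝕜 E] [FiniteDimensional 𝕜 E]
  {F : Type*} [NormedAddCommGroup F] [InnerProductSpace 𝕜 F] [FiniteDimensional 𝕜 F]

/-- `b` is an orthonormal basis of right singular vectors of `T`, with singular values `c`. -/
def IsRightSVBasis (T : E →ₗ[𝕜] F) (c : ℕ → ℝ) {q : ℕ} (b : OrthonormalBasis (Fin q) 𝕜 E) : Prop :=
  ∀ i j : Fin q, ⟪T (b i), T (b j)⟫_𝕜 = if i = j then ((c j : ℝ) : 𝕜) ^ 2 else 0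

theorem exists_isRightSVBasis (T : E →ₗ[𝕜] F) {q : ℕ} (hq : finrank 𝕜 E = q) :
    ∃ b : OrthonormalBasis (Fin q) 𝕜 E, IsRightSVBasis T T.singularValues b := by
  refine ⟨T.isSymmetric_adjoint_comp_self.eigenvectorBasis hq, fun i j => ?_⟩
  have h := T.isSymmetric_adjoint_comp_self.apply_eigenvectorBasis hq j
  rw [← LinearMap.adjoint_inner_right, ← LinearMap.comp_apply, h, inner_smul_right,
    OrthonormalBasis.inner_eq_ite]
  have h2 := T.sq_singularValues_fin hq j
  split_ifs with hij
  · rw [← h2]; simp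
  · simp

theorem IsRightSVBasis.norm_apply {T : E →ₗ[𝕜] F} {c : ℕ → ℝ} {q : ℕ}
    {b : OrthonormalBasis (Fin q) 𝕜 E} (h : IsRightSVBasis T c b) (j : Fin q) (hc : 0 ≤ c j) :
    ‖T (b j)‖ = c j := by
  have h1 := h j j
  rw [inner_self_eq_norm_sq_to_K, if_pos rfl] at h1
  have h2 : ‖T (b j)‖ ^ 2 = c j ^ 2 := by exact_mod_cast h1
  exact (sq_eq_sq₀ (norm_nonneg _) hc).1 h2

theorem IsRightSVBasis.norm_sq_apply {T : E →ₗ[𝕜] F} {c : ℕ → ℝ} {q : ℕ}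
    {b : OrthonormalBasis (Fin q) 𝕜 E} (h : IsRightSVBasis T c b) (x : E) :
    ‖T x‖ ^ 2 = ∑ j : Fin q, c j ^ 2 * ‖⟪b j, x⟫_𝕜‖ ^ 2 := by
  have hx : T x = ∑ j, ⟪b j, x⟫_𝕜 • T (b j) := by
    conv_lhs => rw [← b.sum_repr' x]
    simp
  have : ((‖T x‖ ^ 2 : ℝ) : 𝕜) = ((∑ j : Fin q, c j ^ 2 * ‖⟪b j, x⟫_𝕜‖ ^ 2 : ℝ) : 𝕜) := by
    push_cast
    rw [← inner_self_eq_norm_sq_to_K, hx, sum_inner]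
    refine Finset.sum_congr rfl fun i _ => ?_
    simp only [inner_sum, inner_smul_left, inner_smul_right, h i]
    rw [Finset.sum_eq_single i (by intro j _ hj; simp [hj.symm]) (by simp)]
    rw [← mul_assoc, RCLike.mul_conj, if_pos rfl]; ring
  exact_mod_cast this

/-- Subspaces on which `T` is bounded below and above, of large enough dimensions. -/
theorem le_of_bounds_on_submodules (T : E →ₗ[𝕜] F) {c d : ℝ} (S R : Submodule 𝕜 E)
    (hdim : finrank 𝕜 E < finrank 𝕜 S + finrank 𝕜 R)
    (hS : ∀ x ∈ S, c * ‖x‖ ≤ ‖T x‖) (hR : ∀ x ∈ R, ‖T x‖ ≤ d * ‖x‖) : c ≤ d := by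
  obtain ⟨x, hx, hx0⟩ : ∃ x ∈ S ⊓ R, x ≠ 0 := by
    apply Submodule.exists_mem_ne_zero_of_ne_bot
    intro hbot
    have h1 := Submodule.finrank_sup_add_finrank_inf_eq S R
    rw [hbot, finrank_bot] at h1
    have h2 := Submodule.finrank_le (S ⊔ R)
    omega
  have h1 := (hS x hx.1).trans (hR x hx.2)
  exact le_of_mul_le_mul_right h1 (norm_pos_iff.2 hx0)

/-- One half of Courant–Fischer; the witness is the span of the first `j + 1` right singular
vectors. -/
theorem IsRightSVBasis.exists_lower {T : E →ₗ[𝕜] F} {c : ℕ → ℝ} {q : ℕ}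
    {b : OrthonormalBasis (Fin q) 𝕜 E} (h : IsRightSVBasis T c b) (j : ℕ) (hj : j < q)
    (hc0 : 0 ≤ c j) (hc : ∀ i ≤ j, c j ≤ c i) :
    ∃ S : Submodule 𝕜 E, finrank 𝕜 S = j + 1 ∧ ∀ x ∈ S, c j * ‖x‖ ≤ ‖T x‖ := by
  let v : Fin (j + 1) → E := fun i => b ⟨i, by omega⟩
  have hv : Orthonormal 𝕜 v := b.orthonormal.comp (fun i : Fin (j + 1) => (⟨i, by omega⟩ : Fin q))
    (fun x y hxy => by simpa [Fin.ext_iff] using hxy)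
  refine ⟨Submodule.span 𝕜 (Set.range v), ?_, fun x hx => ?_⟩
  · rw [finrank_span_eq_card hv.linearIndependent, Fintype.card_fin]
  · have hz : ∀ i : Fin q, j < i → ⟪b i, x⟫_𝕜 = 0 := by
      intro i hi
      induction hx using Submodule.span_induction with
      | mem y hy =>
        obtain ⟨l, rfl⟩ := hy
        rw [OrthonormalBasis.inner_eq_ite, if_neg]
        simp only [Fin.ext_iff]; omega
      | zero => simp
      | add y z _ _ hy hz => rw [inner_add_right, hy, hz, add_zero]
      | smul r y _ hy => rw [inner_smul_right, hy, mul_zero]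
    refine le_of_sq_le_sq ?_ (norm_nonneg _)
    rw [h.norm_sq_apply, mul_pow, ← b.sum_sq_norm_inner_right x, Finset.mul_sum]
    refine Finset.sum_le_sum fun i _ => ?_
    by_cases hi : j < i
    · simp [hz i hi]
    · gcongr
      exact hc i (by omega)

theorem IsRightSVBasis.exists_upper {T : E →ₗ[𝕜] F} {c : ℕ → ℝ} {q : ℕ}
    {b : OrthonormalBasis (Fin q) 𝕜 E} (h : IsRightSVBasis T c b) (j : ℕ)
    {d : ℝ} (hd : 0 ≤ d) (hc : ∀ i < q, j ≤ i → |c i| ≤ d) :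
    ∃ R : Submodule 𝕜 E, finrank 𝕜 E ≤ finrank 𝕜 R + j ∧ ∀ x ∈ R, ‖T x‖ ≤ d * ‖x‖ := by
  -- The subspace is the common kernel of the first `j` coordinates. The minimum allows `j` to
  -- exceed the dimension.
  let L : E →ₗ[𝕜] (Fin (min j q) → 𝕜) :=
    LinearMap.pi fun i => (innerSL 𝕜 (b ⟨i, by have := i.2; omega⟩)).toLinearMap
  refine ⟨LinearMap.ker L, ?_, fun x hx => ?_⟩
  · have h1 := LinearMap.finrank_range_add_finrank_ker L
    have h2 := Submodule.finrank_le (LinearMap.range L)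
    rw [Module.finrank_fin_fun] at h2
    omega
  · have hz : ∀ i : Fin q, (i : ℕ) < j → ⟪b i, x⟫_𝕜 = 0 := by
      intro i hi
      have := congrFun (LinearMap.mem_ker.1 hx) ⟨i, by omega⟩
      simpa [L] using this
    refine le_of_sq_le_sq ?_ (by positivity)
    rw [h.norm_sq_apply, mul_pow, ← b.sum_sq_norm_inner_right x, Finset.mul_sum]
    refine Finset.sum_le_sum fun i _ => ?_
    by_cases hi : (i : ℕ) < j
    · simp [hz i hi]
    · have h1 := hc i i.2 (by omega)
      have h2 : c i ^ 2 ≤ d ^ 2 := sq_le_sq' (abs_le.1 h1).1 (abs_le.1 h1).2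
      gcongr

theorem exists_lower_singularValues (T : E →ₗ[𝕜] F) (j : ℕ) (hj : j < finrank 𝕜 E) :
    ∃ S : Submodule 𝕜 E, finrank 𝕜 S = j + 1 ∧ ∀ x ∈ S, T.singularValues j * ‖x‖ ≤ ‖T x‖ := by
  obtain ⟨b, hb⟩ := exists_isRightSVBasis T rfl
  exact hb.exists_lower j hj (T.singularValues_nonneg j) fun i hi => T.singularValues_antitone hi

theorem exists_upper_singularValues (T : E →ₗ[𝕜] F) (j : ℕ) :
    ∃ R : Submodule 𝕜 E, finrank 𝕜 E ≤ finrank 𝕜 R + j ∧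
      ∀ x ∈ R, ‖T x‖ ≤ T.singularValues j * ‖x‖ := by
  obtain ⟨b, hb⟩ := exists_isRightSVBasis T rfl
  refine hb.exists_upper j (T.singularValues_nonneg j) fun i _ hi => ?_
  rw [abs_of_nonneg (T.singularValues_nonneg i)]
  exact T.singularValues_antitone hi

theorem norm_apply_le_singularValues (T : E →ₗ[𝕜] F) (x : E) :
    ‖T x‖ ≤ T.singularValues 0 * ‖x‖ := by
  obtain ⟨R, hR, h⟩ := exists_upper_singularValues T 0
  have : R = ⊤ := Submodule.eq_top_of_finrank_eq (le_antisymm (Submodule.finrank_le _) (by simpa using hR))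
  exact h x (this ▸ Submodule.mem_top)

theorem le_singularValues (T : E →ₗ[𝕜] F) {c : ℝ} {j : ℕ} (S : Submodule 𝕜 E)
    (hj : j < finrank 𝕜 S) (hS : ∀ x ∈ S, c * ‖x‖ ≤ ‖T x‖) : c ≤ T.singularValues j := by
  obtain ⟨R, hR, h⟩ := exists_upper_singularValues T j
  exact le_of_bounds_on_submodules T S R (by omega) hS h

/-- A `singularValues` upper bound from an upper bound on a subspace of codimension at most `j`. -/
theorem singularValues_le (T : E →ₗ[𝕜] F) {d : ℝ} (hd : 0 ≤ d) {j : ℕ} (R : Submodule 𝕜 E)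
    (hj : finrank 𝕜 E ≤ finrank 𝕜 R + j) (hR : ∀ x ∈ R, ‖T x‖ ≤ d * ‖x‖) :
    T.singularValues j ≤ d := by
  by_cases hjE : j < finrank 𝕜 E
  · obtain ⟨S, hS, h⟩ := exists_lower_singularValues T j hjE
    exact le_of_bounds_on_submodules T S R (by omega) h hR
  · rw [T.singularValues_of_finrank_le (by omega)]; exact hd

/-- **Weyl's inequality** for singular values. -/
theorem singularValues_add_le (S T : E →ₗ[𝕜] F) (i j : ℕ) :
    (S + T).singularValues (i + j) ≤ S.singularValues i + T.singularValues j := by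
  obtain ⟨R₁, hR₁, h₁⟩ := exists_upper_singularValues S i
  obtain ⟨R₂, hR₂, h₂⟩ := exists_upper_singularValues T j
  -- Two subspaces of codimension at most `i` and `j` meet in codimension at most `i + j`, and both
  -- upper bounds hold on the intersection.
  refine singularValues_le _ (add_nonneg (S.singularValues_nonneg i) (T.singularValues_nonneg j))
    (R₁ ⊓ R₂) ?_ fun x hx => ?_
  · have h1 := Submodule.finrank_sup_add_finrank_inf_eq R₁ R₂
    have h2 := Submodule.finrank_le (R₁ ⊔ R₂)
    omega
  · rw [LinearMap.add_apply, add_mul]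
    exact (norm_add_le _ _).trans (add_le_add (h₁ x hx.1) (h₂ x hx.2))

/-- By min-max, any orthonormal basis with orthogonal images of decreasing lengths reveals the
singular values. This is how they are read off from an explicit decomposition. -/
theorem IsRightSVBasis.singularValues_eq {T : E →ₗ[𝕜] F} {c : ℕ → ℝ} {q : ℕ}
    {b : OrthonormalBasis (Fin q) 𝕜 E} (h : IsRightSVBasis T c b) (hc0 : ∀ j, 0 ≤ c j)
    (hc : ∀ i j, i ≤ j → j < q → c j ≤ c i) (j : ℕ) (hj : j < q) : T.singularValues j = c j := by
  have hq : finrank 𝕜 E = q := by rw [finrank_eq_card_basis b.toBasis, Fintype.card_fin]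
  apply le_antisymm
  · obtain ⟨R, hR, hbd⟩ := h.exists_upper j (hc0 j) fun i hi hij => by
      rw [abs_of_nonneg (hc0 i)]; exact hc j i hij hi
    exact singularValues_le T (hc0 j) R hR hbd
  · obtain ⟨S, hS, hbd⟩ := h.exists_lower j hj (hc0 j) fun i hi => hc i j hi hj
    exact le_singularValues T S (by omega) hbd

/-- The real part of the Frobenius inner product of linear maps. -/
def frob (S T : E →ₗ[𝕜] F) : ℝ := RCLike.re (LinearMap.trace 𝕜 E (S.adjoint ∘ₗ T))

theorem frob_eq_sum {ι : Type*} [Fintype ι] (S T : E →ₗ[𝕜] F) (b : OrthonormalBasis ι 𝕜 E) :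
    frob S T = ∑ j, RCLike.re ⟪S (b j), T (b j)⟫_𝕜 := by
  rw [frob, LinearMap.trace_eq_sum_inner _ b, map_sum]
  simp [LinearMap.adjoint_inner_right]

theorem frob_self_eq_sum {ι : Type*} [Fintype ι] (T : E →ₗ[𝕜] F) (b : OrthonormalBasis ι 𝕜 E) :
    frob T T = ∑ j, ‖T (b j)‖ ^ 2 := by
  rw [frob_eq_sum T T b]
  simp

theorem frob_self_nonneg (T : E →ₗ[𝕜] F) : 0 ≤ frob T T := by
  rw [frob_self_eq_sum T (stdOrthonormalBasis 𝕜 E)]; positivity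

/-- The first `j + 1` squared singular values are all at least the last of them, and together at
most the squared Frobenius norm. The factor √(j + 1) is the origin of 1/√μ in the radius. -/
theorem sqrt_mul_singularValues_le (T : E →ₗ[𝕜] F) (j : ℕ) :
    √((j : ℝ) + 1) * T.singularValues j ≤ √(frob T T) := by
  by_cases hj : j < finrank 𝕜 E
  · obtain ⟨b, hb⟩ := exists_isRightSVBasis T rfl
    apply Real.le_sqrt_of_sq_le
    rw [mul_pow, Real.sq_sqrt (by positivity), frob_self_eq_sum T b]
    have h1 : ∑ i : Fin (finrank 𝕜 E), ‖T (b i)‖ ^ 2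
        = ∑ i ∈ Finset.range (finrank 𝕜 E), T.singularValues i ^ 2 := by
      rw [← Fin.sum_univ_eq_sum_range fun i => T.singularValues i ^ 2]
      exact Finset.sum_congr rfl fun i _ => by rw [hb.norm_apply i (T.singularValues_nonneg i)]
    rw [h1]
    calc ((j : ℝ) + 1) * T.singularValues j ^ 2
        = ∑ i ∈ Finset.range (j + 1), T.singularValues j ^ 2 := by simp
      _ ≤ ∑ i ∈ Finset.range (j + 1), T.singularValues i ^ 2 := by
          refine Finset.sum_le_sum fun i hi => ?_
          have := T.singularValues_antitone (show i ≤ j by simp at hi; omega)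
          have := T.singularValues_nonneg j
          gcongr
      _ ≤ _ := Finset.sum_le_sum_of_subset_of_nonneg
          (Finset.range_subset_range.2 hj) fun i _ _ => by positivity
  · rw [T.singularValues_of_finrank_le (by omega)]; simp

end SingularValues

/-! ### Discrete Fourier transform of real tensors, conjugate symmetry and Parseval. -/

section Fourier

/-- The kernel of the discrete Fourier transform. -/
def dftKernel (i l : SliceIdx n) : ℂ :=
  ∏ j, Complex.exp (-(2 * Real.pi * Complex.I * ((i j : ℕ) : ℂ) * ((l j : ℕ) : ℂ)) / (n j : ℂ))

theorem fslice_apply (X : Tensor n₁ n₂ n) (i : SliceIdx n) (a : Fin n₁) (b : Fin n₂) :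
    fslice X i a b = ∑ l, (X (a, b, l) : ℂ) * dftKernel i l := rfl

theorem dftKernel_comm (i l : SliceIdx n) : dftKernel i l = dftKernel l i := by
  unfold dftKernel
  refine Finset.prod_congr rfl fun j _ => ?_
  congr 2; ring

/-- The index of the complex conjugate Fourier slice. -/
def negIdx (i : SliceIdx n) : SliceIdx n := fun j =>
  ⟨(n j - i j) % n j, Nat.mod_lt _ ((Nat.zero_le _).trans_lt (i j).2)⟩

theorem negIdx_negIdx (i : SliceIdx n) : negIdx (negIdx i) = i := by
  funext j
  ext
  have hi := (i j).2
  simp only [negIdx]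
  rcases Nat.eq_zero_or_pos (i j : ℕ) with h | h
  · simp [h]
  · rw [Nat.mod_eq_of_lt (show n j - i j < n j by omega), Nat.mod_eq_of_lt (by omega)]
    omega

theorem conj_dftKernel (i l : SliceIdx n) :
    starRingEnd ℂ (dftKernel i l) = dftKernel (negIdx i) l := by
  unfold dftKernel
  rw [map_prod]
  refine Finset.prod_congr rfl fun j _ => ?_
  have hi := (i j).2
  have hn : (n j : ℂ) ≠ 0 := by
    have : n j ≠ 0 := by omega
    exact_mod_cast this
  rw [← Complex.exp_conj]
  simp only [negIdx]
  rcases Nat.eq_zero_or_pos (i j : ℕ) with h | h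
  · simp [h]
  · rw [Nat.mod_eq_of_lt (show n j - i j < n j by omega), Nat.cast_sub hi.le]
    rw [Complex.exp_eq_exp_iff_exists_int]
    -- Replacing the frequency i by n - i shifts the exponent by 2πi times the integer `l j`.
    refine ⟨(l j : ℕ), ?_⟩
    simp [map_ofNat]
    field_simp
    ring

/-- The summands are the powers of an `m`-th root of unity `ζ`, which equals 1 only if `a = b`;
otherwise the geometric sum vanishes. -/
theorem sum_exp_mul_conj_exp {m : ℕ} (a b : Fin m) :
    ∑ x : Fin m, Complex.exp (-(2 * Real.pi * Complex.I * ((x : ℕ) : ℂ) * ((a : ℕ) : ℂ)) / (m : ℂ)) *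
      starRingEnd ℂ
        (Complex.exp (-(2 * Real.pi * Complex.I * ((x : ℕ) : ℂ) * ((b : ℕ) : ℂ)) / (m : ℂ))) =
      if a = b then (m : ℂ) else 0 := by
  have ha := a.2
  have hb := b.2
  have hm : (m : ℂ) ≠ 0 := by
    have : m ≠ 0 := by omega
    exact_mod_cast this
  set ζ : ℂ := Complex.exp (2 * Real.pi * Complex.I * (((b : ℕ) : ℂ) - ((a : ℕ) : ℂ)) / m) with hζ
  have h1 : ∀ x : Fin m,
      Complex.exp (-(2 * Real.pi * Complex.I * ((x : ℕ) : ℂ) * ((a : ℕ) : ℂ)) / (m : ℂ)) *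
      starRingEnd ℂ
        (Complex.exp (-(2 * Real.pi * Complex.I * ((x : ℕ) : ℂ) * ((b : ℕ) : ℂ)) / (m : ℂ))) =
      ζ ^ (x : ℕ) := by
    intro x
    rw [← Complex.exp_conj, ← Complex.exp_add, hζ, ← Complex.exp_nat_mul]
    congr 1
    simp [map_ofNat]
    ring
  simp only [h1]
  rw [Fin.sum_univ_eq_sum_range (fun x => ζ ^ x)]
  split_ifs with h
  · have : ζ = 1 := by rw [hζ, h]; simp
    simp [this]
  · have hpow : ζ ^ m = 1 := by
      rw [hζ, ← Complex.exp_nat_mul, Complex.exp_eq_one_iff]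
      refine ⟨(b : ℕ) - (a : ℕ), ?_⟩
      push_cast
      field_simp
    have hne : ζ ≠ 1 := by
      rw [hζ, Ne, Complex.exp_eq_one_iff]
      rintro ⟨t, ht⟩
      have hpi : (2 * Real.pi * Complex.I : ℂ) ≠ 0 := Complex.two_pi_I_ne_zero
      have h2 : ((b : ℕ) : ℂ) - ((a : ℕ) : ℂ) = t * m := by
        field_simp at ht
        rw [ht]; ring
      have h3 : ((b : ℕ) : ℤ) - ((a : ℕ) : ℤ) = t * m := by exact_mod_cast h2
      have h4 : t = 0 := by
        by_contra h0
        rcases lt_or_gt_of_ne h0 with h5 | h5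
        · have : t * m ≤ -1 * m := by gcongr; omega
          omega
        · have : 1 * (m : ℤ) ≤ t * m := by gcongr; omega
          omega
      rw [h4] at h3
      exact h (Fin.ext (by omega))
    have := mul_neg_geom_sum ζ m
    rw [hpow, sub_self] at this
    rcases mul_eq_zero.1 this with h | h
    · exact absurd (sub_eq_zero.1 h).symm hne
    · exact h

theorem sum_dftKernel_mul_conj (l l' : SliceIdx n) :
    ∑ i, dftKernel i l * starRingEnd ℂ (dftKernel i l') =
      if l = l' then (numSlices n : ℂ) else 0 := by
  unfold dftKernel
  simp only [map_prod, ← Finset.prod_mul_distrib]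
  rw [← Fintype.prod_sum (fun j (x : Fin (n j)) =>
    Complex.exp (-(2 * Real.pi * Complex.I * ((x : ℕ) : ℂ) * ((l j : ℕ) : ℂ)) / (n j : ℂ)) *
      starRingEnd ℂ
        (Complex.exp (-(2 * Real.pi * Complex.I * ((x : ℕ) : ℂ) * ((l' j : ℕ) : ℂ)) / (n j : ℂ))))]
  simp only [sum_exp_mul_conj_exp]
  split_ifs with h
  · subst h; simp [numSlices]
  · obtain ⟨j, hj⟩ := Function.ne_iff.1 h
    exact Finset.prod_eq_zero (Finset.mem_univ j) (by simp [hj])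

theorem numSlices_pos (hn : ∀ j, 0 < n j) : 0 < numSlices n := Finset.prod_pos fun j _ => hn j

/-- The real part of the inverse discrete Fourier transform of a family of slices. -/
def realInvDFT (F : SliceIdx n → Matrix (Fin n₁) (Fin n₂) ℂ) : Tensor n₁ n₂ n :=
  WithLp.toLp 2 fun p => 1 / (numSlices n : ℝ) *
    (∑ i, F i p.1 p.2.1 * starRingEnd ℂ (dftKernel i p.2.2)).re

theorem realInvDFT_apply (F : SliceIdx n → Matrix (Fin n₁) (Fin n₂) ℂ) (a : Fin n₁) (b : Fin n₂)
    (l : SliceIdx n) : realInvDFT F (a, b, l) = 1 / (numSlices n : ℝ) *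
      (∑ i, F i a b * starRingEnd ℂ (dftKernel i l)).re := rfl

theorem fslice_negIdx (X : Tensor n₁ n₂ n) (i : SliceIdx n) :
    fslice X (negIdx i) = (fslice X i).map (starRingEnd ℂ) := by
  ext a b
  simp [fslice_apply, ← conj_dftKernel]

theorem realInvDFT_fslice (hn : ∀ j, 0 < n j) (X : Tensor n₁ n₂ n) :
    realInvDFT (fslice X) = X := by
  have hN : (numSlices n : ℝ) ≠ 0 := by exact_mod_cast (numSlices_pos hn).ne'
  ext ⟨a, b, l⟩
  rw [realInvDFT_apply]
  have : ∑ i, fslice X i a b * starRingEnd ℂ (dftKernel i l) = (numSlices n : ℂ) * X (a, b, l) := by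
    simp only [fslice_apply, Finset.sum_mul]
    rw [Finset.sum_comm]
    simp only [mul_assoc, ← Finset.mul_sum, sum_dftKernel_mul_conj]
    simp [mul_comm]
  rw [this]
  have h2 : ((numSlices n : ℂ) * X (a, b, l)).re = (numSlices n : ℝ) * X (a, b, l) := by
    rw [← Complex.ofReal_natCast, ← Complex.ofReal_mul, Complex.ofReal_re]
  rw [h2]
  field_simp

/-- Conjugate symmetry makes the complex inverse transform real, so that taking the real part loses
nothing. -/
theorem fslice_realInvDFT (hn : ∀ j, 0 < n j) (F : SliceIdx n → Matrix (Fin n₁) (Fin n₂) ℂ)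
    (hF : ∀ i, F (negIdx i) = (F i).map (starRingEnd ℂ)) : fslice (realInvDFT F) = F := by
  have hN : (numSlices n : ℂ) ≠ 0 := by exact_mod_cast (numSlices_pos hn).ne'
  have hreal : ∀ a b l, ((realInvDFT F (a, b, l) : ℝ) : ℂ) = 1 / (numSlices n : ℂ) *
      ∑ i, F i a b * starRingEnd ℂ (dftKernel i l) := by
    intro a b l
    rw [realInvDFT_apply]
    push_cast
    congr 1
    apply Complex.conj_eq_iff_re.1
    rw [map_sum]
    simp only [map_mul, Complex.conj_conj]
    let e : SliceIdx n ≃ SliceIdx n := ⟨negIdx, negIdx, negIdx_negIdx, negIdx_negIdx⟩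
    rw [← Equiv.sum_comp e]
    refine Finset.sum_congr rfl fun i _ => ?_
    show starRingEnd ℂ (F (negIdx i) a b) * dftKernel (negIdx i) l = _
    rw [hF, ← conj_dftKernel]
    simp
  ext i a b
  rw [fslice_apply]
  simp only [hreal, mul_assoc, Finset.sum_mul, ← Finset.mul_sum]
  rw [Finset.sum_comm]
  simp only [← Finset.mul_sum]
  have h2 : ∀ i', ∑ l, starRingEnd ℂ (dftKernel i' l) * dftKernel i l =
      if i = i' then (numSlices n : ℂ) else 0 := by
    intro i'
    rw [← sum_dftKernel_mul_conj i i']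
    refine Finset.sum_congr rfl fun l _ => ?_
    rw [dftKernel_comm i' l, dftKernel_comm i l, mul_comm]
  simp only [h2]
  simp
  field_simp

/-- The frontal slices of the Fourier transform, as linear maps. -/
def slice (X : Tensor n₁ n₂ n) (i : SliceIdx n) :
    EuclideanSpace ℂ (Fin n₂) →ₗ[ℂ] EuclideanSpace ℂ (Fin n₁) :=
  Matrix.toEuclideanLin (fslice X i)

theorem slice_add (X Y : Tensor n₁ n₂ n) (i : SliceIdx n) :
    slice (X + Y) i = slice X i + slice Y i := by
  unfold slice
  rw [← map_add]
  congr 1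
  ext a b
  simp [fslice_apply, add_mul, Finset.sum_add_distrib]

theorem slice_smul (c : ℝ) (X : Tensor n₁ n₂ n) (i : SliceIdx n) :
    slice (c • X) i = (c : ℂ) • slice X i := by
  unfold slice
  rw [← map_smul]
  congr 1
  ext a b
  simp [fslice_apply, mul_assoc, Finset.mul_sum]

theorem slice_neg (X : Tensor n₁ n₂ n) (i : SliceIdx n) : slice (-X) i = -slice X i := by
  rw [← neg_one_smul ℝ X, slice_smul]; simp

theorem slice_sub (X Y : Tensor n₁ n₂ n) (i : SliceIdx n) :
    slice (X - Y) i = slice X i - slice Y i := by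
  rw [sub_eq_add_neg, slice_add, slice_neg, sub_eq_add_neg]

theorem sval_fslice (X : Tensor n₁ n₂ n) (i : SliceIdx n) (j : ℕ) :
    sval (fslice X i) j = (slice X i).singularValues j := rfl

theorem frob_toEuclideanLin (A B : Matrix (Fin n₁) (Fin n₂) ℂ) :
    frob (Matrix.toEuclideanLin A) (Matrix.toEuclideanLin B) =
      ∑ b, ∑ a, (starRingEnd ℂ (A a b) * B a b).re := by
  rw [frob_eq_sum _ _ (EuclideanSpace.basisFun (Fin n₂) ℂ)]
  refine Finset.sum_congr rfl fun b _ => ?_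
  simp [Matrix.toLpLin_apply, PiLp.inner_apply]
  refine Finset.sum_congr rfl fun a _ => ?_
  ring

/-- No conjugate symmetry of `F` is needed: `W` is real, so the real part can be moved outside the
pairing. This permits families supported on a single slice. -/
theorem inner_realInvDFT (W : Tensor n₁ n₂ n) (F : SliceIdx n → Matrix (Fin n₁) (Fin n₂) ℂ) :
    ⟪W, realInvDFT F⟫_ℝ =
      1 / (numSlices n : ℝ) * ∑ i, frob (slice W i) (Matrix.toEuclideanLin (F i)) := by
  unfold slice
  simp only [frob_toEuclideanLin]
  have key : ∀ a b, ∑ l, ⟪W (a, b, l), realInvDFT F (a, b, l)⟫_ℝ =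
      1 / (numSlices n : ℝ) * ∑ i, (starRingEnd ℂ (fslice W i a b) * F i a b).re := by
    intro a b
    simp only [realInvDFT_apply, fslice_apply, Complex.re_sum, map_sum, map_mul, Complex.conj_ofReal,
      Finset.sum_mul, Finset.mul_sum]
    simp only [RCLike.inner_apply, conj_trivial, Finset.sum_mul]
    rw [Finset.sum_comm]
    refine Finset.sum_congr rfl fun i _ => Finset.sum_congr rfl fun l _ => ?_
    rw [mul_assoc (W (a, b, l) : ℂ), Complex.re_ofReal_mul, mul_comm (F i a b)]
    ring
  rw [PiLp.inner_apply]
  simp only [Fintype.sum_prod_type]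
  simp only [key, ← Finset.mul_sum]
  congr 1
  rw [Finset.sum_comm]
  conv_rhs => rw [Finset.sum_comm]
  refine Finset.sum_congr rfl fun b _ => ?_
  rw [Finset.sum_comm]

theorem inner_eq_sum_frob (hn : ∀ j, 0 < n j) (X Y : Tensor n₁ n₂ n) :
    ⟪X, Y⟫_ℝ = 1 / (numSlices n : ℝ) * ∑ i, frob (slice X i) (slice Y i) := by
  conv_lhs => rw [← realInvDFT_fslice hn Y]
  exact inner_realInvDFT X (fslice Y)

end Fourier

/-! ### Matrix singular value decompositions and existence of a real t-SVD. -/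

section MatrixSVD

variable {𝕜 : Type*} [RCLike 𝕜]

/-- The rectangular diagonal matrix over `𝕜` with diagonal entries `c 0, c 1, …`. -/
def diagRect (𝕜 : Type*) [RCLike 𝕜] (n₁ n₂ : ℕ) (c : ℕ → ℝ) : Matrix (Fin n₁) (Fin n₂) 𝕜 :=
  Matrix.of fun a b => if (a : ℕ) = (b : ℕ) then (c a : 𝕜) else 0

/-- `T` is diagonal with entries `c` with respect to the orthonormal bases `u` and `v`. -/
def IsDiagIn (T : EuclideanSpace 𝕜 (Fin n₂) →ₗ[𝕜] EuclideanSpace 𝕜 (Fin n₁)) (c : ℕ → ℝ)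
    (u : OrthonormalBasis (Fin n₁) 𝕜 (EuclideanSpace 𝕜 (Fin n₁)))
    (v : OrthonormalBasis (Fin n₂) 𝕜 (EuclideanSpace 𝕜 (Fin n₂))) : Prop :=
  ∀ j : Fin n₂, T (v j) = if h : (j : ℕ) < n₁ then ((c j : ℝ) : 𝕜) • u ⟨j, h⟩ else 0

theorem IsDiagIn.isRightSVBasis {T : EuclideanSpace 𝕜 (Fin n₂) →ₗ[𝕜] EuclideanSpace 𝕜 (Fin n₁)}
    {c : ℕ → ℝ} {u : OrthonormalBasis (Fin n₁) 𝕜 (EuclideanSpace 𝕜 (Fin n₁))}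
    {v : OrthonormalBasis (Fin n₂) 𝕜 (EuclideanSpace 𝕜 (Fin n₂))} (h : IsDiagIn T c u v) :
    IsRightSVBasis T (fun j => if j < n₁ then c j else 0) v := by
  intro i j
  rw [h i, h j]
  by_cases hi : (i : ℕ) < n₁ <;> by_cases hj : (j : ℕ) < n₁
  · simp only [hi, hj, dif_pos, inner_smul_left, inner_smul_right, OrthonormalBasis.inner_eq_ite,
      if_pos, RCLike.conj_ofReal, Fin.ext_iff]
    split_ifs with hij
    · rw [hij]; ring
    · simp
  · have : i ≠ j := by rintro rfl; exact hj hi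
    simp [hj, this]
  · have : i ≠ j := by rintro rfl; exact hi hj
    simp [hi, this]
  · simp [hi, hj]

theorem IsDiagIn.singularValues_eq
    {T : EuclideanSpace 𝕜 (Fin n₂) →ₗ[𝕜] EuclideanSpace 𝕜 (Fin n₁)}
    {c : ℕ → ℝ} {u : OrthonormalBasis (Fin n₁) 𝕜 (EuclideanSpace 𝕜 (Fin n₁))}
    {v : OrthonormalBasis (Fin n₂) 𝕜 (EuclideanSpace 𝕜 (Fin n₂))} (h : IsDiagIn T c u v)
    (hc0 : ∀ j, 0 ≤ c j) (hc : Antitone c) (j : ℕ) (hj : j < min n₁ n₂) :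
    T.singularValues j = c j := by
  rw [h.isRightSVBasis.singularValues_eq _ _ j (by omega), if_pos (by omega)]
  · intro j; split_ifs; exacts [hc0 j, le_rfl]
  · intro i j hij _
    split_ifs
    exacts [hc hij, by omega, hc0 i, le_rfl]

theorem singularValues_eq_zero_of_le
    (T : EuclideanSpace 𝕜 (Fin n₂) →ₗ[𝕜] EuclideanSpace 𝕜 (Fin n₁)) {j : ℕ} (hj : min n₁ n₂ ≤ j) :
    T.singularValues j = 0 := by
  rw [T.singularValues_eq_zero_iff_le_finrank_range]
  refine le_trans (le_min ?_ ?_) hj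
  · simpa using Submodule.finrank_le (LinearMap.range T)
  · simpa using LinearMap.finrank_range_le T

/-- The left vectors are T v_j/σ_j where σ_j ≠ 0, completed to an orthonormal basis. The generality
of `RCLike` serves self-conjugate slices, which need real factors. -/
theorem exists_isDiagIn (T : EuclideanSpace 𝕜 (Fin n₂) →ₗ[𝕜] EuclideanSpace 𝕜 (Fin n₁)) :
    ∃ u v, IsDiagIn T T.singularValues u v := by
  obtain ⟨v, hv⟩ := exists_isRightSVBasis T (q := n₂) (by simp)
  set σ := T.singularValues with hσ
  let w : Fin n₁ → EuclideanSpace 𝕜 (Fin n₁) := fun a =>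
    if h : (a : ℕ) < n₂ then (((σ a)⁻¹ : ℝ) : 𝕜) • T (v ⟨a, h⟩) else 0
  let s : Set (Fin n₁) := {a | (a : ℕ) < n₂ ∧ σ a ≠ 0}
  have hw : Orthonormal 𝕜 (s.domRestrict w) := by
    rw [orthonormal_iff_ite]
    rintro ⟨i, hi, hi0⟩ ⟨j, hj, hj0⟩
    simp only [Set.domRestrict_apply, w, hi, hj, dif_pos, inner_smul_left, inner_smul_right, hv _ _,
      RCLike.conj_ofReal, Fin.ext_iff, Subtype.ext_iff]
    split_ifs with hij
    · simp only [hij]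
      have : (σ j : 𝕜) ≠ 0 := by exact_mod_cast hj0
      push_cast
      field_simp
    · simp
  obtain ⟨u, hu⟩ := hw.exists_orthonormalBasis_extension_of_card_eq (by simp)
  refine ⟨u, v, fun j => ?_⟩
  have hz : σ j = 0 → T (v j) = 0 := fun h0 => by
    have := hv.norm_apply j (T.singularValues_nonneg _)
    rw [h0] at this
    exact norm_eq_zero.1 this
  split_ifs with h
  · by_cases h0 : σ j = 0
    · rw [hz h0, h0]; simp
    · rw [hu ⟨j, h⟩ ⟨j.2, h0⟩]
      have : (σ j : 𝕜) ≠ 0 := by exact_mod_cast h0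
      simp only [w, j.2, dif_pos, smul_smul, RCLike.ofReal_inv]
      rw [mul_inv_cancel₀ this, one_smul]
  · exact hz (singularValues_eq_zero_of_le T (by omega))

/-- The matrix whose columns are the vectors of an orthonormal basis. -/
def colMatrix {m : ℕ} (u : OrthonormalBasis (Fin m) 𝕜 (EuclideanSpace 𝕜 (Fin m))) :
    Matrix (Fin m) (Fin m) 𝕜 := Matrix.of fun a j => u j a

theorem colMatrix_mem {m : ℕ} (u : OrthonormalBasis (Fin m) 𝕜 (EuclideanSpace 𝕜 (Fin m))) :
    colMatrix u ∈ Matrix.unitaryGroup (Fin m) 𝕜 := by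
  rw [Matrix.mem_unitaryGroup_iff']
  ext i j
  have := u.inner_eq_ite i j
  rw [PiLp.inner_apply] at this
  simp only [Matrix.mul_apply, Matrix.star_apply, colMatrix, Matrix.of_apply, Matrix.one_apply]
  rw [← this]
  refine Finset.sum_congr rfl fun a _ => ?_
  rw [RCLike.inner_apply, mul_comm]; rfl

theorem exists_colMatrix_eq {m : ℕ} {U : Matrix (Fin m) (Fin m) 𝕜}
    (hU : U ∈ Matrix.unitaryGroup (Fin m) 𝕜) :
    ∃ u : OrthonormalBasis (Fin m) 𝕜 (EuclideanSpace 𝕜 (Fin m)), colMatrix u = U := by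
  let w : Fin m → EuclideanSpace 𝕜 (Fin m) := fun j => WithLp.toLp 2 fun a => U a j
  have hw : Orthonormal 𝕜 ((Set.univ : Set (Fin m)).domRestrict w) := by
    rw [orthonormal_iff_ite]
    rintro ⟨i, hi⟩ ⟨j, hj⟩
    have := congrFun (congrFun (Matrix.mem_unitaryGroup_iff'.1 hU) i) j
    simp only [Matrix.mul_apply, Matrix.star_apply, Matrix.one_apply] at this
    simp only [Set.domRestrict_apply, Subtype.ext_iff]
    rw [← this, PiLp.inner_apply]
    refine Finset.sum_congr rfl fun a _ => ?_
    rw [RCLike.inner_apply, mul_comm]; rfl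
  obtain ⟨u, hu⟩ := hw.exists_orthonormalBasis_extension_of_card_eq (by simp)
  refine ⟨u, ?_⟩
  ext a j
  simp only [colMatrix, Matrix.of_apply, hu j (Set.mem_univ j)]
  rfl

theorem isDiagIn_iff (A : Matrix (Fin n₁) (Fin n₂) 𝕜) (c : ℕ → ℝ)
    (u : OrthonormalBasis (Fin n₁) 𝕜 (EuclideanSpace 𝕜 (Fin n₁)))
    (v : OrthonormalBasis (Fin n₂) 𝕜 (EuclideanSpace 𝕜 (Fin n₂))) :
    IsDiagIn (Matrix.toEuclideanLin A) c u v ↔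
      A = colMatrix u * diagRect 𝕜 n₁ n₂ c * (colMatrix v).conjTranspose := by
  have h1 : IsDiagIn (Matrix.toEuclideanLin A) c u v ↔
      A * colMatrix v = colMatrix u * diagRect 𝕜 n₁ n₂ c := by
    rw [← Matrix.ext_iff, IsDiagIn, forall_comm]
    refine forall_congr' fun j => ?_
    rw [PiLp.ext_iff]
    refine forall_congr' fun a => ?_
    have e1 : (Matrix.toEuclideanLin A (v j)) a = (A * colMatrix v) a j := by
      simp [Matrix.toLpLin_apply, Matrix.mul_apply, colMatrix, Matrix.mulVec, dotProduct]
    have e2 : (if h : (j : ℕ) < n₁ then ((c j : ℝ) : 𝕜) • u ⟨j, h⟩ else 0 :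
        EuclideanSpace 𝕜 (Fin n₁)) a = (colMatrix u * diagRect 𝕜 n₁ n₂ c) a j := by
      simp only [Matrix.mul_apply, colMatrix, diagRect, Matrix.of_apply, mul_ite, mul_zero]
      split_ifs with h
      · rw [Finset.sum_eq_single (⟨j, h⟩ : Fin n₁)]
        · rw [if_pos rfl, PiLp.smul_apply, smul_eq_mul, mul_comm]
        · intro b _ hb
          rw [if_neg]
          intro hb'
          exact hb (Fin.ext hb')
        · simp
      · rw [Finset.sum_eq_zero]
        · simp
        · intro b _
          rw [if_neg]
          have := b.2
          omega
    rw [e1, e2]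
  have hv := colMatrix_mem v
  rw [h1]
  constructor
  · intro h
    rw [← h, Matrix.mul_assoc, ← Matrix.star_eq_conjTranspose, Matrix.mem_unitaryGroup_iff.1 hv,
      Matrix.mul_one]
  · intro h
    rw [h, Matrix.mul_assoc, ← Matrix.star_eq_conjTranspose, Matrix.mem_unitaryGroup_iff'.1 hv,
      Matrix.mul_one]

theorem rectDiag_congr {c d : ℕ → ℝ} (h : ∀ j < min n₁ n₂, c j = d j) :
    rectDiag n₁ n₂ c = rectDiag n₁ n₂ d := by
  ext a b
  simp only [rectDiag, Matrix.of_apply]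
  split_ifs with hab
  · rw [h a (by have := a.2; have := b.2; omega)]
  · rfl

/-- The factors of any singular value decomposition have the singular values on the diagonal. -/
theorem sval_eq_of_decomposition {A : Matrix (Fin n₁) (Fin n₂) ℂ} {U : Matrix (Fin n₁) (Fin n₁) ℂ}
    {V : Matrix (Fin n₂) (Fin n₂) ℂ} {c : ℕ → ℝ} (hU : U ∈ Matrix.unitaryGroup (Fin n₁) ℂ)
    (hV : V ∈ Matrix.unitaryGroup (Fin n₂) ℂ) (hA : A = U * rectDiag n₁ n₂ c * V.conjTranspose)
    (hc0 : ∀ j, 0 ≤ c j) (hc : Antitone c) (j : ℕ) (hj : j < min n₁ n₂) : sval A j = c j := by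
  obtain ⟨u, rfl⟩ := exists_colMatrix_eq hU
  obtain ⟨v, rfl⟩ := exists_colMatrix_eq hV
  exact ((isDiagIn_iff A c u v).2 hA).singularValues_eq hc0 hc j hj

theorem map_mem_unitaryGroup {R S : Type*} [CommRing R] [StarRing R] [CommRing S] [StarRing S]
    {m : ℕ} (φ : R →+* S) (hφ : ∀ x, φ (star x) = star (φ x)) {U : Matrix (Fin m) (Fin m) R}
    (hU : U ∈ Matrix.unitaryGroup (Fin m) R) : U.map φ ∈ Matrix.unitaryGroup (Fin m) S := by
  rw [Matrix.mem_unitaryGroup_iff] at hU ⊢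
  have : star (U.map φ) = (star U).map φ := by
    ext a b; simp [Matrix.star_apply, hφ]
  rw [this, ← Matrix.map_mul, hU, Matrix.map_one _ (map_zero φ) (map_one φ)]

/-- The last clause matters at frequencies with `negIdx i = i`: the slice is real there, and
conjugate symmetric tensor factors require real `U` and `V`. -/
theorem exists_svd (A : Matrix (Fin n₁) (Fin n₂) ℂ) :
    ∃ U ∈ Matrix.unitaryGroup (Fin n₁) ℂ, ∃ V ∈ Matrix.unitaryGroup (Fin n₂) ℂ,
      A = U * rectDiag n₁ n₂ (sval A) * V.conjTranspose ∧
      (A.map (starRingEnd ℂ) = A → U.map (starRingEnd ℂ) = U ∧ V.map (starRingEnd ℂ) = V) := by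
  by_cases hA : A.map (starRingEnd ℂ) = A
  · let B : Matrix (Fin n₁) (Fin n₂) ℝ := A.map Complex.re
    obtain ⟨u, v, h⟩ := exists_isDiagIn (Matrix.toEuclideanLin B)
    rw [isDiagIn_iff] at h
    set c := (Matrix.toEuclideanLin B).singularValues
    let φ : ℝ →+* ℂ := Complex.ofRealHom
    have hφ : ∀ x : ℝ, φ (star x) = star (φ x) := fun x => by simp [φ]
    have hU := map_mem_unitaryGroup φ hφ (colMatrix_mem u)
    have hV := map_mem_unitaryGroup φ hφ (colMatrix_mem v)
    have hAB : A = B.map φ := by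
      ext a b
      have := congrFun (congrFun hA a) b
      exact (Complex.conj_eq_iff_re.1 this).symm
    have hdec : A = (colMatrix u).map φ * rectDiag n₁ n₂ c *
        ((colMatrix v).map φ).conjTranspose := by
      rw [hAB, h, Matrix.map_mul, Matrix.map_mul]
      congr 1
      · congr 1
        ext a b
        simp only [diagRect, rectDiag, Matrix.map_apply, Matrix.of_apply]
        split_ifs <;> simp [φ]
      · ext a b
        simp [φ]
    refine ⟨_, hU, _, hV, ?_, fun _ => ⟨?_, ?_⟩⟩
    · rw [rectDiag_congr fun j hj => sval_eq_of_decomposition hU hV hdec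
        (LinearMap.singularValues_nonneg _) (LinearMap.singularValues_antitone _) j hj]
      exact hdec
    · ext a b; simp [φ]
    · ext a b; simp [φ]
  · obtain ⟨u, v, h⟩ := exists_isDiagIn (Matrix.toEuclideanLin A)
    rw [isDiagIn_iff] at h
    exact ⟨_, colMatrix_mem u, _, colMatrix_mem v, h, fun h => absurd h hA⟩

theorem map_conj_rectDiag (c : ℕ → ℝ) :
    (rectDiag n₁ n₂ c).map (starRingEnd ℂ) = rectDiag n₁ n₂ c := by
  ext a b
  simp only [rectDiag, Matrix.map_apply, Matrix.of_apply]
  split_ifs <;> simp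

theorem map_conj_decomposition (U : Matrix (Fin n₁) (Fin n₁) ℂ) (V : Matrix (Fin n₂) (Fin n₂) ℂ)
    (c : ℕ → ℝ) :
    (U * rectDiag n₁ n₂ c * V.conjTranspose).map (starRingEnd ℂ) =
      U.map (starRingEnd ℂ) * rectDiag n₁ n₂ c * (V.map (starRingEnd ℂ)).conjTranspose := by
  rw [Matrix.map_mul, Matrix.map_mul, map_conj_rectDiag]
  congr 1

theorem sval_map_conj (A : Matrix (Fin n₁) (Fin n₂) ℂ) (j : ℕ) :
    sval (A.map (starRingEnd ℂ)) j = sval A j := by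
  by_cases hj : j < min n₁ n₂
  · obtain ⟨U, hU, V, hV, h, -⟩ := exists_svd A
    have hc : ∀ x : ℂ, starRingEnd ℂ (star x) = star (starRingEnd ℂ x) := fun x => rfl
    refine sval_eq_of_decomposition (map_mem_unitaryGroup _ hc hU) (map_mem_unitaryGroup _ hc hV) ?_
      (LinearMap.singularValues_nonneg _) (LinearMap.singularValues_antitone _) j hj
    conv_lhs => rw [h]
    exact map_conj_decomposition _ _ _
  · exact (singularValues_eq_zero_of_le _ (not_lt.1 hj)).trans
      (singularValues_eq_zero_of_le _ (not_lt.1 hj)).symm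

theorem exists_isTSVD (hn : ∀ j, 0 < n j) (P : Tensor n₁ n₂ n) : ∃ U V, IsTSVD P U V := by
  choose U hU V hV hdec hreal using exists_svd (n₁ := n₁) (n₂ := n₂)
  let e := Fintype.equivFin (SliceIdx n)
  -- From each pair {i, -i} the enumeration `e` selects one index. The decomposition is chosen there
  -- and conjugated at the other, which yields the symmetry needed for real tensors.
  let W : ∀ {m : ℕ}, (Matrix (Fin n₁) (Fin n₂) ℂ → Matrix (Fin m) (Fin m) ℂ) →
      SliceIdx n → Matrix (Fin m) (Fin m) ℂ := fun f i =>
    if e i ≤ e (negIdx i) then f (fslice P i) else (f (fslice P (negIdx i))).map (starRingEnd ℂ)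
  have hW : ∀ {m : ℕ} (f : Matrix (Fin n₁) (Fin n₂) ℂ → Matrix (Fin m) (Fin m) ℂ),
      (∀ A, A.map (starRingEnd ℂ) = A → (f A).map (starRingEnd ℂ) = f A) →
      ∀ i, W f (negIdx i) = (W f i).map (starRingEnd ℂ) := by
    intro m f hf i
    simp only [W, negIdx_negIdx]
    rcases lt_trichotomy (e i) (e (negIdx i)) with h | h | h
    · rw [if_neg (not_le.2 h), if_pos h.le]
    · have hi : negIdx i = i := (e.injective h).symm
      rw [hi, if_pos le_rfl, hf]
      rw [← fslice_negIdx, hi]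
    · rw [if_pos h.le, if_neg (not_le.2 h)]
      ext a b; simp
  have hU' := hW U fun A hA => (hreal A hA).1
  have hV' := hW V fun A hA => (hreal A hA).2
  have hc : ∀ x : ℂ, starRingEnd ℂ (star x) = star (starRingEnd ℂ x) := fun x => rfl
  refine ⟨realInvDFT (W U), realInvDFT (W V), fun i => ?_⟩
  rw [fslice_realInvDFT hn _ hU', fslice_realInvDFT hn _ hV']
  simp only [W]
  split_ifs with h
  · exact ⟨hU _, hV _, hdec _⟩
  · refine ⟨map_mem_unitaryGroup _ hc (hU _), map_mem_unitaryGroup _ hc (hV _), ?_⟩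
    have h1 : fslice P i = (fslice P (negIdx i)).map (starRingEnd ℂ) := by
      rw [← fslice_negIdx, negIdx_negIdx]
    have h2 : sval (fslice P i) = sval (fslice P (negIdx i)) := by
      funext j; rw [h1, sval_map_conj]
    rw [h2, ← map_conj_decomposition, ← hdec, h1]

end MatrixSVD

/-! ### Duality between the tensor nuclear norm and slicewise operator norms; projection onto the
ball. -/

section Duality

/-- The operator norms of all Fourier slices of `Y` are at most `c`. -/
def SliceBound (Y : Tensor n₁ n₂ n) (c : ℝ) : Prop := ∀ i x, ‖slice Y i x‖ ≤ c * ‖x‖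

theorem sum_range_min_singularValues
    (T : EuclideanSpace ℂ (Fin n₂) →ₗ[ℂ] EuclideanSpace ℂ (Fin n₁)) :
    ∑ j ∈ Finset.range (min n₁ n₂), T.singularValues j = ∑ j : Fin n₂, T.singularValues j := by
  rw [Fin.sum_univ_eq_sum_range (fun j => T.singularValues j) n₂]
  refine Finset.sum_subset (Finset.range_subset_range.2 (min_le_right _ _)) fun j _ hj => ?_
  exact singularValues_eq_zero_of_le T (by simp at hj; omega)

theorem tnn_eq (X : Tensor n₁ n₂ n) :
    tnn X = 1 / (numSlices n : ℝ) * ∑ i, ∑ j : Fin n₂, (slice X i).singularValues j := by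
  unfold tnn
  congr 1
  exact Finset.sum_congr rfl fun i _ => sum_range_min_singularValues _

/-- Expand the trace in a right singular basis of `T` and apply Cauchy–Schwarz to each term. -/
theorem frob_le_of_bound {S T : EuclideanSpace ℂ (Fin n₂) →ₗ[ℂ] EuclideanSpace ℂ (Fin n₁)} {c : ℝ}
    (hS : ∀ x, ‖S x‖ ≤ c * ‖x‖) : frob S T ≤ c * ∑ j : Fin n₂, T.singularValues j := by
  obtain ⟨b, hb⟩ := exists_isRightSVBasis T (q := n₂) (by simp)
  rw [frob_eq_sum S T b, Finset.mul_sum]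
  refine Finset.sum_le_sum fun j _ => ?_
  refine (re_inner_le_norm _ _).trans ?_
  rw [hb.norm_apply j (T.singularValues_nonneg _)]
  have := hS (b j)
  rw [b.norm_eq_one, mul_one] at this
  exact mul_le_mul_of_nonneg_right this (T.singularValues_nonneg _)

theorem inner_le_of_sliceBound (hn : ∀ j, 0 < n j) {X Y : Tensor n₁ n₂ n} {c : ℝ}
    (hY : SliceBound Y c) : ⟪Y, X⟫_ℝ ≤ c * tnn X := by
  rw [inner_eq_sum_frob hn, tnn_eq, ← mul_assoc, mul_comm c, mul_assoc]
  refine mul_le_mul_of_nonneg_left ?_ (by positivity)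
  rw [Finset.mul_sum]
  exact Finset.sum_le_sum fun i _ => frob_le_of_bound (hY i)

theorem IsTSVD.exists_isDiagIn {P : Tensor n₁ n₂ n} {U : Tensor n₁ n₁ n} {V : Tensor n₂ n₂ n}
    (h : IsTSVD P U V) (i : SliceIdx n) :
    ∃ u v, fslice U i = colMatrix u ∧ fslice V i = colMatrix v ∧
      IsDiagIn (slice P i) (slice P i).singularValues u v := by
  obtain ⟨hU, hV, hP⟩ := h i
  obtain ⟨u, hu⟩ := exists_colMatrix_eq hU
  obtain ⟨v, hv⟩ := exists_colMatrix_eq hV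
  refine ⟨u, v, hu.symm, hv.symm, ?_⟩
  rw [slice, isDiagIn_iff, hu, hv]
  exact hP

/-- The slicewise product of orthogonal tensors with real diagonal matrices is the Fourier
transform of a real tensor. -/
theorem exists_fslice_eq (hn : ∀ j, 0 < n j) (U : Tensor n₁ n₁ n) (V : Tensor n₂ n₂ n)
    (c : SliceIdx n → ℕ → ℝ) (hc : ∀ i, c (negIdx i) = c i) :
    ∃ Z : Tensor n₁ n₂ n, ∀ i,
      fslice Z i = fslice U i * rectDiag n₁ n₂ (c i) * (fslice V i).conjTranspose := by
  refine ⟨realInvDFT fun i => fslice U i * rectDiag n₁ n₂ (c i) * (fslice V i).conjTranspose, ?_⟩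
  intro i
  rw [fslice_realInvDFT hn]
  intro i
  rw [map_conj_decomposition, fslice_negIdx, fslice_negIdx, hc]

theorem IsDiagIn.norm_apply_le
    {T : EuclideanSpace ℂ (Fin n₂) →ₗ[ℂ] EuclideanSpace ℂ (Fin n₁)}
    {c : ℕ → ℝ} {u : OrthonormalBasis (Fin n₁) ℂ (EuclideanSpace ℂ (Fin n₁))}
    {v : OrthonormalBasis (Fin n₂) ℂ (EuclideanSpace ℂ (Fin n₂))} (h : IsDiagIn T c u v)
    {d : ℝ} (hd : 0 ≤ d) (hc : ∀ j < min n₁ n₂, |c j| ≤ d) (x : EuclideanSpace ℂ (Fin n₂)) :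
    ‖T x‖ ≤ d * ‖x‖ := by
  refine le_of_sq_le_sq ?_ (by positivity)
  rw [h.isRightSVBasis.norm_sq_apply, mul_pow, ← v.sum_sq_norm_inner_right x, Finset.mul_sum]
  refine Finset.sum_le_sum fun j _ => ?_
  have : (if (j : ℕ) < n₁ then c j else 0) ^ 2 ≤ d ^ 2 := by
    split_ifs with hj
    · have := abs_le.1 (hc j (by omega))
      exact sq_le_sq' this.1 this.2
    · simpa using sq_nonneg d
  gcongr

/-- The Frobenius inner product of two maps which are diagonal in the same bases. -/
theorem IsDiagIn.frob_eq
    {S T : EuclideanSpace ℂ (Fin n₂) →ₗ[ℂ] EuclideanSpace ℂ (Fin n₁)}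
    {c d : ℕ → ℝ} {u : OrthonormalBasis (Fin n₁) ℂ (EuclideanSpace ℂ (Fin n₁))}
    {v : OrthonormalBasis (Fin n₂) ℂ (EuclideanSpace ℂ (Fin n₂))} (hS : IsDiagIn S c u v)
    (hT : IsDiagIn T d u v) : frob S T = ∑ j ∈ Finset.range (min n₁ n₂), c j * d j := by
  rw [frob_eq_sum S T v]
  have h1 : ∀ j : Fin n₂, RCLike.re ⟪S (v j), T (v j)⟫_ℂ =
      if (j : ℕ) < n₁ then c j * d j else 0 := by
    intro j
    rw [hS j, hT j]
    split_ifs with hj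
    · rw [inner_smul_left, inner_smul_right, u.inner_eq_one]
      simp
    · simp
  rw [Finset.sum_congr rfl fun j _ => h1 j,
    Fin.sum_univ_eq_sum_range (fun j => if j < n₁ then c j * d j else 0) n₂, ← Finset.sum_filter]
  refine Finset.sum_congr ?_ fun _ _ => rfl
  ext j
  simp [and_comm]

/-- The maximizer is the polar factor U Vᴴ of a t-SVD: all diagonal entries are replaced by one. -/
theorem exists_dual_certificate (hn : ∀ j, 0 < n j) (X : Tensor n₁ n₂ n) :
    ∃ Y : Tensor n₁ n₂ n, SliceBound Y 1 ∧ ⟪Y, X⟫_ℝ = tnn X := by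
  obtain ⟨U, V, h⟩ := exists_isTSVD hn X
  obtain ⟨Y, hY⟩ := exists_fslice_eq hn U V (fun _ _ => 1) fun _ => rfl
  have key : ∀ i, ∃ u v, IsDiagIn (slice X i) (slice X i).singularValues u v ∧
      IsDiagIn (slice Y i) (fun _ => 1) u v := by
    intro i
    obtain ⟨u, v, hu, hv, hd⟩ := h.exists_isDiagIn i
    refine ⟨u, v, hd, ?_⟩
    rw [slice, isDiagIn_iff, hY, hu, hv]
    rfl
  refine ⟨Y, fun i x => ?_, ?_⟩
  · obtain ⟨u, v, -, hd⟩ := key i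
    exact hd.norm_apply_le zero_le_one (by simp) x
  · rw [inner_eq_sum_frob hn, tnn]
    congr 1
    refine Finset.sum_congr rfl fun i _ => ?_
    obtain ⟨u, v, hX, hd⟩ := key i
    rw [hd.frob_eq hX]
    simp [sval_fslice]

/-- Exhibiting the ball as an intersection of half-spaces gives convexity and closedness at once,
without a triangle inequality for `tnn`. -/
theorem mem_ball_iff (hn : ∀ j, 0 < n j) (X : Tensor n₁ n₂ n) :
    X ∈ ball n₁ n₂ n ↔ ∀ Y : Tensor n₁ n₂ n, SliceBound Y 1 → ⟪Y, X⟫_ℝ ≤ 1 := by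
  constructor
  · intro hX Y hY
    exact (inner_le_of_sliceBound hn hY).trans (by simpa [ball] using hX)
  · intro h
    obtain ⟨Y, hY, hXY⟩ := exists_dual_certificate hn X
    exact hXY.symm.le.trans (h Y hY)

theorem ball_eq_iInter (hn : ∀ j, 0 < n j) : ball n₁ n₂ n =
    ⋂ (Y : Tensor n₁ n₂ n) (_ : SliceBound Y 1), {X | ⟪Y, X⟫_ℝ ≤ 1} := by
  ext X
  simp [mem_ball_iff hn]

theorem convex_ball (hn : ∀ j, 0 < n j) : Convex ℝ (ball n₁ n₂ n) := by
  rw [ball_eq_iInter hn]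
  exact convex_iInter₂ fun Y _ => convex_halfSpace_le (innerSL ℝ Y).isBoundedLinearMap.toIsLinearMap 1

theorem isClosed_ball (hn : ∀ j, 0 < n j) : IsClosed (ball n₁ n₂ n) := by
  rw [ball_eq_iInter hn]
  exact isClosed_iInter fun Y => isClosed_iInter fun _ => isClosed_le (by fun_prop) (by fun_prop)

theorem zero_mem_ball (hn : ∀ j, 0 < n j) : (0 : Tensor n₁ n₂ n) ∈ ball n₁ n₂ n := by
  rw [mem_ball_iff hn]; simp

theorem isProj_of_inner_le {P Z : Tensor n₁ n₂ n} (hZ : Z ∈ ball n₁ n₂ n)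
    (h : ∀ W ∈ ball n₁ n₂ n, ⟪P - Z, W - Z⟫_ℝ ≤ 0) : IsProj P Z := by
  refine ⟨hZ, fun W hW => ?_⟩
  have h1 := h W hW
  have h2 : ‖P - W‖ ^ 2 = ‖P - Z‖ ^ 2 - 2 * ⟪P - Z, W - Z⟫_ℝ + ‖W - Z‖ ^ 2 := by
    rw [← norm_sub_sq_real]; congr 2; abel
  refine le_of_sq_le_sq ?_ (norm_nonneg _)
  nlinarith [sq_nonneg ‖W - Z‖]

theorem IsProj.inner_le (hn : ∀ j, 0 < n j) {P Z : Tensor n₁ n₂ n} (h : IsProj P Z)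
    {W : Tensor n₁ n₂ n} (hW : W ∈ ball n₁ n₂ n) : ⟪P - Z, W - Z⟫_ℝ ≤ 0 := by
  refine (norm_eq_iInf_iff_real_inner_le_zero (convex_ball hn) h.1).1 ?_ W hW
  have : Nonempty (ball n₁ n₂ n) := ⟨⟨Z, h.1⟩⟩
  exact le_antisymm (le_ciInf fun W => h.2 W W.2)
    (ciInf_le ⟨0, by rintro _ ⟨x, rfl⟩; exact norm_nonneg _⟩ (⟨Z, h.1⟩ : ball n₁ n₂ n))

theorem exists_isProj (hn : ∀ j, 0 < n j) (P : Tensor n₁ n₂ n) : ∃ Z, IsProj P Z := by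
  obtain ⟨Z, hZ, h⟩ := exists_norm_eq_iInf_of_complete_convex ⟨0, zero_mem_ball hn⟩
    (isClosed_ball (n₁ := n₁) (n₂ := n₂) hn).isComplete (convex_ball hn) P
  exact ⟨Z, isProj_of_inner_le hZ
    ((norm_eq_iInf_iff_real_inner_le_zero (convex_ball hn) hZ).1 h)⟩

theorem IsProj.unique (hn : ∀ j, 0 < n j) {P Z Z' : Tensor n₁ n₂ n} (h : IsProj P Z)
    (h' : IsProj P Z') : Z = Z' := by
  have h1 := h.inner_le hn h'.1
  have h2 := h'.inner_le hn h.1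
  have h3 : ⟪Z - Z', Z - Z'⟫_ℝ = ⟪P - Z, Z' - Z⟫_ℝ + ⟪P - Z', Z - Z'⟫_ℝ := by
    rw [← neg_sub Z Z', inner_neg_right, neg_add_eq_sub, ← inner_sub_left]
    congr 1; abel
  have h4 : ⟪Z - Z', Z - Z'⟫_ℝ = 0 :=
    le_antisymm (by linarith) real_inner_self_nonneg
  exact sub_eq_zero.1 (inner_self_eq_zero.1 h4)

end Duality

/-! ### Soft-thresholding and exactness of the truncated projection. -/

section Truncation

/-- The sum over the slices of the `r` leading singular values soft-thresholded at level `s`. -/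
def thresholdSum (r : ℕ) (P : Tensor n₁ n₂ n) (s : ℝ) : ℝ :=
  ∑ i : SliceIdx n, ∑ j ∈ Finset.range r, max 0 (sval (fslice P i) j - s)

theorem sval_nonneg {p q : Type*} [Fintype p] [Fintype q] [DecidableEq q] (A : Matrix p q ℂ)
    (j : ℕ) : 0 ≤ sval A j := LinearMap.singularValues_nonneg _ j

theorem sval_antitone {p q : Type*} [Fintype p] [Fintype q] [DecidableEq q] (A : Matrix p q ℂ) :
    Antitone (sval A) := LinearMap.singularValues_antitone _

theorem thresholdSum_lt_of_lt {r : ℕ} {P : Tensor n₁ n₂ n} {s t : ℝ} (hst : s < t)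
    (ht : 0 < thresholdSum r P t) : thresholdSum r P t < thresholdSum r P s := by
  unfold thresholdSum at *
  obtain ⟨i, -, hi⟩ := Finset.exists_lt_of_sum_lt
    (show ∑ i : SliceIdx n, (0 : ℝ) < _ by simpa using ht)
  obtain ⟨j, hj, hij⟩ := Finset.exists_lt_of_sum_lt
    (show ∑ j ∈ Finset.range r, (0 : ℝ) < _ by simpa using hi)
  have hmono : ∀ x : ℝ, max 0 (x - t) ≤ max 0 (x - s) := fun x => max_le_max le_rfl (by linarith)
  refine Finset.sum_lt_sum (fun i _ => Finset.sum_le_sum fun j _ => hmono _)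
    ⟨i, Finset.mem_univ i, Finset.sum_lt_sum (fun j _ => hmono _) ⟨j, hj, ?_⟩⟩
  have h1 : 0 < sval (fslice P i) j - t := by
    rcases lt_max_iff.1 hij with h | h
    · exact absurd h (lt_irrefl _)
    · exact h
  rw [max_eq_right h1.le]
  exact lt_max_of_lt_right (by linarith)

/-- Trace duality directly from a diagonal form, so that the singular values of a thresholded matrix
never have to be computed. -/
theorem IsDiagIn.frob_le
    {S T : EuclideanSpace ℂ (Fin n₂) →ₗ[ℂ] EuclideanSpace ℂ (Fin n₁)}
    {d : ℕ → ℝ} {u : OrthonormalBasis (Fin n₁) ℂ (EuclideanSpace ℂ (Fin n₁))}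
    {v : OrthonormalBasis (Fin n₂) ℂ (EuclideanSpace ℂ (Fin n₂))} (hT : IsDiagIn T d u v)
    (hd : ∀ j, 0 ≤ d j) (hS : ∀ x, ‖S x‖ ≤ ‖x‖) :
    frob S T ≤ ∑ j ∈ Finset.range (min n₁ n₂), d j := by
  have h1 : ∀ j : Fin n₂, RCLike.re ⟪S (v j), T (v j)⟫_ℂ ≤ if (j : ℕ) < n₁ then d j else 0 := by
    intro j
    refine (re_inner_le_norm _ _).trans ?_
    have h2 : ‖S (v j)‖ ≤ 1 := (hS _).trans (by simp)
    rw [hT j]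
    split_ifs with hj
    · rw [norm_smul, u.norm_eq_one, mul_one]
      simp only [RCLike.norm_ofReal, abs_of_nonneg (hd j)]
      exact mul_le_of_le_one_left (hd j) h2
    · simp
  rw [frob_eq_sum S T v]
  refine (Finset.sum_le_sum fun j _ => h1 j).trans (le_of_eq ?_)
  rw [Fin.sum_univ_eq_sum_range (fun j => if j < n₁ then d j else 0) n₂, ← Finset.sum_filter]
  refine Finset.sum_congr ?_ fun _ _ => rfl
  ext j
  simp [and_comm]

theorem IsDiagIn.sub
    {S T : EuclideanSpace ℂ (Fin n₂) →ₗ[ℂ] EuclideanSpace ℂ (Fin n₁)}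
    {c d : ℕ → ℝ} {u : OrthonormalBasis (Fin n₁) ℂ (EuclideanSpace ℂ (Fin n₁))}
    {v : OrthonormalBasis (Fin n₂) ℂ (EuclideanSpace ℂ (Fin n₂))} (hS : IsDiagIn S c u v)
    (hT : IsDiagIn T d u v) : IsDiagIn (S - T) (fun j => c j - d j) u v := by
  intro j
  rw [LinearMap.sub_apply, hS j, hT j]
  split_ifs with h
  · rw [← sub_smul]; simp
  · simp

theorem abs_sub_max_le {x s : ℝ} (hx : 0 ≤ x) (hs : 0 ≤ s) : |x - max 0 (x - s)| ≤ s := by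
  rw [abs_le]
  rcases le_total 0 (x - s) with h | h
  · rw [max_eq_right h]; constructor <;> linarith
  · rw [max_eq_left h]; constructor <;> linarith

/-- Truncation is harmless if the thresholded sum at some level above the discarded singular values
is at least one. -/
theorem IsTruncProj.isProj (hn : ∀ j, 0 < n j) {r : ℕ} (hr : r ≤ min n₁ n₂) {P Z : Tensor n₁ n₂ n}
    {s₀ : ℝ} (hs₀ : ∀ i, sval (fslice P i) r ≤ s₀)
    (hsum : (numSlices n : ℝ) ≤ thresholdSum r P s₀) (h : IsTruncProj r P Z) : IsProj P Z := by
  obtain ⟨U, V, σ, hUV, hσ0, hσ, hZ⟩ := h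
  have hN : (0 : ℝ) < numSlices n := by exact_mod_cast numSlices_pos hn
  have hσ' : thresholdSum r P σ = numSlices n ∨ thresholdSum r P σ ≤ numSlices n ∧ σ = 0 := by
    rcases hσ with h | ⟨rfl, h⟩
    · left
      have : 1 / (numSlices n : ℝ) * thresholdSum r P σ = 1 := h
      field_simp at this
      linarith
    · right
      refine ⟨?_, rfl⟩
      have h2 : thresholdSum r P 0 = ∑ i : SliceIdx n, ∑ j ∈ Finset.range r, sval (fslice P i) j :=
        Finset.sum_congr rfl fun i _ => Finset.sum_congr rfl fun j _ => by
          rw [sub_zero, max_eq_right (sval_nonneg _ _)]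
      rw [← h2, one_div, inv_mul_le_iff₀ hN, mul_one] at h
      exact h
  have hle : thresholdSum r P σ ≤ numSlices n := by
    rcases hσ' with h | h
    exacts [h.le, h.1]
  -- A level below `s₀` would give a sum strictly larger than the one at `s₀`, which is already at
  -- least N.
  have hs₀σ : s₀ ≤ σ := by
    by_contra hlt
    have := thresholdSum_lt_of_lt (not_le.1 hlt) (hN.trans_le hsum)
    linarith
  have heq : thresholdSum r P σ = numSlices n := by
    rcases hσ' with h | ⟨h1, h2⟩
    · exact h
    · refine le_antisymm h1 (hsum.trans (le_of_eq ?_))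
      have i₀ : SliceIdx n := fun j => ⟨0, hn j⟩
      have : 0 ≤ s₀ := (sval_nonneg _ _).trans (hs₀ i₀)
      -- Here σ = 0, and 0 ≤ `s₀` ≤ σ forces the two levels to coincide.
      rw [show s₀ = σ by linarith]
  -- Beyond index `r` all singular values lie below `s₀` ≤ σ, so the truncation discards only zeros.
  have hz : ∀ i j, (if j < r then max 0 (sval (fslice P i) j - σ) else 0) =
      max 0 (sval (fslice P i) j - σ) := by
    intro i j
    split_ifs with hj
    · rfl
    · rw [max_eq_left]
      have := sval_antitone (fslice P i) (not_lt.1 hj)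
      linarith [hs₀ i]
  simp only [hz] at hZ
  have key : ∀ i, ∃ u v, IsDiagIn (slice P i) (sval (fslice P i)) u v ∧
      IsDiagIn (slice Z i) (fun j => max 0 (sval (fslice P i) j - σ)) u v := by
    intro i
    obtain ⟨u, v, hu, hv, hd⟩ := hUV.exists_isDiagIn i
    refine ⟨u, v, hd, ?_⟩
    rw [slice, isDiagIn_iff, hZ, hu, hv]
    rfl
  have hsumz : ∑ i, ∑ j ∈ Finset.range (min n₁ n₂), max 0 (sval (fslice P i) j - σ) =
      numSlices n := by
    rw [← heq, thresholdSum]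
    refine Finset.sum_congr rfl fun i _ => ?_
    refine (Finset.sum_subset (Finset.range_subset_range.2 hr) fun j _ hj => ?_).symm
    rw [← hz, if_neg (by simpa using hj)]
  refine isProj_of_inner_le ?_ fun W hW => ?_
  · rw [mem_ball_iff hn]
    intro Y hY
    rw [inner_eq_sum_frob hn, one_div, inv_mul_le_iff₀ hN, mul_one, ← hsumz]
    refine Finset.sum_le_sum fun i _ => ?_
    obtain ⟨u, v, -, hd⟩ := key i
    exact hd.frob_le (fun j => le_max_left _ _) fun x => by simpa using hY i x
  -- The residual has diagonal entries min(σ_j, σ): its dual norm is at most σ, and σ is attained at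
  -- `Z`. This is the variational inequality of the projection.
  · have hb : SliceBound (P - Z) σ := by
      intro i x
      obtain ⟨u, v, hP, hd⟩ := key i
      rw [slice_sub]
      exact (hP.sub hd).norm_apply_le hσ0 (fun j _ => abs_sub_max_le (sval_nonneg _ _) hσ0) x
    have h1 : ⟪P - Z, W⟫_ℝ ≤ σ := by
      refine (inner_le_of_sliceBound hn hb).trans ?_
      exact mul_le_of_le_one_right hσ0 hW
    have h2 : ⟪P - Z, Z⟫_ℝ = σ := by
      rw [inner_eq_sum_frob hn]
      have : ∀ i, frob (slice (P - Z) i) (slice Z i) =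
          ∑ j ∈ Finset.range (min n₁ n₂), σ * max 0 (sval (fslice P i) j - σ) := by
        intro i
        obtain ⟨u, v, hP, hd⟩ := key i
        rw [slice_sub, (hP.sub hd).frob_eq hd]
        refine Finset.sum_congr rfl fun j _ => ?_
        rcases le_total 0 (sval (fslice P i) j - σ) with h | h
        · rw [max_eq_right h]; ring
        · rw [max_eq_left h]; ring
      simp only [this, ← Finset.mul_sum]
      rw [hsumz]
      field_simp
    rw [inner_sub_right]
    linarith

theorem exists_isTruncProj (hn : ∀ j, 0 < n j) {r : ℕ} {P : Tensor n₁ n₂ n}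
    {s₀ : ℝ} (hs₀ : 0 ≤ s₀) (hsum : (numSlices n : ℝ) ≤ thresholdSum r P s₀) :
    ∃ Z, IsTruncProj r P Z := by
  have hN : (0 : ℝ) < numSlices n := by exact_mod_cast numSlices_pos hn
  obtain ⟨σ, hσ, hσeq⟩ : ∃ σ, 0 ≤ σ ∧ thresholdSum r P σ = numSlices n := by
    -- This level lies above all singular values, so the thresholded sum vanishes there and the
    -- intermediate value theorem applies between `s₀` and `M`.
    let M : ℝ := s₀ + ∑ i : SliceIdx n, sval (fslice P i) 0
    have hM : thresholdSum r P M = 0 := by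
      unfold thresholdSum
      refine Finset.sum_eq_zero fun i _ => Finset.sum_eq_zero fun j _ => max_eq_left ?_
      have h1 := Finset.single_le_sum (f := fun i => sval (fslice P i) 0)
        (fun i _ => sval_nonneg (fslice P i) 0) (Finset.mem_univ i)
      have h2 := sval_antitone (fslice P i) (Nat.zero_le j)
      simp only [M]
      linarith
    have hsM : s₀ ≤ M := le_add_of_nonneg_right (Finset.sum_nonneg fun i _ => sval_nonneg _ _)
    have hcont : Continuous (thresholdSum r P) := by unfold thresholdSum; fun_prop
    obtain ⟨σ, hσ, h⟩ := intermediate_value_Icc' hsM hcont.continuousOn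
      (show (numSlices n : ℝ) ∈ Set.Icc (thresholdSum r P M) (thresholdSum r P s₀) from
        ⟨hM ▸ hN.le, hsum⟩)
    exact ⟨σ, hs₀.trans hσ.1, h⟩
  obtain ⟨U, V, h⟩ := exists_isTSVD hn P
  obtain ⟨Z, hZ⟩ := exists_fslice_eq hn U V
    (fun i j => if j < r then max 0 (sval (fslice P i) j - σ) else 0)
    -- Conjugate slices have equal singular values, so the thresholded tensor is again real.
    fun i => by funext j; rw [fslice_negIdx, sval_map_conj]
  refine ⟨Z, U, V, σ, h, hσ, Or.inl ?_, hZ⟩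
  show 1 / (numSlices n : ℝ) * thresholdSum r P σ = 1
  rw [hσeq]
  field_simp

/-- The converse of `IsTruncProj.isProj` comes from existence of some truncated projection together
with uniqueness of the Euclidean one. -/
theorem isProj_iff_isTruncProj (hn : ∀ j, 0 < n j) {r : ℕ} (hr : r ≤ min n₁ n₂)
    {P : Tensor n₁ n₂ n} {s₀ : ℝ} (hs₀ : ∀ i, sval (fslice P i) r ≤ s₀)
    (hsum : (numSlices n : ℝ) ≤ thresholdSum r P s₀) (Z : Tensor n₁ n₂ n) :
    IsProj P Z ↔ IsTruncProj r P Z := by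
  refine ⟨fun h => ?_, fun h => h.isProj hn hr hs₀ hsum⟩
  have i₀ : SliceIdx n := fun j => ⟨0, hn j⟩
  obtain ⟨Z', hZ'⟩ := exists_isTruncProj hn ((sval_nonneg _ _).trans (hs₀ i₀)) hsum
  rw [h.unique hn (hZ'.isProj hn hr hs₀ hsum)]
  exact hZ'

end Truncation

/-! ### Smooth convex analysis and the potential of the fast projected gradient method. -/

section SmoothConvex

variable {E : Type*} [NormedAddCommGroup E] [InnerProductSpace ℝ E] [CompleteSpace E]

theorem hasDerivAt_line {f : E → ℝ} (hf : Differentiable ℝ f) (X D : E) (t : ℝ) :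
    HasDerivAt (fun t : ℝ => f (X + t • D)) ⟪∇ f (X + t • D), D⟫_ℝ t := by
  have h1 : HasDerivAt (fun t : ℝ => X + t • D) D t := by
    simpa using ((hasDerivAt_id t).smul_const D).const_add X
  have h2 := (hf (X + t • D)).hasGradientAt.hasFDerivAt.comp_hasDerivAt t h1
  rw [InnerProductSpace.toDual_apply_apply] at h2
  exact h2

/-- Strong convexity of the outer function gives a quadratic lower bound at every point. -/
theorem add_inner_gradient_add_le {F : Type*} [NormedAddCommGroup F] [InnerProductSpace ℝ F]
    {f : E → ℝ} {g : F → ℝ} {A : E →ₗ[ℝ] F} {C : E} {α : ℝ} (hf : ∀ X, f X = g (A X) + ⟪C, X⟫_ℝ)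
    (hg : StrongConvexOn Set.univ α g) (hd : Differentiable ℝ f) (X Y : E) :
    f X + ⟪∇ f X, Y - X⟫_ℝ + α / 2 * ‖A (Y - X)‖ ^ 2 ≤ f Y := by
  have h0 := hasDerivAt_line hd X (Y - X) 0
  rw [zero_smul, add_zero] at h0
  have h1 := h0.tendsto_slope_zero_right
  -- Strong convexity bounds the slope of f on the segment at time t by this function of t; letting
  -- t → 0⁺ gives the claim.
  have h2 : Filter.Tendsto (fun t : ℝ => f Y - f X - (1 - t) * (α / 2 * ‖A (Y - X)‖ ^ 2))
      (nhdsWithin 0 (Set.Ioi 0)) (nhds (f Y - f X - (1 - 0) * (α / 2 * ‖A (Y - X)‖ ^ 2))) := by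
    refine Filter.Tendsto.mono_left ?_ nhdsWithin_le_nhds
    exact Continuous.tendsto (by fun_prop) 0
  have h3 := le_of_tendsto_of_tendsto h1 h2 ?_
  · linarith
  · have : Set.Ioo (0 : ℝ) 1 ∈ nhdsWithin (0 : ℝ) (Set.Ioi 0) := Ioo_mem_nhdsGT one_pos
    filter_upwards [this] with t ht
    have hc := hg.2 (Set.mem_univ (A X)) (Set.mem_univ (A Y)) (sub_nonneg.2 ht.2.le) ht.1.le
      (by ring)
    have e1 : A (X + t • (Y - X)) = (1 - t) • A X + t • A Y := by
      simp only [map_add, map_smul, map_sub]; module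
    have e2 : ⟪C, X + t • (Y - X)⟫_ℝ = (1 - t) * ⟪C, X⟫_ℝ + t * ⟪C, Y⟫_ℝ := by
      simp only [inner_add_right, inner_smul_right, inner_sub_right]; ring
    have e3 : ‖A X - A Y‖ = ‖A (Y - X)‖ := by rw [map_sub, norm_sub_rev]
    rw [e3] at hc
    simp only [smul_eq_mul, zero_add, zero_smul, add_zero] at hc ⊢
    rw [inv_mul_le_iff₀ ht.1, hf (X + _), hf X, hf Y, e1, e2]
    nlinarith

/-- The descent lemma without integration: along the segment, f minus its quadratic majorant has
nonpositive derivative. -/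
theorem le_add_inner_gradient_add {f : E → ℝ} {β : ℝ} (hd : Differentiable ℝ f)
    (hL : ∀ X Y, ‖∇ f X - ∇ f Y‖ ≤ β * ‖X - Y‖) (X Y : E) :
    f Y ≤ f X + ⟪∇ f X, Y - X⟫_ℝ + β / 2 * ‖Y - X‖ ^ 2 := by
  set D := Y - X with hD
  let φ : ℝ → ℝ := fun t => f (X + t • D) - (t * ⟪∇ f X, D⟫_ℝ + β / 2 * ‖D‖ ^ 2 * t ^ 2)
  have hφ : ∀ t, HasDerivAt φ
      (⟪∇ f (X + t • D), D⟫_ℝ - (⟪∇ f X, D⟫_ℝ + β * ‖D‖ ^ 2 * t)) t := by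
    intro t
    refine (hasDerivAt_line hd X D t).sub ?_
    have := ((hasDerivAt_id t).mul_const ⟪∇ f X, D⟫_ℝ).add
      ((hasDerivAt_pow 2 t).const_mul (β / 2 * ‖D‖ ^ 2))
    refine HasDerivAt.congr_deriv this ?_
    rw [one_mul, pow_one]
    push_cast
    ring
  have hanti : AntitoneOn φ (Set.Icc 0 1) := by
    refine antitoneOn_of_deriv_nonpos (convex_Icc 0 1)
      (fun t _ => (hφ t).continuousAt.continuousWithinAt)
      (fun t _ => (hφ t).differentiableAt.differentiableWithinAt) fun t ht => ?_
    rw [interior_Icc] at ht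
    rw [(hφ t).deriv]
    have h1 := real_inner_le_norm (∇ f (X + t • D) - ∇ f X) D
    have h2 := hL (X + t • D) X
    rw [add_sub_cancel_left, norm_smul, Real.norm_eq_abs, abs_of_pos ht.1] at h2
    rw [inner_sub_left] at h1
    have := mul_le_mul_of_nonneg_right h2 (norm_nonneg D)
    nlinarith
  have := hanti (Set.left_mem_Icc.2 zero_le_one) (Set.right_mem_Icc.2 zero_le_one) zero_le_one
  simp only [φ, one_smul, zero_smul, add_zero] at this
  have hXD : X + D = Y := by rw [hD]; abel
  rw [hXD] at this
  linarith

/-- Evaluate f at the point Y - g/β, with g the gradient difference: convexity at X bounds it below,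
descent from Y bounds it above. -/
theorem gradient_cocoercive {f : E → ℝ} {β : ℝ} (hβ : 0 < β)
    (hconv : ∀ X Y, f X + ⟪∇ f X, Y - X⟫_ℝ ≤ f Y)
    (hdesc : ∀ X Y, f Y ≤ f X + ⟪∇ f X, Y - X⟫_ℝ + β / 2 * ‖Y - X‖ ^ 2) (X Y : E) :
    f X + ⟪∇ f X, Y - X⟫_ℝ + 1 / (2 * β) * ‖∇ f Y - ∇ f X‖ ^ 2 ≤ f Y := by
  set g := ∇ f Y - ∇ f X with hg
  have h1 := hconv X (Y - (1 / β) • g)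
  have h2 := hdesc Y (Y - (1 / β) • g)
  have e1 : Y - (1 / β) • g - Y = -((1 / β) • g) := by abel
  have e2 : Y - (1 / β) • g - X = (Y - X) - (1 / β) • g := by abel
  rw [e1, norm_neg, norm_smul, inner_neg_right, inner_smul_right, mul_pow, Real.norm_eq_abs,
    sq_abs] at h2
  rw [e2, inner_sub_right, inner_smul_right] at h1
  have e3 : ⟪∇ f Y, g⟫_ℝ - ⟪∇ f X, g⟫_ℝ = ‖g‖ ^ 2 := by
    rw [← inner_sub_left, real_inner_self_eq_norm_sq]
  have e4 : β / 2 * ((1 / β) ^ 2 * ‖g‖ ^ 2) = 1 / (2 * β) * ‖g‖ ^ 2 := by field_simp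
  have e5 : 1 / β * ‖g‖ ^ 2 = 2 * (1 / (2 * β) * ‖g‖ ^ 2) := by field_simp
  rw [e4] at h2
  rw [← e3, mul_sub] at e5
  rw [e3] at e5
  linarith

/-- Gradient steps of length `1/β` are nonexpansive. -/
theorem gradient_step_nonexpansive {f : E → ℝ} {β : ℝ} (hβ : 0 < β)
    (hconv : ∀ X Y, f X + ⟪∇ f X, Y - X⟫_ℝ ≤ f Y)
    (hdesc : ∀ X Y, f Y ≤ f X + ⟪∇ f X, Y - X⟫_ℝ + β / 2 * ‖Y - X‖ ^ 2) (X Y : E) :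
    ‖(Y - (1 / β) • ∇ f Y) - (X - (1 / β) • ∇ f X)‖ ≤ ‖Y - X‖ := by
  have h1 := gradient_cocoercive hβ hconv hdesc X Y
  have h2 := gradient_cocoercive hβ hconv hdesc Y X
  rw [norm_sub_rev, ← neg_sub Y X, inner_neg_right] at h2
  have e : (Y - (1 / β) • ∇ f Y) - (X - (1 / β) • ∇ f X) =
      (Y - X) - (1 / β) • (∇ f Y - ∇ f X) := by module
  set g := ∇ f Y - ∇ f X with hg
  have h3 : 1 / β * ‖g‖ ^ 2 ≤ ⟪Y - X, g⟫_ℝ := by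
    rw [real_inner_comm, hg, inner_sub_left]
    have : 1 / β * ‖g‖ ^ 2 = 2 * (1 / (2 * β) * ‖g‖ ^ 2) := by field_simp
    rw [← hg]
    linarith
  refine le_of_sq_le_sq ?_ (norm_nonneg _)
  rw [e, norm_sub_sq_real, inner_smul_right, norm_smul, mul_pow, Real.norm_eq_abs, sq_abs]
  have hb : 0 < 1 / β := by positivity
  nlinarith [mul_le_mul_of_nonneg_left h3 hb.le, mul_nonneg hb.le hb.le, sq_nonneg ‖g‖,
    mul_nonneg (mul_nonneg hb.le hb.le) (sq_nonneg ‖g‖)]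

theorem inner_gradient_nonneg_of_isMin {f : E → ℝ} (hd : Differentiable ℝ f) {B : Set E}
    (hB : Convex ℝ B) {X : E} (hX : X ∈ B) (hmin : ∀ Y ∈ B, f X ≤ f Y) {Y : E} (hY : Y ∈ B) :
    0 ≤ ⟪∇ f X, Y - X⟫_ℝ := by
  have h0 := hasDerivAt_line hd X (Y - X) 0
  rw [zero_smul, add_zero] at h0
  refine ge_of_tendsto h0.tendsto_slope_zero_right ?_
  have : Set.Ioo (0 : ℝ) 1 ∈ nhdsWithin (0 : ℝ) (Set.Ioi 0) := Ioo_mem_nhdsGT one_pos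
  filter_upwards [this] with t ht
  have h1 := hmin (X + t • (Y - X)) (hB.add_smul_sub_mem hX hY ⟨ht.1.le, ht.2.le⟩)
  simp only [zero_add, zero_smul, add_zero, smul_eq_mul]
  exact mul_nonneg (inv_nonneg.2 ht.1.le) (by linarith)

/-- `z` results from a projected gradient step of length `1/β` at `y`. -/
def ProjGradStep (f : E → ℝ) (β : ℝ) (B : Set E) (y z : E) : Prop :=
  z ∈ B ∧ ∀ W ∈ B, ⟪y - (1 / β) • ∇ f y - z, W - z⟫_ℝ ≤ 0

/-- Convexity from y to W and descent from y to z differ by a gradient term, which the projection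
inequality turns into a difference of squared distances. -/
theorem ProjGradStep.sub_le {f : E → ℝ} {β : ℝ} (hβ : 0 < β)
    (hconv : ∀ X Y, f X + ⟪∇ f X, Y - X⟫_ℝ ≤ f Y)
    (hdesc : ∀ X Y, f Y ≤ f X + ⟪∇ f X, Y - X⟫_ℝ + β / 2 * ‖Y - X‖ ^ 2) {B : Set E} {y z W : E}
    (h : ProjGradStep f β B y z) (hW : W ∈ B) :
    f z - f W ≤ β / 2 * (‖y - W‖ ^ 2 - ‖z - W‖ ^ 2) := by
  have h1 := h.2 W hW
  have h2 := hconv y W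
  have h3 := hdesc y z
  have e1 : y - (1 / β) • ∇ f y - z = (y - z) - (1 / β) • ∇ f y := by abel
  rw [e1, inner_sub_left, inner_smul_left] at h1
  have e2 : ‖y - W‖ ^ 2 = ‖y - z‖ ^ 2 - 2 * ⟪y - z, W - z⟫_ℝ + ‖W - z‖ ^ 2 := by
    rw [← norm_sub_sq_real]; congr 2; abel
  have e3 : ⟪∇ f y, W - z⟫_ℝ = ⟪∇ f y, W - y⟫_ℝ - ⟪∇ f y, z - y⟫_ℝ := by
    rw [← inner_sub_right]; congr 1; abel
  have h4 : β * ⟪y - z, W - z⟫_ℝ ≤ ⟪∇ f y, W - z⟫_ℝ := by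
    simp only [conj_trivial] at h1
    have : ⟪y - z, W - z⟫_ℝ ≤ 1 / β * ⟪∇ f y, W - z⟫_ℝ := by linarith
    rwa [one_div, le_inv_mul_iff₀ hβ] at this
  rw [e2, norm_sub_rev W z]
  rw [norm_sub_rev z y] at h3
  nlinarith

theorem theta_succ_sq (s : ℕ) (hs : 1 ≤ s) :
    theta (s + 1) ^ 2 - theta (s + 1) = theta s ^ 2 := by
  obtain ⟨s, rfl⟩ := Nat.exists_eq_add_of_le' hs
  have h := Real.sq_sqrt (show (0 : ℝ) ≤ 1 + 4 * theta (s + 1) ^ 2 by positivity)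
  show ((1 + √(1 + 4 * theta (s + 1) ^ 2)) / 2) ^ 2 - (1 + √(1 + 4 * theta (s + 1) ^ 2)) / 2 = _
  nlinarith

theorem half_le_theta (s : ℕ) (hs : 1 ≤ s) : ((s : ℝ) + 1) / 2 ≤ theta s := by
  induction s, hs using Nat.le_induction with
  | base => simp [theta]
  | succ s hs ih =>
    obtain ⟨s, rfl⟩ := Nat.exists_eq_add_of_le' hs
    show _ ≤ (1 + √(1 + 4 * theta (s + 1) ^ 2)) / 2
    have h0 : 0 ≤ theta (s + 1) := le_trans (by positivity) ih
    have : 2 * theta (s + 1) ≤ √(1 + 4 * theta (s + 1) ^ 2) :=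
      Real.le_sqrt_of_sq_le (by nlinarith)
    push_cast at *
    linarith

theorem theta_ge_one (s : ℕ) (hs : 1 ≤ s) : 1 ≤ theta s := by
  have := half_le_theta s hs
  have h2 : (1 : ℝ) ≤ s := by exact_mod_cast hs
  linarith

theorem theta_le_theta_succ (s : ℕ) (hs : 1 ≤ s) : theta s ≤ theta (s + 1) := by
  have h1 := theta_succ_sq s hs
  have h2 := theta_ge_one s hs
  have h3 := theta_ge_one (s + 1) (by omega)
  nlinarith

/-- The potential function estimate for the fast projected gradient method. -/
theorem fastGradient_potential {f : E → ℝ} {β : ℝ} (hβ : 0 < β)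
    (hconv : ∀ X Y, f X + ⟪∇ f X, Y - X⟫_ℝ ≤ f Y)
    (hdesc : ∀ X Y, f Y ≤ f X + ⟪∇ f X, Y - X⟫_ℝ + β / 2 * ‖Y - X‖ ^ 2) {B : Set E}
    (hB : Convex ℝ B) {Xs : E} (hXs : Xs ∈ B) {S : ℕ} {x y : ℕ → E}
    (hx1 : x 1 ∈ B) (hxy : y 1 = x 1)
    (hstep : ∀ s, 1 ≤ s → s ≤ S → ProjGradStep f β B (y s) (x (s + 1)))
    (hmom : ∀ s, 1 ≤ s → s < S →
      y (s + 1) = x (s + 1) + ((theta s - 1) / theta (s + 1)) • (x (s + 1) - x s)) :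
    ∀ s, 1 ≤ s → s ≤ S → theta s ^ 2 * (f (x (s + 1)) - f Xs) +
      β / 2 * ‖theta s • x (s + 1) - (theta s - 1) • x s - Xs‖ ^ 2 ≤ β / 2 * ‖x 1 - Xs‖ ^ 2 := by
  have hfc : ∀ X ∈ B, ∀ a b : ℝ, 0 ≤ a → 0 ≤ b → a + b = 1 →
      f (a • X + b • Xs) ≤ a * f X + b * f Xs := by
    intro X _ a b ha hb hab
    set W := a • X + b • Xs with hW
    have h1 := hconv W X
    have h2 := hconv W Xs
    have h3 : a * ⟪∇ f W, X - W⟫_ℝ + b * ⟪∇ f W, Xs - W⟫_ℝ = 0 := by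
      rw [← inner_smul_right, ← inner_smul_right, ← inner_add_right]
      have : a • (X - W) + b • (Xs - W) = 0 := by
        rw [smul_sub, smul_sub, sub_add_sub_comm, ← hW, ← add_smul, hab, one_smul, sub_self]
      rw [this, inner_zero_right]
    have h4 : (a + b) * f W ≤ a * f X + b * f Xs := by
      nlinarith [mul_le_mul_of_nonneg_left h1 ha, mul_le_mul_of_nonneg_left h2 hb]
    rwa [hab, one_mul] at h4
  have hxB : ∀ s, 1 ≤ s → s ≤ S + 1 → x s ∈ B := by
    intro s hs hsS
    rcases Nat.lt_or_ge 1 s with h | h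
    · obtain ⟨s, rfl⟩ := Nat.exists_eq_add_of_le' hs
      exact (hstep s (by omega) (by omega)).1
    · rw [show s = 1 by omega]; exact hx1
  have hone : ∀ s, 1 ≤ s → s ≤ S → theta s ^ 2 * (f (x (s + 1)) - f Xs) +
      β / 2 * ‖theta s • x (s + 1) - (theta s - 1) • x s - Xs‖ ^ 2 ≤
      (theta s ^ 2 - theta s) * (f (x s) - f Xs) +
      β / 2 * ‖theta s • y s - (theta s - 1) • x s - Xs‖ ^ 2 := by
    intro s hs hsS
    have hθ := theta_ge_one s hs
    set θ := theta s
    have hθ0 : 0 < θ := by linarith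
    set W := (1 - 1 / θ) • x s + (1 / θ) • Xs with hW
    have hle : 1 / θ ≤ 1 := by rw [div_le_one hθ0]; exact hθ
    have hWB : W ∈ B := hB (hxB s hs (by omega)) hXs (by linarith) (by positivity) (by ring)
    have h1 := (hstep s hs hsS).sub_le hβ hconv hdesc hWB
    have h2 := hfc (x s) (hxB s hs (by omega)) (1 - 1 / θ) (1 / θ) (by linarith) (by positivity)
      (by ring)
    -- Comparison with the convex combination `W` of `x s` and `Xs`, scaled by θ², produces the
    -- vectors of the potential.
    have hn : ∀ z : E, θ ^ 2 * ‖z - W‖ ^ 2 = ‖θ • z - (θ - 1) • x s - Xs‖ ^ 2 := by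
      intro z
      have : θ • z - (θ - 1) • x s - Xs = θ • (z - W) := by
        rw [hW, smul_sub, smul_add, smul_smul, smul_smul, mul_sub, mul_one,
          mul_one_div_cancel hθ0.ne', one_smul]
        abel
      rw [this, norm_smul, mul_pow, Real.norm_eq_abs, sq_abs]
    rw [← hn, ← hn]
    have h3 : θ ^ 2 * (f (x (s + 1)) - ((1 - 1 / θ) * f (x s) + 1 / θ * f Xs)) ≤
        θ ^ 2 * (β / 2 * (‖y s - W‖ ^ 2 - ‖x (s + 1) - W‖ ^ 2)) :=
      mul_le_mul_of_nonneg_left (by linarith) (by positivity)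
    have h4 : θ ^ 2 * (f (x (s + 1)) - ((1 - 1 / θ) * f (x s) + 1 / θ * f Xs)) =
        θ ^ 2 * (f (x (s + 1)) - f Xs) - (θ ^ 2 - θ) * (f (x s) - f Xs) := by
      field_simp
      ring
    rw [h4] at h3
    linarith
  intro s hs
  induction s, hs using Nat.le_induction with
  | base =>
    intro hS
    refine (hone 1 le_rfl hS).trans (le_of_eq ?_)
    have : theta 1 = 1 := rfl
    rw [this, hxy]; simp
  | succ s hs ih =>
    intro hS
    refine (hone (s + 1) (by omega) hS).trans ((le_of_eq ?_).trans (ih (by omega)))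
    have hθ : theta (s + 1) ≠ 0 := by have := theta_ge_one (s + 1) (by omega); linarith
    -- The momentum rule is designed so that θ_{s+1} y_{s+1} - (θ_{s+1} - 1) x_{s+1} = θ_s x_{s+1} -
    -- (θ_s - 1) x_s. With θ_{s+1}² - θ_{s+1} = θ_s², the bounds telescope.
    rw [theta_succ_sq s hs, hmom s hs (by omega)]
    congr 4
    rw [smul_add, smul_smul, mul_div_cancel₀ _ hθ]
    module

end SmoothConvex

/-! ### Rank-one test tensors and norm comparisons. -/

section RankOne

/-- The real tensor representing the functional `W ↦ N⁻¹ Re ⟪W̄⁽ⁱ⁾ v, u⟫`. -/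
def rankOneTensor (i : SliceIdx n) (u : EuclideanSpace ℂ (Fin n₁)) (v : EuclideanSpace ℂ (Fin n₂)) :
    Tensor n₁ n₂ n :=
  realInvDFT fun j => if j = i then
    Matrix.toEuclideanLin.symm (InnerProductSpace.rankOne ℂ u v).toLinearMap else 0

theorem inner_rankOneTensor (W : Tensor n₁ n₂ n) (i : SliceIdx n) (u : EuclideanSpace ℂ (Fin n₁))
    (v : EuclideanSpace ℂ (Fin n₂)) :
    ⟪W, rankOneTensor i u v⟫_ℝ = 1 / (numSlices n : ℝ) * (⟪slice W i v, u⟫_ℂ).re := by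
  rw [rankOneTensor, inner_realInvDFT]
  congr 1
  rw [Finset.sum_eq_single i]
  · rw [if_pos rfl, LinearEquiv.apply_symm_apply,
      frob_eq_sum _ _ (EuclideanSpace.basisFun (Fin n₂) ℂ)]
    conv_rhs => rw [← (EuclideanSpace.basisFun (Fin n₂) ℂ).sum_repr' v]
    rw [map_sum, sum_inner, Complex.re_sum]
    refine Finset.sum_congr rfl fun j _ => ?_
    rw [map_smul, inner_smul_left, inner_conj_symm]
    simp [InnerProductSpace.rankOne_apply, inner_smul_right]
  · intro j _ hj
    rw [if_neg hj]
    simp [frob]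
  · simp

theorem sum_frob_self (hn : ∀ j, 0 < n j) (W : Tensor n₁ n₂ n) :
    ∑ i, frob (slice W i) (slice W i) = numSlices n * ‖W‖ ^ 2 := by
  have hN : (0 : ℝ) < numSlices n := by exact_mod_cast numSlices_pos hn
  rw [← real_inner_self_eq_norm_sq, inner_eq_sum_frob hn]
  field_simp

theorem norm_apply_le_sqrt_frob
    (T : EuclideanSpace ℂ (Fin n₂) →ₗ[ℂ] EuclideanSpace ℂ (Fin n₁)) (x : EuclideanSpace ℂ (Fin n₂)) :
    ‖T x‖ ≤ √(frob T T) * ‖x‖ := by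
  refine (norm_apply_le_singularValues T x).trans ?_
  gcongr
  simpa using sqrt_mul_singularValues_le T 0

theorem sliceBound_sqrt_mul_norm (hn : ∀ j, 0 < n j) (W : Tensor n₁ n₂ n) :
    SliceBound W (√(numSlices n) * ‖W‖) := by
  intro i x
  refine (norm_apply_le_sqrt_frob _ x).trans ?_
  gcongr
  rw [← Real.sqrt_sq (norm_nonneg W), ← Real.sqrt_mul (Nat.cast_nonneg _), ← sum_frob_self hn]
  exact Real.sqrt_le_sqrt (Finset.single_le_sum (f := fun i => frob (slice W i) (slice W i))
    (fun i _ => frob_self_nonneg _) (Finset.mem_univ i))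

end RankOne

/-! ### The block diagonal Fourier matrix: its norm and rank in terms of the slices. -/

section BlockDiagonal

/-- The block diagonal matrix of the Fourier slices, as a linear map. -/
def blockMap (X : Tensor n₁ n₂ n) : EuclideanSpace ℂ (Fin n₂ × SliceIdx n) →ₗ[ℂ]
    EuclideanSpace ℂ (Fin n₁ × SliceIdx n) := Matrix.toEuclideanLin (bdiag X)

/-- The components of a vector in a given block. -/
def blockProj (m : ℕ) (i : SliceIdx n) :
    EuclideanSpace ℂ (Fin m × SliceIdx n) →ₗ[ℂ] EuclideanSpace ℂ (Fin m) where
  toFun w := WithLp.toLp 2 fun b => w (b, i)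
  map_add' _ _ := rfl
  map_smul' _ _ := rfl

/-- The vector supported on a given block. -/
def blockIncl (m : ℕ) (i : SliceIdx n) :
    EuclideanSpace ℂ (Fin m) →ₗ[ℂ] EuclideanSpace ℂ (Fin m × SliceIdx n) where
  toFun x := WithLp.toLp 2 fun p => if p.2 = i then x p.1 else 0
  map_add' x y := by ext p; by_cases h : p.2 = i <;> simp [h]
  map_smul' c x := by ext p; by_cases h : p.2 = i <;> simp [h]

theorem blockProj_apply {m : ℕ} (i : SliceIdx n) (w : EuclideanSpace ℂ (Fin m × SliceIdx n))
    (b : Fin m) : blockProj m i w b = w (b, i) := rfl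

theorem blockIncl_apply {m : ℕ} (i : SliceIdx n) (x : EuclideanSpace ℂ (Fin m))
    (p : Fin m × SliceIdx n) : blockIncl m i x p = if p.2 = i then x p.1 else 0 := rfl

theorem norm_sq_eq_sum_blockProj {m : ℕ} (w : EuclideanSpace ℂ (Fin m × SliceIdx n)) :
    ‖w‖ ^ 2 = ∑ i, ‖blockProj m i w‖ ^ 2 := by
  simp only [EuclideanSpace.norm_sq_eq, blockProj_apply]
  rw [Fintype.sum_prod_type, Finset.sum_comm]

theorem blockProj_blockIncl {m : ℕ} (i j : SliceIdx n) (x : EuclideanSpace ℂ (Fin m)) :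
    blockProj m j (blockIncl m i x) = if j = i then x else 0 := by
  ext b
  rw [blockProj_apply, blockIncl_apply]
  split_ifs <;> simp

theorem norm_blockIncl {m : ℕ} (i : SliceIdx n) (x : EuclideanSpace ℂ (Fin m)) :
    ‖blockIncl m i x‖ = ‖x‖ := by
  rw [← sq_eq_sq₀ (norm_nonneg _) (norm_nonneg _), norm_sq_eq_sum_blockProj,
    Finset.sum_eq_single i]
  · rw [blockProj_blockIncl, if_pos rfl]
  · intro j _ hj; rw [blockProj_blockIncl, if_neg hj]; simp
  · simp

theorem inner_blockIncl {m : ℕ} (i : SliceIdx n) (x : EuclideanSpace ℂ (Fin m))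
    (w : EuclideanSpace ℂ (Fin m × SliceIdx n)) :
    ⟪blockIncl m i x, w⟫_ℂ = ⟪x, blockProj m i w⟫_ℂ := by
  simp only [PiLp.inner_apply, Fintype.sum_prod_type, blockIncl_apply, blockProj_apply]
  refine Finset.sum_congr rfl fun b _ => ?_
  rw [Finset.sum_eq_single i]
  · simp
  · intro j _ hj; simp [hj]
  · simp

theorem blockProj_blockMap (X : Tensor n₁ n₂ n) (i : SliceIdx n)
    (w : EuclideanSpace ℂ (Fin n₂ × SliceIdx n)) :
    blockProj n₁ i (blockMap X w) = slice X i (blockProj n₂ i w) := by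
  ext a
  simp only [blockProj_apply, blockMap, slice, bdiag, Matrix.toLpLin_apply, Matrix.mulVec,
    dotProduct, Fintype.sum_prod_type, Matrix.blockDiagonal_apply]
  refine Finset.sum_congr rfl fun b _ => ?_
  simp

theorem blockMap_blockIncl (X : Tensor n₁ n₂ n) (i : SliceIdx n) (x : EuclideanSpace ℂ (Fin n₂)) :
    blockMap X (blockIncl n₂ i x) = blockIncl n₁ i (slice X i x) := by
  ext ⟨a, j⟩
  rw [← blockProj_apply, blockProj_blockMap, blockProj_blockIncl, blockIncl_apply]
  dsimp only
  split_ifs with h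
  · rw [h]
  · simp

theorem norm_slice_le_sval_bdiag (X : Tensor n₁ n₂ n) : SliceBound X (sval (bdiag X) 0) := by
  intro i x
  have := norm_apply_le_singularValues (blockMap X) (blockIncl n₂ i x)
  rwa [blockMap_blockIncl, norm_blockIncl, norm_blockIncl] at this

theorem sval_bdiag_le {X : Tensor n₁ n₂ n} {c : ℝ} (hc : 0 ≤ c) (h : SliceBound X c) :
    sval (bdiag X) 0 ≤ c := by
  refine singularValues_le (blockMap X) hc ⊤ (by simp) fun w _ => ?_
  refine le_of_sq_le_sq ?_ (by positivity)
  rw [mul_pow, norm_sq_eq_sum_blockProj, norm_sq_eq_sum_blockProj w, Finset.mul_sum]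
  refine Finset.sum_le_sum fun i _ => ?_
  rw [blockProj_blockMap, ← mul_pow]
  gcongr
  exact h i _

theorem rank_bdiag (X : Tensor n₁ n₂ n) :
    (bdiag X).rank = finrank ℂ (LinearMap.range (blockMap X)) :=
  Matrix.rank_eq_finrank_range_toLin (bdiag X)
    (EuclideanSpace.basisFun (Fin n₁ × SliceIdx n) ℂ).toBasis
    (EuclideanSpace.basisFun (Fin n₂ × SliceIdx n) ℂ).toBasis

theorem rank_bdiag_le (X : Tensor n₁ n₂ n) :
    (bdiag X).rank ≤ ∑ i, finrank ℂ (LinearMap.range (slice X i)) := by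
  rw [rank_bdiag, ← Module.finrank_pi_fintype ℂ]
  let L : LinearMap.range (blockMap X) →ₗ[ℂ] ((i : SliceIdx n) → LinearMap.range (slice X i)) :=
    LinearMap.pi fun i => LinearMap.codRestrict _ (blockProj n₁ i ∘ₗ Submodule.subtype _) (by
      rintro ⟨_, w, rfl⟩
      exact ⟨blockProj n₂ i w, (blockProj_blockMap X i w).symm⟩)
  refine LinearMap.finrank_le_finrank_of_injective (f := L) ?_
  intro y z hyz
  ext ⟨a, i⟩
  have := congrArg (fun w => (w i : EuclideanSpace ℂ (Fin n₁)) a) hyz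
  exact this

end BlockDiagonal

/-! ### Vectors on which a contraction is isometric. -/

section Isometry

variable {E F : Type*} [NormedAddCommGroup E] [InnerProductSpace ℂ E] [FiniteDimensional ℂ E]
  [NormedAddCommGroup F] [InnerProductSpace ℂ F] [FiniteDimensional ℂ F]

/-- A contraction preserves inner products with every vector whose norm it preserves. -/
theorem inner_map_map_of_norm_eq {Q : E →ₗ[ℂ] F} (hQ : ∀ x, ‖Q x‖ ≤ ‖x‖) {x : E}
    (hx : ‖Q x‖ = ‖x‖) (v : E) : ⟪Q x, Q v⟫_ℂ = ⟪x, v⟫_ℂ := by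
  have hadj : ‖Q.adjoint (Q x)‖ ≤ ‖Q x‖ := by
    by_cases h0 : ‖Q.adjoint (Q x)‖ = 0
    · rw [h0]; positivity
    have h1 : ‖Q.adjoint (Q x)‖ ^ 2 ≤ ‖Q.adjoint (Q x)‖ * ‖Q x‖ := by
      rw [← inner_self_eq_norm_sq (𝕜 := ℂ), LinearMap.adjoint_inner_right]
      refine (re_inner_le_norm _ _).trans ?_
      gcongr
      exact hQ _
    rw [sq] at h1
    exact le_of_mul_le_mul_left h1 (lt_of_le_of_ne (norm_nonneg _) (Ne.symm h0))
  have h2 : ‖Q.adjoint (Q x) - x‖ ^ 2 ≤ 0 := by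
    rw [norm_sub_sq (𝕜 := ℂ), LinearMap.adjoint_inner_left, inner_self_eq_norm_sq]
    have := pow_le_pow_left₀ (norm_nonneg _) hadj 2
    rw [← hx]
    linarith
  -- Preservation of the norm at x means that Q*Q fixes x; the identity of inner products follows
  -- for every v.
  have h3 : Q.adjoint (Q x) = x := by
    rw [← sub_eq_zero, ← norm_eq_zero]
    exact pow_eq_zero_iff (two_ne_zero) |>.1 (le_antisymm h2 (sq_nonneg _))
  rw [← LinearMap.adjoint_inner_left, h3]

/-- Preservation of the norm is not linear in x, but preservation of inner products with all v is.
The span induction runs on the latter. -/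
theorem norm_map_eq_of_mem_span {Q : E →ₗ[ℂ] F} (hQ : ∀ x, ‖Q x‖ ≤ ‖x‖) {s : Set E}
    (hs : ∀ x ∈ s, ‖Q x‖ = ‖x‖) {x : E} (hx : x ∈ Submodule.span ℂ s) : ‖Q x‖ = ‖x‖ := by
  have key : ∀ v, ⟪Q x, Q v⟫_ℂ = ⟪x, v⟫_ℂ := by
    induction hx using Submodule.span_induction with
    | mem y hy => exact inner_map_map_of_norm_eq hQ (hs y hy)
    | zero => simp
    | add y z _ _ hy hz => intro v; rw [map_add, inner_add_left, inner_add_left, hy, hz]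
    | smul c y _ hy => intro v; rw [map_smul, inner_smul_left, inner_smul_left, hy]
  have h := congrArg RCLike.re (key x)
  rw [inner_self_eq_norm_sq, inner_self_eq_norm_sq] at h
  exact (sq_eq_sq₀ (norm_nonneg _) (norm_nonneg _)).1 h

end Isometry

/-! ### Dual certificates and complementarity with the minimizer. -/

section Optimality

/-- `Q` is a dual certificate of the point `Xs` of the unit ball: it lies in the dual unit ball and
attains the value one at `Xs`. -/
structure IsCertificate (Q Xs : Tensor n₁ n₂ n) : Prop where
  mem : Xs ∈ ball n₁ n₂ n
  bound : SliceBound Q 1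
  inner_eq : ⟪Q, Xs⟫_ℝ = 1

/-- The orthogonal complement of the kernel of a Fourier slice. -/
def coker (X : Tensor n₁ n₂ n) (i : SliceIdx n) : Submodule ℂ (EuclideanSpace ℂ (Fin n₂)) :=
  (LinearMap.ker (slice X i))ᗮ

theorem mem_coker_of_pos {X : Tensor n₁ n₂ n} {i : SliceIdx n}
    {b : OrthonormalBasis (Fin n₂) ℂ (EuclideanSpace ℂ (Fin n₂))}
    (hb : IsRightSVBasis (slice X i) (slice X i).singularValues b) {j : Fin n₂}
    (hj : 0 < (slice X i).singularValues j) : b j ∈ coker X i := by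
  rw [coker, Submodule.mem_orthogonal]
  intro x hx
  have h1 := hb.norm_sq_apply x
  rw [LinearMap.mem_ker.1 hx, norm_zero, zero_pow two_ne_zero, eq_comm,
    Finset.sum_eq_zero_iff_of_nonneg (fun _ _ => by positivity)] at h1
  have h2 := h1 j (Finset.mem_univ j)
  rcases mul_eq_zero.1 h2 with h | h
  · exact absurd (pow_eq_zero_iff two_ne_zero |>.1 h) hj.ne'
  · rw [← inner_conj_symm, norm_eq_zero.1 (pow_eq_zero_iff two_ne_zero |>.1 h), map_zero]

theorem coker_le_span {X : Tensor n₁ n₂ n} {i : SliceIdx n}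
    {b : OrthonormalBasis (Fin n₂) ℂ (EuclideanSpace ℂ (Fin n₂))}
    (hb : IsRightSVBasis (slice X i) (slice X i).singularValues b) :
    coker X i ≤ Submodule.span ℂ {x | ∃ j : Fin n₂, 0 < (slice X i).singularValues j ∧ x = b j} := by
  intro x hx
  rw [← b.sum_repr' x]
  refine Submodule.sum_mem _ fun j _ => ?_
  by_cases hj : 0 < (slice X i).singularValues j
  · exact Submodule.smul_mem _ _ (Submodule.subset_span ⟨j, hj, rfl⟩)
  · have h0 : (slice X i).singularValues j = 0 :=
      le_antisymm (not_lt.1 hj) (LinearMap.singularValues_nonneg _ _)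
    have h1 : b j ∈ LinearMap.ker (slice X i) := by
      rw [LinearMap.mem_ker, ← norm_eq_zero, hb.norm_apply j h0.ge, h0]
    rw [(Submodule.mem_orthogonal _ _).1 hx _ h1, zero_smul]
    exact Submodule.zero_mem _

theorem finrank_coker (X : Tensor n₁ n₂ n) (i : SliceIdx n) :
    finrank ℂ (coker X i) = finrank ℂ (LinearMap.range (slice X i)) := by
  have h1 := Submodule.finrank_add_finrank_orthogonal (LinearMap.ker (slice X i))
  have h2 := LinearMap.finrank_range_add_finrank_ker (slice X i)
  rw [coker]
  omega

variable {Q Xs : Tensor n₁ n₂ n}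

theorem IsCertificate.norm_le (h : IsCertificate Q Xs) (i : SliceIdx n)
    (x : EuclideanSpace ℂ (Fin n₂)) : ‖slice Q i x‖ ≤ ‖x‖ := by
  simpa using h.bound i x

theorem IsCertificate.tnn_eq_one (hn : ∀ j, 0 < n j) (h : IsCertificate Q Xs) : tnn Xs = 1 := by
  refine le_antisymm h.mem ?_
  have := inner_le_of_sliceBound (X := Xs) hn h.bound
  rwa [h.inner_eq, one_mul] at this

/-- The duality inequality holds slice by slice and the totals agree, so it is an equality in every
slice. -/
theorem IsCertificate.frob_eq (hn : ∀ j, 0 < n j) (h : IsCertificate Q Xs) (i : SliceIdx n) :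
    frob (slice Q i) (slice Xs i) = ∑ j : Fin n₂, (slice Xs i).singularValues j := by
  have hN : (0 : ℝ) < numSlices n := by exact_mod_cast numSlices_pos hn
  have h1 := h.inner_eq.trans (h.tnn_eq_one hn).symm
  rw [inner_eq_sum_frob hn, tnn_eq] at h1
  have h2 := mul_left_cancel₀ (by positivity) h1
  have h3 : ∀ i ∈ Finset.univ, frob (slice Q i) (slice Xs i) ≤
      ∑ j : Fin n₂, (slice Xs i).singularValues j := fun i _ => by
    simpa using frob_le_of_bound (T := slice Xs i) (h.bound i)
  exact (Finset.sum_eq_sum_iff_of_le h3).1 h2 i (Finset.mem_univ i)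

/-- A certificate maps right singular vectors to left singular vectors. -/
theorem IsCertificate.apply_eq (hn : ∀ j, 0 < n j) (h : IsCertificate Q Xs) {i : SliceIdx n}
    {b : OrthonormalBasis (Fin n₂) ℂ (EuclideanSpace ℂ (Fin n₂))}
    (hb : IsRightSVBasis (slice Xs i) (slice Xs i).singularValues b) (j : Fin n₂) :
    slice Xs i (b j) = (((slice Xs i).singularValues j : ℝ) : ℂ) • slice Q i (b j) := by
  have h1 := h.frob_eq hn i
  rw [frob_eq_sum _ _ b] at h1
  have hs := LinearMap.singularValues_nonneg (slice Xs i)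
  have hQ1 : ∀ j, ‖slice Q i (b j)‖ ≤ 1 := fun j => (h.norm_le i _).trans (by simp)
  have h2 : ∀ j ∈ Finset.univ, RCLike.re ⟪slice Q i (b j), slice Xs i (b j)⟫_ℂ ≤
      (slice Xs i).singularValues j := fun j _ => by
    refine (re_inner_le_norm _ _).trans ?_
    rw [hb.norm_apply j (hs j)]
    exact mul_le_of_le_one_left (hs j) (hQ1 j)
  have h3 := (Finset.sum_eq_sum_iff_of_le h2).1 h1 j (Finset.mem_univ j)
  set s := (slice Xs i).singularValues j with hs'
  -- The same argument on singular vectors gives equality in Cauchy–Schwarz; expanding the square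
  -- turns it into equality of vectors.
  have h4 : ‖slice Xs i (b j) - ((s : ℝ) : ℂ) • slice Q i (b j)‖ ^ 2 ≤ 0 := by
    have e : ∀ z : ℂ, RCLike.re ((s : ℂ) * z) = s * RCLike.re z := Complex.re_ofReal_mul s
    rw [norm_sub_sq (𝕜 := ℂ), inner_smul_right, norm_smul, hb.norm_apply j (hs j), ← hs', e,
      ← inner_conj_symm, RCLike.conj_re, h3]
    have : ‖((s : ℝ) : ℂ)‖ = s := by simpa using hs j
    rw [this, mul_pow]
    have := mul_le_of_le_one_right (sq_nonneg s)
      (pow_le_one₀ (n := 2) (norm_nonneg _) (hQ1 j))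
    nlinarith
  have h5 := pow_eq_zero_iff (two_ne_zero) |>.1 (le_antisymm h4 (sq_nonneg _))
  exact sub_eq_zero.1 (norm_eq_zero.1 h5)

theorem IsCertificate.norm_apply_basis (hn : ∀ j, 0 < n j) (h : IsCertificate Q Xs)
    {i : SliceIdx n} {b : OrthonormalBasis (Fin n₂) ℂ (EuclideanSpace ℂ (Fin n₂))}
    (hb : IsRightSVBasis (slice Xs i) (slice Xs i).singularValues b) {j : Fin n₂}
    (hj : 0 < (slice Xs i).singularValues j) : ‖slice Q i (b j)‖ = ‖b j‖ := by
  have h1 := congrArg norm (h.apply_eq hn hb j)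
  rw [hb.norm_apply j hj.le, norm_smul] at h1
  have : ‖(((slice Xs i).singularValues j : ℝ) : ℂ)‖ = (slice Xs i).singularValues j := by
    simp [abs_of_nonneg hj.le]
  rw [this] at h1
  rw [b.norm_eq_one]
  have h2 : (slice Xs i).singularValues j * 1 =
      (slice Xs i).singularValues j * ‖slice Q i (b j)‖ := by rw [mul_one]; exact h1
  exact (mul_left_cancel₀ hj.ne' h2).symm

theorem IsCertificate.norm_apply_coker (hn : ∀ j, 0 < n j) (h : IsCertificate Q Xs)
    {i : SliceIdx n} {x : EuclideanSpace ℂ (Fin n₂)} (hx : x ∈ coker Xs i) :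
    ‖slice Q i x‖ = ‖x‖ := by
  obtain ⟨b, hb⟩ := exists_isRightSVBasis (slice Xs i) (q := n₂) (by simp)
  refine norm_map_eq_of_mem_span (h.norm_le i) ?_ (coker_le_span hb hx)
  rintro _ ⟨j, hj, rfl⟩
  exact h.norm_apply_basis hn hb hj

/-- Off the support of `Xs`, the certificate is controlled by a later singular value of its block
diagonal matrix. -/
theorem IsCertificate.norm_apply_ker (hn : ∀ j, 0 < n j) (h : IsCertificate Q Xs)
    {i : SliceIdx n} {v : EuclideanSpace ℂ (Fin n₂)} (hv : slice Xs i v = 0) :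
    ‖slice Q i v‖ ≤ sval (bdiag Q) (bdiag Xs).rank * ‖v‖ := by
  by_cases hv0 : v = 0
  · simp [hv0]
  set M := blockMap Xs
  set H := blockMap Q
  set R := (LinearMap.ker M)ᗮ with hR
  set w := blockIncl n₂ i v with hw
  have hw0 : w ≠ 0 := by rw [← norm_ne_zero_iff, hw, norm_blockIncl]; exact norm_ne_zero_iff.2 hv0
  have hwker : w ∈ LinearMap.ker M := by
    rw [LinearMap.mem_ker, hw, blockMap_blockIncl, hv, map_zero]
  have hQ : ∀ x, ‖H x‖ ≤ ‖x‖ := by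
    intro x
    refine le_of_sq_le_sq ?_ (norm_nonneg _)
    rw [norm_sq_eq_sum_blockProj, norm_sq_eq_sum_blockProj x]
    refine Finset.sum_le_sum fun i _ => ?_
    rw [blockProj_blockMap]
    gcongr
    exact h.norm_le i _
  have hRn : ∀ x ∈ R, ‖H x‖ = ‖x‖ := by
    intro x hx
    rw [← sq_eq_sq₀ (norm_nonneg _) (norm_nonneg _), norm_sq_eq_sum_blockProj,
      norm_sq_eq_sum_blockProj x]
    refine Finset.sum_congr rfl fun i _ => ?_
    rw [blockProj_blockMap, h.norm_apply_coker hn]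
    rw [coker, Submodule.mem_orthogonal]
    intro y hy
    rw [← inner_blockIncl]
    refine (Submodule.mem_orthogonal _ _).1 hx _ ?_
    rw [LinearMap.mem_ker, blockMap_blockIncl, LinearMap.mem_ker.1 hy, map_zero]
  have hfin : finrank ℂ R = (bdiag Xs).rank := by
    have h1 := Submodule.finrank_add_finrank_orthogonal (LinearMap.ker M)
    have h2 := LinearMap.finrank_range_add_finrank_ker M
    rw [← hR] at h1
    have h3 : (bdiag Xs).rank = finrank ℂ (LinearMap.range M) := rank_bdiag Xs
    omega
  have hS : finrank ℂ ↥(R ⊔ Submodule.span ℂ {w}) = (bdiag Xs).rank + 1 := by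
    have hinf : R ⊓ Submodule.span ℂ {w} = ⊥ := by
      have : Submodule.span ℂ {w} ≤ LinearMap.ker M := by
        rw [Submodule.span_singleton_le_iff_mem]; exact hwker
      exact ((LinearMap.ker M).orthogonal_disjoint.symm.mono_right this).eq_bot
    have h1 := Submodule.finrank_sup_add_finrank_inf_eq R (Submodule.span ℂ {w})
    rw [hinf, finrank_bot, finrank_span_singleton hw0, hfin] at h1
    omega
  have hvpos : 0 < ‖v‖ := norm_pos_iff.2 hv0
  rw [← div_le_iff₀ hvpos]
  -- `H` is isometric on `R` and keeps it orthogonal to the image of `w`. On the sum, of dimension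
  -- rank + 1, it thus stretches by at least ‖Qv‖/‖v‖ ≤ 1, and min-max applies.
  refine le_singularValues H (R ⊔ Submodule.span ℂ {w}) (by omega) fun x hx => ?_
  obtain ⟨y, hy, z, hz, rfl⟩ := Submodule.mem_sup.1 hx
  obtain ⟨c, rfl⟩ := Submodule.mem_span_singleton.1 hz
  have hyw : ⟪y, c • w⟫_ℂ = 0 := by
    rw [inner_smul_right, ← inner_conj_symm, (Submodule.mem_orthogonal _ _).1 hy _ hwker]
    simp
  have hHyw : ⟪H y, H (c • w)⟫_ℂ = 0 := by
    rw [inner_map_map_of_norm_eq hQ (hRn y hy), hyw]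
  have hHw : ‖H w‖ = ‖slice Q i v‖ := by
    rw [hw, blockMap_blockIncl, norm_blockIncl]
  refine le_of_sq_le_sq ?_ (norm_nonneg _)
  rw [map_add, mul_pow, norm_add_sq (𝕜 := ℂ), norm_add_sq (𝕜 := ℂ), hyw, hHyw, hRn y hy, map_smul,
    norm_smul, norm_smul, hHw, hw, norm_blockIncl]
  have h1 : ‖slice Q i v‖ / ‖v‖ ≤ 1 := by rw [div_le_one hvpos]; exact h.norm_le i v
  have h2 : (‖slice Q i v‖ / ‖v‖) ^ 2 ≤ 1 := pow_le_one₀ (by positivity) h1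
  have h3 : (‖slice Q i v‖ / ‖v‖) ^ 2 * (‖c‖ * ‖v‖) ^ 2 = (‖c‖ * ‖slice Q i v‖) ^ 2 := by
    field_simp
  simp only [map_zero, mul_zero, add_zero, mul_add, h3]
  have := mul_le_of_le_one_left (sq_nonneg ‖y‖) h2
  linarith

end Optimality

/-! ### Geometry of the ball around the face exposed by the certificate. -/

section QuadraticGrowth

variable {Q Xs : Tensor n₁ n₂ n}

/-- The linear span of the face of the unit ball exposed by `Q`. -/
def faceSpan (Q Xs : Tensor n₁ n₂ n) : Submodule ℝ (Tensor n₁ n₂ n) :=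
  Submodule.span ℝ {Z | ∃ i, ∃ x ∈ coker Xs i, Z = rankOneTensor i (slice Q i x) x}

theorem re_inner_eq_zero_of_mem_faceSpan_orthogonal (hn : ∀ j, 0 < n j) {W : Tensor n₁ n₂ n}
    (hW : W ∈ (faceSpan Q Xs)ᗮ) {i : SliceIdx n} {x : EuclideanSpace ℂ (Fin n₂)}
    (hx : x ∈ coker Xs i) : (⟪slice Q i x, slice W i x⟫_ℂ).re = 0 := by
  have hN : (0 : ℝ) < numSlices n := by exact_mod_cast numSlices_pos hn
  have h := (Submodule.mem_orthogonal' _ _).1 hW _ (Submodule.subset_span ⟨i, x, hx, rfl⟩)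
  rw [inner_rankOneTensor] at h
  rw [← inner_conj_symm, Complex.conj_re]
  rcases mul_eq_zero.1 h with h | h
  · exact absurd h (by positivity)
  · exact h

theorem IsCertificate.inner_eq_sum (hn : ∀ j, 0 < n j) (h : IsCertificate Q Xs)
    (b : SliceIdx n → OrthonormalBasis (Fin n₂) ℂ (EuclideanSpace ℂ (Fin n₂)))
    (hb : ∀ i, IsRightSVBasis (slice Xs i) (slice Xs i).singularValues (b i))
    (W : Tensor n₁ n₂ n) : ⟪W, Xs⟫_ℝ = 1 / (numSlices n : ℝ) *
      ∑ i, ∑ j : Fin n₂, (slice Xs i).singularValues j *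
        (⟪slice W i (b i j), slice Q i (b i j)⟫_ℂ).re := by
  rw [inner_eq_sum_frob hn]
  congr 1
  refine Finset.sum_congr rfl fun i _ => ?_
  rw [frob_eq_sum _ _ (b i)]
  refine Finset.sum_congr rfl fun j _ => ?_
  rw [h.apply_eq hn (hb i) j, inner_smul_right]
  exact Complex.re_ofReal_mul _ _

theorem IsCertificate.mem_faceSpan (hn : ∀ j, 0 < n j) (h : IsCertificate Q Xs) :
    Xs ∈ faceSpan Q Xs := by
  rw [← Submodule.orthogonal_orthogonal (faceSpan Q Xs), Submodule.mem_orthogonal]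
  intro W hW
  choose b hb using fun i => exists_isRightSVBasis (slice Xs i) (q := n₂) (by simp)
  rw [h.inner_eq_sum hn b hb, Finset.sum_eq_zero, mul_zero]
  intro i _
  refine Finset.sum_eq_zero fun j _ => ?_
  rcases eq_or_lt_of_le (LinearMap.singularValues_nonneg (slice Xs i) j) with h0 | h0
  · rw [← h0, zero_mul]
  · rw [← inner_conj_symm, Complex.conj_re,
      re_inner_eq_zero_of_mem_faceSpan_orthogonal hn hW (mem_coker_of_pos (hb i) h0), mul_zero]

/-- Directions orthogonal to the span of the face change the operator norm of the certificate to
second order only. -/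
theorem norm_add_apply_sq_le {E F : Type*} [NormedAddCommGroup E] [InnerProductSpace ℂ E]
    [FiniteDimensional ℂ E] [NormedAddCommGroup F] [InnerProductSpace ℂ F] [FiniteDimensional ℂ F]
    {Q W : E →ₗ[ℂ] F} (hQ : ∀ x, ‖Q x‖ ≤ ‖x‖) {V : Submodule ℂ E} (hV : ∀ x ∈ V, ‖Q x‖ = ‖x‖)
    {τ : ℝ} (hτ0 : 0 ≤ τ) (hτ : τ < 1) (hVτ : ∀ x ∈ Vᗮ, ‖Q x‖ ≤ τ * ‖x‖) {w : ℝ} (hw : 0 ≤ w)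
    (hW : ∀ x, ‖W x‖ ≤ w * ‖x‖) (hQW : ∀ x ∈ V, (⟪Q x, W x⟫_ℂ).re = 0) (v : E) :
    ‖Q v + W v‖ ^ 2 ≤ (1 + (1 + 4 / (1 - τ ^ 2)) * w ^ 2) * ‖v‖ ^ 2 := by
  obtain ⟨q, hq, p, hp, rfl⟩ := V.exists_add_mem_mem_orthogonal v
  have hqp : ⟪q, p⟫_ℂ = 0 := (Submodule.mem_orthogonal _ _).1 hp q hq
  have hn : ‖q + p‖ ^ 2 = ‖q‖ ^ 2 + ‖p‖ ^ 2 := by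
    rw [norm_add_sq (𝕜 := ℂ), hqp]; simp
  have hQn : ‖Q (q + p)‖ ^ 2 ≤ ‖q‖ ^ 2 + τ ^ 2 * ‖p‖ ^ 2 := by
    rw [map_add, norm_add_sq (𝕜 := ℂ), inner_map_map_of_norm_eq hQ (hV q hq), hqp, hV q hq,
      ← mul_pow]
    have := pow_le_pow_left₀ (norm_nonneg _) (hVτ p hp) 2
    simp only [map_zero, mul_zero, add_zero]
    linarith
  have hqle : ‖q‖ ≤ ‖q + p‖ := by
    refine le_of_sq_le_sq ?_ (norm_nonneg _)
    rw [hn]; linarith [sq_nonneg ‖p‖]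
  -- The pure V term vanishes, so the first-order contribution always carries a factor ‖p‖.
  have hcross : RCLike.re ⟪Q (q + p), W (q + p)⟫_ℂ ≤ 2 * w * ‖p‖ * ‖q + p‖ := by
    have e : RCLike.re ⟪Q (q + p), W (q + p)⟫_ℂ =
        (⟪Q q, W q⟫_ℂ).re + RCLike.re ⟪Q q, W p⟫_ℂ + RCLike.re ⟪Q p, W (q + p)⟫_ℂ := by
      rw [map_add Q, inner_add_left, map_add, map_add W q p, inner_add_right, map_add]
      rfl
    rw [e, hQW q hq, zero_add]
    have h1 : RCLike.re ⟪Q q, W p⟫_ℂ ≤ ‖q‖ * (w * ‖p‖) :=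
      (re_inner_le_norm _ _).trans (mul_le_mul (hQ q) (hW p) (norm_nonneg _) (norm_nonneg _))
    have h2 : RCLike.re ⟪Q p, W (q + p)⟫_ℂ ≤ ‖p‖ * (w * ‖q + p‖) :=
      (re_inner_le_norm _ _).trans (mul_le_mul (hQ p) (hW _) (norm_nonneg _) (norm_nonneg _))
    have h3 : ‖q‖ * (w * ‖p‖) ≤ ‖q + p‖ * (w * ‖p‖) := by gcongr
    linarith
  have hWn : ‖W (q + p)‖ ^ 2 ≤ w ^ 2 * ‖q + p‖ ^ 2 := by
    rw [← mul_pow]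
    exact pow_le_pow_left₀ (norm_nonneg _) (hW _) 2
  rw [norm_add_sq (𝕜 := ℂ)]
  have hκ : 0 < 1 - τ ^ 2 := by nlinarith
  set κ := 1 - τ ^ 2 with hκdef
  have hQn' : ‖Q (q + p)‖ ^ 2 ≤ ‖q + p‖ ^ 2 - κ * ‖p‖ ^ 2 := by
    rw [hn, hκdef]; linarith
  -- The gain κ‖p‖² from strict contraction on the complement of V absorbs that cross term, leaving
  -- only order w².
  have hyoung : 4 * w * ‖p‖ * ‖q + p‖ ≤ κ * ‖p‖ ^ 2 + 4 / κ * w ^ 2 * ‖q + p‖ ^ 2 := by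
    have h := sq_nonneg (κ * ‖p‖ - 2 * w * ‖q + p‖)
    have e : κ * ‖p‖ ^ 2 + 4 / κ * w ^ 2 * ‖q + p‖ ^ 2 - 4 * w * ‖p‖ * ‖q + p‖ =
        (κ * ‖p‖ - 2 * w * ‖q + p‖) ^ 2 / κ := by
      field_simp
      ring
    have := div_nonneg h hκ.le
    linarith
  linarith

theorem IsCertificate.sliceBound_add (hn : ∀ j, 0 < n j) (h : IsCertificate Q Xs) {τ : ℝ}
    (hτ0 : 0 ≤ τ) (hτ : τ < 1) (hker : ∀ i v, slice Xs i v = 0 → ‖slice Q i v‖ ≤ τ * ‖v‖) :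
    ∃ C : ℝ, 0 < C ∧ ∀ W ∈ (faceSpan Q Xs)ᗮ, SliceBound (Q + W) (1 + C * ‖W‖ ^ 2) := by
  have hN : (0 : ℝ) < numSlices n := by exact_mod_cast numSlices_pos hn
  have hκ : 0 < 1 - τ ^ 2 := by nlinarith
  refine ⟨(1 + 4 / (1 - τ ^ 2)) * numSlices n, by positivity, fun W hW i v => ?_⟩
  have hbd := sliceBound_sqrt_mul_norm hn W
  have h1 := norm_add_apply_sq_le (h.norm_le i) (fun x hx => h.norm_apply_coker hn hx) hτ0 hτ
    (V := coker Xs i) (fun x hx => hker i x (by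
      rw [coker, Submodule.orthogonal_orthogonal] at hx
      exact LinearMap.mem_ker.1 hx)) (by positivity) (hbd i)
    (fun x hx => re_inner_eq_zero_of_mem_faceSpan_orthogonal hn hW hx) v
  rw [mul_pow, Real.sq_sqrt hN.le] at h1
  rw [slice_add, LinearMap.add_apply]
  refine le_of_sq_le_sq (h1.trans ?_) (by positivity)
  rw [mul_pow]
  gcongr
  rw [← mul_assoc]
  set c := (1 + 4 / (1 - τ ^ 2)) * numSlices n * ‖W‖ ^ 2
  have : 0 ≤ c := by positivity
  nlinarith

/-- W is the component of X orthogonal to the face span. Pairing Q + tW with X gains t‖W‖² while the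
dual norm grows by at most Ct²‖W‖²; the choice t = 1/(2C) is optimal. -/
theorem IsCertificate.norm_sq_le_of_mem_ball (hn : ∀ j, 0 < n j) (h : IsCertificate Q Xs) {τ : ℝ}
    (hτ0 : 0 ≤ τ) (hτ : τ < 1) (hker : ∀ i v, slice Xs i v = 0 → ‖slice Q i v‖ ≤ τ * ‖v‖) :
    ∃ C : ℝ, 0 < C ∧ ∀ X ∈ ball n₁ n₂ n, ∃ W ∈ (faceSpan Q Xs)ᗮ,
      X - Xs - W ∈ faceSpan Q Xs ∧ ‖W‖ ^ 2 ≤ C * ⟪Q, Xs - X⟫_ℝ := by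
  obtain ⟨C, hC, hb⟩ := h.sliceBound_add hn hτ0 hτ hker
  refine ⟨4 * C, by positivity, fun X hX => ?_⟩
  obtain ⟨Z, hZ, W, hW, hXZ⟩ := (faceSpan Q Xs).exists_add_mem_mem_orthogonal X
  refine ⟨W, hW, ?_, ?_⟩
  · have : X - Xs - W = Z - Xs := by rw [hXZ]; abel
    rw [this]
    exact Submodule.sub_mem _ hZ (h.mem_faceSpan hn)
  · set t : ℝ := 1 / (2 * C) with ht
    have h1 := inner_le_of_sliceBound (X := X) hn (hb (t • W) (Submodule.smul_mem _ t hW))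
    have h2 : (1 + C * ‖t • W‖ ^ 2) * tnn X ≤ 1 + C * ‖t • W‖ ^ 2 :=
      mul_le_of_le_one_right (by positivity) hX
    have h3 : ⟪W, X⟫_ℝ = ‖W‖ ^ 2 := by
      rw [hXZ, inner_add_right, (Submodule.mem_orthogonal' _ _).1 hW Z hZ,
        real_inner_self_eq_norm_sq, zero_add]
    rw [inner_add_left, inner_smul_left, h3, norm_smul, mul_pow, Real.norm_eq_abs, sq_abs] at h1
    rw [norm_smul, mul_pow, Real.norm_eq_abs, sq_abs] at h2
    rw [inner_sub_right, h.inner_eq]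
    simp only [conj_trivial] at h1
    have h4 : t * ‖W‖ ^ 2 - C * (t ^ 2 * ‖W‖ ^ 2) = ‖W‖ ^ 2 / (4 * C) := by
      rw [ht]; field_simp; ring
    have h5 : ‖W‖ ^ 2 / (4 * C) ≤ 1 - ⟪Q, X⟫_ℝ := by linarith
    rwa [div_le_iff₀' (by positivity)] at h5

/-- In the span of the face, linear functionals in the dual ball are controlled by their values
at `Xs`. -/
theorem IsCertificate.exists_abs_inner_le (hn : ∀ j, 0 < n j) (h : IsCertificate Q Xs)
    {Z : Tensor n₁ n₂ n} (hZ : Z ∈ faceSpan Q Xs) :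
    ∃ C : ℝ, 0 ≤ C ∧ ∀ Y, SliceBound Y 1 → |⟪Q - Y, Z⟫_ℝ| ≤ C * ⟪Q - Y, Xs⟫_ℝ := by
  have hN : (0 : ℝ) < numSlices n := by exact_mod_cast numSlices_pos hn
  induction hZ using Submodule.span_induction with
  | zero => exact ⟨0, le_rfl, by simp⟩
  | add Z₁ Z₂ _ _ h₁ h₂ =>
    obtain ⟨C₁, hC₁, h₁⟩ := h₁
    obtain ⟨C₂, hC₂, h₂⟩ := h₂
    refine ⟨C₁ + C₂, by positivity, fun Y hY => ?_⟩
    rw [inner_add_right, add_mul]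
    exact (abs_add_le _ _).trans (add_le_add (h₁ Y hY) (h₂ Y hY))
  | smul c Z₁ _ h₁ =>
    obtain ⟨C₁, hC₁, h₁⟩ := h₁
    refine ⟨|c| * C₁, by positivity, fun Y hY => ?_⟩
    rw [inner_smul_right, abs_mul, mul_assoc]
    exact mul_le_mul_of_nonneg_left (h₁ Y hY) (abs_nonneg c)
  | mem Z hZ =>
    obtain ⟨i, x, hx, rfl⟩ := hZ
    choose b hb using fun i => exists_isRightSVBasis (slice Xs i) (q := n₂) (by simp)
    -- On `coker Xs i` this is a nonnegative Hermitian quadratic form. ⟪Q - Y, Xs⟫ is a combination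
    -- of its values at singular vectors, with positive weights on the support, so it controls each
    -- such value.
    let φ : Tensor n₁ n₂ n → SliceIdx n → EuclideanSpace ℂ (Fin n₂) → ℝ := fun Y i x =>
      (⟪slice (Q - Y) i x, slice Q i x⟫_ℂ).re
    have hφ0 : ∀ Y : Tensor n₁ n₂ n, SliceBound Y 1 → ∀ i, ∀ x ∈ coker Xs i, 0 ≤ φ Y i x := by
      intro Y hY i x hx
      have e : φ Y i x = ‖slice Q i x‖ ^ 2 - (⟪slice Y i x, slice Q i x⟫_ℂ).re := by
        simp only [φ]
        rw [slice_sub, LinearMap.sub_apply, inner_sub_left, Complex.sub_re]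
        congr 1
        exact inner_self_eq_norm_sq (𝕜 := ℂ) _
      rw [e]
      have h1 : (⟪slice Y i x, slice Q i x⟫_ℂ).re ≤ ‖slice Y i x‖ * ‖slice Q i x‖ :=
        re_inner_le_norm (𝕜 := ℂ) _ _
      have h2 := hY i x
      rw [one_mul] at h2
      rw [h.norm_apply_coker hn hx] at h1 ⊢
      nlinarith [norm_nonneg x]
    have hsum : ∀ Y : Tensor n₁ n₂ n, ⟪Q - Y, Xs⟫_ℝ = 1 / (numSlices n : ℝ) *
        ∑ i, ∑ j : Fin n₂, (slice Xs i).singularValues j * φ Y i (b i j) :=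
      fun Y => h.inner_eq_sum hn b hb (Q - Y)
    have hterm : ∀ Y : Tensor n₁ n₂ n, SliceBound Y 1 → ∀ i (j : Fin n₂),
        0 ≤ (slice Xs i).singularValues j * φ Y i (b i j) := by
      intro Y hY i j
      rcases eq_or_lt_of_le (LinearMap.singularValues_nonneg (slice Xs i) j) with h0 | h0
      · rw [← h0, zero_mul]
      · exact mul_nonneg h0.le (hφ0 Y hY i _ (mem_coker_of_pos (hb i) h0))
    have hP : x ∈ coker Xs i ∧ ∃ C : ℝ, 0 ≤ C ∧ ∀ Y : Tensor n₁ n₂ n, SliceBound Y 1 →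
        φ Y i x ≤ C * ⟪Q - Y, Xs⟫_ℝ := by
      have hx' := coker_le_span (hb i) hx
      clear hx
      induction hx' using Submodule.span_induction with
      | zero => exact ⟨Submodule.zero_mem _, 0, le_rfl, by simp [φ]⟩
      | mem x hx =>
        obtain ⟨j, hj, rfl⟩ := hx
        refine ⟨mem_coker_of_pos (hb i) hj,
          numSlices n / (slice Xs i).singularValues j, by positivity, fun Y hY => ?_⟩
        have h1 : (slice Xs i).singularValues j * φ Y i (b i j) ≤
            ∑ i, ∑ j : Fin n₂, (slice Xs i).singularValues j * φ Y i (b i j) :=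
          (Finset.single_le_sum (f := fun j : Fin n₂ =>
            (slice Xs i).singularValues j * φ Y i (b i j)) (fun j _ => hterm Y hY i j)
            (Finset.mem_univ j)).trans
          (Finset.single_le_sum (f := fun i => ∑ j : Fin n₂,
            (slice Xs i).singularValues j * φ Y i (b i j))
            (fun i _ => Finset.sum_nonneg fun j _ => hterm Y hY i j) (Finset.mem_univ i))
        rw [hsum, div_mul_eq_mul_div, le_div_iff₀ hj, ← mul_assoc, mul_one_div_cancel hN.ne',
          one_mul, mul_comm]
        exact h1
      | add x y _ _ hx hy =>
        obtain ⟨hx, C₁, hC₁, h₁⟩ := hx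
        obtain ⟨hy, C₂, hC₂, h₂⟩ := hy
        refine ⟨Submodule.add_mem _ hx hy, 2 * C₁ + 2 * C₂, by positivity, fun Y hY => ?_⟩
        -- Nonnegativity at `x - y` gives φ(x + y) ≤ 2φ(x) + 2φ(y). It requires membership in `coker
        -- Xs i`, hence the conjunction carried through the induction.
        have hpar : φ Y i (x + y) + φ Y i (x - y) = 2 * φ Y i x + 2 * φ Y i y := by
          simp only [φ, map_add, map_sub, inner_add_left, inner_add_right, inner_sub_left,
            inner_sub_right, Complex.add_re, Complex.sub_re]
          ring
        have := hφ0 Y hY i (x - y) (Submodule.sub_mem _ hx hy)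
        linarith [h₁ Y hY, h₂ Y hY]
      | smul c x _ hx =>
        obtain ⟨hx, C₁, hC₁, h₁⟩ := hx
        refine ⟨Submodule.smul_mem _ c hx, ‖c‖ ^ 2 * C₁, by positivity, fun Y hY => ?_⟩
        have : φ Y i (c • x) = ‖c‖ ^ 2 * φ Y i x := by
          simp only [φ, map_smul, inner_smul_left, inner_smul_right]
          rw [← mul_assoc, RCLike.mul_conj, ← RCLike.ofReal_pow]
          exact Complex.re_ofReal_mul _ _
        rw [this, mul_assoc]
        exact mul_le_mul_of_nonneg_left (h₁ Y hY) (by positivity)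
    obtain ⟨-, C, hC, hP⟩ := hP
    refine ⟨1 / numSlices n * C, by positivity, fun Y hY => ?_⟩
    rw [inner_rankOneTensor, abs_of_nonneg (mul_nonneg (by positivity) (hφ0 Y hY i x hx)), mul_assoc]
    exact mul_le_mul_of_nonneg_left (hP Y hY) (by positivity)

/-- X* is a relative interior point of its face: the slack 1 - ⟪Y, X*⟫ dominates |⟪Y, Z⟫| up to a
constant independent of the dual point Y. -/
theorem IsCertificate.exists_add_smul_mem_ball (hn : ∀ j, 0 < n j) (h : IsCertificate Q Xs)
    {Z : Tensor n₁ n₂ n} (hZ : Z ∈ faceSpan Q Xs) (hQZ : ⟪Q, Z⟫_ℝ = 0) :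
    ∃ ε : ℝ, 0 < ε ∧ Xs + ε • Z ∈ ball n₁ n₂ n := by
  obtain ⟨C, hC, hbd⟩ := h.exists_abs_inner_le hn hZ
  refine ⟨1 / (C + 1), by positivity, (mem_ball_iff hn _).2 fun Y hY => ?_⟩
  have h1 := neg_abs_le ⟪Q - Y, Z⟫_ℝ
  have h2 := hbd Y hY
  have h3 : 0 ≤ ⟪Q - Y, Xs⟫_ℝ := by
    rw [inner_sub_left, h.inner_eq]
    linarith [(mem_ball_iff hn Xs).1 h.mem Y hY]
  rw [inner_add_right, inner_smul_right]
  have e1 : ⟪Y, Xs⟫_ℝ = 1 - ⟪Q - Y, Xs⟫_ℝ := by rw [inner_sub_left, h.inner_eq]; ring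
  have e2 : ⟪Y, Z⟫_ℝ = -⟪Q - Y, Z⟫_ℝ := by rw [inner_sub_left, hQZ]; ring
  rw [e1, e2]
  have h4 : -⟪Q - Y, Z⟫_ℝ ≤ (C + 1) * ⟪Q - Y, Xs⟫_ℝ := by linarith
  have h5 : 1 / (C + 1) * -⟪Q - Y, Z⟫_ℝ ≤ 1 / (C + 1) * ((C + 1) * ⟪Q - Y, Xs⟫_ℝ) :=
    mul_le_mul_of_nonneg_left h4 (by positivity)
  rw [← mul_assoc, one_div_mul_cancel (by positivity), one_mul] at h5
  linarith

end QuadraticGrowth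

/-! ### The certificate from first-order optimality, and quadratic growth. -/

section Growth

theorem singularValues_smul_le {E F : Type*} [NormedAddCommGroup E] [InnerProductSpace ℂ E]
    [FiniteDimensional ℂ E] [NormedAddCommGroup F] [InnerProductSpace ℂ F] [FiniteDimensional ℂ F]
    (c : ℂ) (T : E →ₗ[ℂ] F) (j : ℕ) : (c • T).singularValues j ≤ ‖c‖ * T.singularValues j := by
  obtain ⟨R, hR, h⟩ := exists_upper_singularValues T j
  refine singularValues_le _ (mul_nonneg (norm_nonneg _) (T.singularValues_nonneg j)) R hR
    fun x hx => ?_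
  rw [LinearMap.smul_apply, norm_smul, mul_assoc]
  exact mul_le_mul_of_nonneg_left (h x hx) (norm_nonneg c)

theorem blockMap_smul (c : ℝ) (X : Tensor n₁ n₂ n) : blockMap (c • X) = (c : ℂ) • blockMap X := by
  ext w : 1
  ext ⟨a, i⟩
  rw [← blockProj_apply, blockProj_blockMap, slice_smul, LinearMap.smul_apply,
    LinearMap.smul_apply, ← blockProj_blockMap]
  rfl

/-- The negative gradient at a minimizer over the unit ball, suitably normalized, is a dual
certificate. -/
theorem isCertificate_of_inner_nonneg (hn : ∀ j, 0 < n j) {G Xs : Tensor n₁ n₂ n}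
    (hXs : Xs ∈ ball n₁ n₂ n) (hG : ∀ X ∈ ball n₁ n₂ n, 0 ≤ ⟪G, X - Xs⟫_ℝ)
    (hσ : 0 < sval (bdiag G) 0) : IsCertificate (-(1 / sval (bdiag G) 0) • G) Xs := by
  have hN : (0 : ℝ) < numSlices n := by exact_mod_cast numSlices_pos hn
  set σ := sval (bdiag G) 0 with hσdef
  have hb := norm_slice_le_sval_bdiag G
  rw [← hσdef] at hb
  have hb' : SliceBound (-(1 / σ) • G) 1 := by
    intro i x
    rw [slice_smul, LinearMap.smul_apply, norm_smul]
    have : ‖((-(1 / σ) : ℝ) : ℂ)‖ = 1 / σ := by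
      rw [Complex.norm_real, norm_neg, Real.norm_eq_abs, abs_of_pos (by positivity)]
    rw [this, one_div, inv_mul_le_iff₀ hσ, one_mul]
    exact hb i x
  have hm0 : 0 ≤ -⟪G, Xs⟫_ℝ := by
    have := hG 0 (zero_mem_ball hn)
    rwa [zero_sub, inner_neg_right] at this
  have hle : σ ≤ -⟪G, Xs⟫_ℝ := by
    refine sval_bdiag_le hm0 fun i v => ?_
    by_cases hv : v = 0
    · simp [hv]
    by_cases hGv : slice G i v = 0
    · rw [hGv, norm_zero]; positivity
    have hv' : 0 < ‖v‖ := norm_pos_iff.2 hv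
    have hGv' : 0 < ‖slice G i v‖ := norm_pos_iff.2 hGv
    -- This scaling puts the negative rank-one tensor in the ball. Optimality tested against it
    -- reads ‖Gv‖/‖v‖ ≤ -⟪G, X*⟫.
    set c : ℝ := numSlices n / (‖slice G i v‖ * ‖v‖) with hc
    have hc0 : 0 < c := by positivity
    have hmem : -(c • rankOneTensor i (slice G i v) v) ∈ ball n₁ n₂ n := by
      rw [mem_ball_iff hn]
      intro Y hY
      rw [inner_neg_right, inner_smul_right, inner_rankOneTensor]
      have h1 : -(⟪slice Y i v, slice G i v⟫_ℂ).re ≤ ‖v‖ * ‖slice G i v‖ := by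
        have h2 := Complex.abs_re_le_norm ⟪slice Y i v, slice G i v⟫_ℂ
        have h3 := norm_inner_le_norm (𝕜 := ℂ) (slice Y i v) (slice G i v)
        have h4 := hY i v
        rw [one_mul] at h4
        have h5 := mul_le_mul_of_nonneg_right h4 (norm_nonneg (slice G i v))
        linarith [neg_abs_le (⟪slice Y i v, slice G i v⟫_ℂ).re]
      have h2 : -(c * (1 / (numSlices n : ℝ) * (⟪slice Y i v, slice G i v⟫_ℂ).re)) =
          -(⟪slice Y i v, slice G i v⟫_ℂ).re / (‖v‖ * ‖slice G i v‖) := by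
        rw [hc]; field_simp
      rw [h2, div_le_one (by positivity)]
      exact h1
    have h1 := hG _ hmem
    rw [inner_sub_right, inner_neg_right, inner_smul_right, inner_rankOneTensor] at h1
    have h2 : (⟪slice G i v, slice G i v⟫_ℂ).re = ‖slice G i v‖ ^ 2 :=
      inner_self_eq_norm_sq (𝕜 := ℂ) _
    have h3 : c * (1 / (numSlices n : ℝ) * ‖slice G i v‖ ^ 2) = ‖slice G i v‖ / ‖v‖ := by
      rw [hc]; field_simp
    rw [h2, h3] at h1
    rw [← div_le_iff₀ hv']
    linarith
  have h1 : ⟪-(1 / σ) • G, Xs⟫_ℝ ≤ 1 := (mem_ball_iff hn Xs).1 hXs _ hb'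
  refine ⟨hXs, hb', le_antisymm h1 ?_⟩
  rw [inner_smul_left]
  simp only [conj_trivial]
  rw [neg_mul, ← mul_neg, one_div, le_inv_mul_iff₀ hσ, mul_one]
  exact hle

theorem exists_quadraticGrowth (hn : ∀ j, 0 < n j) {m : ℕ} {f : Tensor n₁ n₂ n → ℝ}
    {g : EuclideanSpace ℝ (Fin m) → ℝ} {A : Tensor n₁ n₂ n →ₗ[ℝ] EuclideanSpace ℝ (Fin m)}
    {C : Tensor n₁ n₂ n} (hf : ∀ X, f X = g (A X) + ⟪C, X⟫_ℝ) {α : ℝ} (hα : 0 < α)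
    (hg : StrongConvexOn Set.univ α g) (hd : Differentiable ℝ f) {Xs : Tensor n₁ n₂ n}
    (hopt : IsUniqueMinimizer f Xs) (hsc : StrictComplementarity f Xs) :
    ∃ γ : ℝ, 0 < γ ∧ QuadraticGrowth f Xs γ := by
  set G := ∇ f Xs with hG
  set σ := sval (bdiag G) 0 with hσ
  have hσ0 : 0 < σ := by
    have h1 := hsc.2
    have h2 := sval_nonneg (bdiag (∇ f Xs)) (bdiag Xs).rank
    rw [← hG] at h1 h2
    linarith
  have hmin : ∀ Y ∈ ball n₁ n₂ n, f Xs ≤ f Y := fun Y hY => by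
    by_cases h : Y = Xs
    · rw [h]
    · exact (hopt.2 Y hY h).le
  have hGn : ∀ X ∈ ball n₁ n₂ n, 0 ≤ ⟪G, X - Xs⟫_ℝ := fun X hX =>
    inner_gradient_nonneg_of_isMin hd (convex_ball hn) hopt.1 hmin hX
  have hcert := isCertificate_of_inner_nonneg hn hopt.1 hGn hσ0
  rw [← hσ] at hcert
  set Q := -(1 / σ) • G with hQ
  have hGQ : G = -(σ • Q) := by
    rw [hQ, smul_smul, mul_neg, mul_one_div_cancel hσ0.ne', neg_smul, one_smul, neg_neg]
  set τ := sval (bdiag Q) (bdiag Xs).rank with hτ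
  have hτ1 : τ < 1 := by
    have h1 : τ ≤ ‖((-(1 / σ) : ℝ) : ℂ)‖ * sval (bdiag G) (bdiag Xs).rank := by
      have := singularValues_smul_le ((-(1 / σ) : ℝ) : ℂ) (blockMap G) (bdiag Xs).rank
      rw [← blockMap_smul] at this
      exact this
    have h2 : ‖((-(1 / σ) : ℝ) : ℂ)‖ = 1 / σ := by
      rw [Complex.norm_real, norm_neg, Real.norm_eq_abs, abs_of_pos (by positivity)]
    rw [h2] at h1
    refine h1.trans_lt ?_
    rw [one_div, inv_mul_lt_iff₀ hσ0, mul_one]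
    linarith [hsc.2]
  obtain ⟨C₁, hC₁, hdist⟩ := hcert.norm_sq_le_of_mem_ball hn (sval_nonneg _ _) hτ1
    (fun i v hv => hcert.norm_apply_ker hn hv)
  let L : Tensor n₁ n₂ n →ₗ[ℝ] EuclideanSpace ℝ (Fin m) × ℝ :=
    A.prod (innerSL ℝ Q).toLinearMap
  have hLapp : ∀ Z, L Z = (A Z, ⟪Q, Z⟫_ℝ) := fun Z => rfl
  -- Along a direction Z of the face span with AZ = 0 and ⟪Q, Z⟫ = 0, f is affine of slope ⟪C, Z⟫ =
  -- ⟪G, Z⟫ = 0. Some X* + εZ with ε > 0 stays in the ball, so uniqueness of the minimizer forces Z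
  -- = 0.
  have hinj : LinearMap.ker (L ∘ₗ (faceSpan Q Xs).subtype) = ⊥ := by
    rw [LinearMap.ker_eq_bot']
    rintro ⟨Z, hZ⟩ hLZ
    have hLZ' : (A Z, ⟪Q, Z⟫_ℝ) = 0 := hLZ
    rw [Prod.mk_eq_zero] at hLZ'
    obtain ⟨hAZ, hQZ⟩ := hLZ'
    obtain ⟨ε, hε, hmem⟩ := hcert.exists_add_smul_mem_ball hn hZ hQZ
    have hline : ∀ t : ℝ, f (Xs + t • Z) = f Xs + t * ⟪C, Z⟫_ℝ := by
      intro t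
      rw [hf, hf, map_add, map_smul, hAZ, smul_zero, add_zero, inner_add_right, inner_smul_right]
      ring
    have hder := hasDerivAt_line hd Xs Z 0
    rw [zero_smul, add_zero] at hder
    have hder' : HasDerivAt (fun t : ℝ => f (Xs + t • Z)) ⟪C, Z⟫_ℝ 0 := by
      simp only [hline]
      simpa using ((hasDerivAt_id (0 : ℝ)).mul_const ⟪C, Z⟫_ℝ).const_add (f Xs)
    have hCZ : ⟪C, Z⟫_ℝ = 0 := by
      rw [hder'.unique hder, ← hG, hGQ, inner_neg_left, inner_smul_left, hQZ]; simp
    have h0 : ε • Z = 0 := by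
      by_contra hne
      have := hopt.2 _ hmem (by simpa using hne)
      rw [hline, hCZ] at this
      simp at this
    ext1
    exact (smul_eq_zero.1 h0).resolve_left hε.ne'
  obtain ⟨K, hK, hanti⟩ := LinearMap.exists_antilipschitzWith _ hinj
  have hbd : ∀ Z ∈ faceSpan Q Xs, ‖Z‖ ≤ K * ‖L Z‖ := fun Z hZ =>
    ZeroHomClass.bound_of_antilipschitz _ hanti (⟨Z, hZ⟩ : faceSpan Q Xs)
  set M := ‖L.toContinuousLinearMap‖
  have hM : ∀ Z, ‖L Z‖ ≤ M * ‖Z‖ := L.toContinuousLinearMap.le_opNorm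
  -- The two summands match the coefficients 2K² of ‖A D‖² and 4K² + 2(KM + 1)²C₁ of ε in the final
  -- estimate of ‖D‖².
  set R : ℝ := 4 * K ^ 2 / α + (4 * K ^ 2 + 2 * (K * M + 1) ^ 2 * C₁) / σ with hR
  have hM0 : 0 ≤ M := norm_nonneg _
  have hR0 : 0 < R := by positivity
  refine ⟨1 / R, by positivity, fun X hX => ?_⟩
  obtain ⟨W, hW, hZ, hWle⟩ := hdist X hX
  set ε := ⟪Q, Xs - X⟫_ℝ with hε
  have hlow := add_inner_gradient_add_le hf hg hd Xs X
  have hGε : ⟪G, X - Xs⟫_ℝ = σ * ε := by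
    rw [hGQ, inner_neg_left, inner_smul_left, hε, ← neg_sub Xs X, inner_neg_right]; simp
  rw [← hG, hGε] at hlow
  have hε0 : 0 ≤ ε := by
    rw [hε, inner_sub_right, hcert.inner_eq]
    linarith [(mem_ball_iff hn X).1 hX Q hcert.bound]
  -- The gap ε enters ‖L D‖² squared but the lower bound on f only linearly; ε ≤ 2 gives ε² ≤ 2ε.
  have hε2 : ε ≤ 2 := by
    have hneg : SliceBound (-Q) 1 := fun i x => by
      rw [slice_neg, LinearMap.neg_apply, norm_neg]; exact hcert.bound i x
    have := (mem_ball_iff hn X).1 hX (-Q) hneg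
    rw [inner_neg_left] at this
    rw [hε, inner_sub_right, hcert.inner_eq]
    linarith
  set D := X - Xs with hD
  have hLD : ‖L D‖ ^ 2 ≤ ‖A D‖ ^ 2 + 2 * ε := by
    have hQD : ⟪Q, D⟫_ℝ = -ε := by rw [hε, hD, ← inner_neg_right, neg_sub]
    rw [hLapp, Prod.norm_def, hQD]
    simp only [norm_neg, Real.norm_eq_abs, abs_of_nonneg hε0]
    rcases max_choice ‖A D‖ ε with h | h
    · rw [h]; linarith
    · rw [h]; nlinarith [sq_nonneg ‖A D‖]
  have hDle : ‖D‖ ≤ K * ‖L D‖ + (K * M + 1) * ‖W‖ := by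
    have h1 := hbd _ hZ
    have h2 : ‖L (D - W)‖ ≤ ‖L D‖ + M * ‖W‖ := by
      rw [map_sub]
      exact (norm_sub_le _ _).trans (by gcongr; exact hM W)
    have h3 : ‖D‖ ≤ ‖D - W‖ + ‖W‖ := by
      simpa using norm_add_le (D - W) W
    have h4 : (K : ℝ) * ‖L (D - W)‖ ≤ K * (‖L D‖ + M * ‖W‖) := by gcongr
    linarith
  have hD2 : ‖D‖ ^ 2 ≤ 2 * K ^ 2 * ‖L D‖ ^ 2 + 2 * (K * M + 1) ^ 2 * ‖W‖ ^ 2 := by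
    have h1 := pow_le_pow_left₀ (norm_nonneg D) hDle 2
    nlinarith [sq_nonneg (K * ‖L D‖ - (K * M + 1) * ‖W‖)]
  have hD3 : ‖D‖ ^ 2 ≤ R * (σ * ε + α / 2 * ‖A D‖ ^ 2) := by
    have h1 : 2 * (K : ℝ) ^ 2 * ‖L D‖ ^ 2 ≤ 2 * K ^ 2 * (‖A D‖ ^ 2 + 2 * ε) := by gcongr
    have h2 : 2 * (K * M + 1) ^ 2 * ‖W‖ ^ 2 ≤ 2 * (K * M + 1) ^ 2 * (C₁ * ε) := by gcongr
    have e : R * (σ * ε + α / 2 * ‖A D‖ ^ 2) =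
        2 * K ^ 2 * ‖A D‖ ^ 2 + (4 * K ^ 2 + 2 * (K * M + 1) ^ 2 * C₁) * ε +
        (4 * K ^ 2 / α * (σ * ε) +
          (4 * K ^ 2 + 2 * (K * M + 1) ^ 2 * C₁) / σ * (α / 2 * ‖A D‖ ^ 2)) := by
      rw [hR]
      field_simp
      ring
    have h3 : 0 ≤ 4 * (K : ℝ) ^ 2 / α * (σ * ε) +
          (4 * K ^ 2 + 2 * (K * M + 1) ^ 2 * C₁) / σ * (α / 2 * ‖A D‖ ^ 2) := by positivity
    rw [e]
    linarith
  rw [one_div, inv_mul_le_iff₀ hR0]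
  refine hD3.trans (mul_le_mul_of_nonneg_left ?_ hR0.le)
  linarith

end Growth

/-! ### Top multiplicities and the generalized complementarity gap. -/

section Multiplicity

theorem finite_topMult_set {p q : Type*} [Fintype p] [Fintype q] [DecidableEq q]
    (A : Matrix p q ℂ) : {j : ℕ | sval A j = sval A 0 ∧ sval A j ≠ 0}.Finite :=
  (Matrix.toEuclideanLin A).singularValues.hasFiniteSupport.subset fun _ hj => hj.2

theorem le_topMult {p q : Type*} [Fintype p] [Fintype q] [DecidableEq q] {A : Matrix p q ℂ} {m : ℕ}
    (h : ∀ j < m, sval A j = sval A 0 ∧ sval A j ≠ 0) : m ≤ topMult A := by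
  have := Set.ncard_le_ncard (s := (Finset.range m : Set ℕ))
    (t := {j : ℕ | sval A j = sval A 0 ∧ sval A j ≠ 0})
    (fun j hj => h j (by simpa using hj)) (finite_topMult_set A)
  rwa [Set.ncard_coe_finset, Finset.card_range] at this

theorem topMult_le {p q : Type*} [Fintype p] [Fintype q] [DecidableEq q] {A : Matrix p q ℂ} {m : ℕ}
    (h : sval A m < sval A 0) : topMult A ≤ m := by
  have := Set.ncard_le_ncard (s := {j : ℕ | sval A j = sval A 0 ∧ sval A j ≠ 0})
    (t := (Finset.range m : Set ℕ)) (fun j hj => ?_) (Finset.finite_toSet _)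
  · rwa [Set.ncard_coe_finset, Finset.card_range] at this
  · rw [Finset.mem_coe, Finset.mem_range]
    by_contra hmj
    have := sval_antitone A (not_lt.1 hmj)
    rw [hj.1] at this
    linarith

theorem topMult_le_maxTopMult (G : Tensor n₁ n₂ n) (i : SliceIdx n) :
    topMult (fslice G i) ≤ maxTopMult G :=
  Finset.le_sup (f := fun i : SliceIdx n => topMult (fslice G i)) (Finset.mem_univ i)

theorem sval_fslice_le_sval_bdiag (G : Tensor n₁ n₂ n) (i : SliceIdx n) (j : ℕ) :
    sval (fslice G i) j ≤ sval (bdiag G) 0 := by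
  refine (sval_antitone _ (Nat.zero_le j)).trans ?_
  exact singularValues_le (slice G i) (sval_nonneg _ _) ⊤ (by simp) fun x _ =>
    norm_slice_le_sval_bdiag G i x

theorem sval_le_sub_genGap (G : Tensor n₁ n₂ n) (i : SliceIdx n) (j : ℕ) :
    sval (fslice G i) j ≤ sval (bdiag G) 0 - genGap G j := by
  rw [genGap, sub_sub_cancel]
  exact le_ciSup (f := fun i : SliceIdx n => sval (fslice G i) j) (Set.finite_range _).bddAbove i

/-- Without a gap, some slice would have `r + 1` singular values equal to σ₁(Ḡ), more than the
maximal multiplicity. -/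
theorem genGap_pos (hn : ∀ j, 0 < n j) {G : Tensor n₁ n₂ n} (hσ : 0 < sval (bdiag G) 0) {r : ℕ}
    (hr : maxTopMult G ≤ r) : 0 < genGap G r := by
  have : Nonempty (SliceIdx n) := ⟨fun j => ⟨0, hn j⟩⟩
  rw [genGap, sub_pos]
  obtain ⟨i, hi⟩ := exists_eq_ciSup_of_finite (f := fun i : SliceIdx n => sval (fslice G i) r)
  rw [← hi]
  by_contra hle
  have h0 := not_lt.1 hle
  have h1 : ∀ j ≤ r, sval (fslice G i) j = sval (bdiag G) 0 := fun j hj =>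
    le_antisymm (sval_fslice_le_sval_bdiag G i j) (h0.trans (sval_antitone _ hj))
  have h2 : r + 1 ≤ topMult (fslice G i) := by
    refine le_topMult fun j hj => ?_
    rw [h1 j (by omega), h1 0 (by omega)]
    exact ⟨rfl, hσ.ne'⟩
  have := topMult_le_maxTopMult G i
  omega

end Multiplicity

/-! ### Singular values of the ideal step X* + κQ and thresholded sums of its perturbations. -/

section LocalTruncation

variable {Q Xs : Tensor n₁ n₂ n}

theorem IsCertificate.one_le_singularValues (hn : ∀ j, 0 < n j) (h : IsCertificate Q Xs) {i : SliceIdx n}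
    {j : ℕ} (hj : j < finrank ℂ (LinearMap.range (slice Xs i))) :
    1 ≤ (slice Q i).singularValues j := by
  rw [← finrank_coker] at hj
  refine le_singularValues _ (coker Xs i) hj fun x hx => ?_
  rw [one_mul, h.norm_apply_coker hn hx]

/-- The trailing singular values of `Xs + κ Q` are those of `κ Q`. -/
theorem IsCertificate.singularValues_add_smul_le (hn : ∀ j, 0 < n j) (h : IsCertificate Q Xs)
    {κ : ℝ} (hκ : 0 < κ) {i : SliceIdx n} {j : ℕ} (hj : (slice Q i).singularValues j < 1) :
    (slice (Xs + κ • Q) i).singularValues j ≤ κ * (slice Q i).singularValues j := by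
  by_cases hjn : finrank ℂ (EuclideanSpace ℂ (Fin n₂)) ≤ j
  · rw [LinearMap.singularValues_of_finrank_le _ hjn]
    exact mul_nonneg hκ.le (LinearMap.singularValues_nonneg _ _)
  obtain ⟨S, hS, hSle⟩ := exists_lower_singularValues (slice (Xs + κ • Q) i) j (not_le.1 hjn)
  set c := (slice (Xs + κ • Q) i).singularValues j with hc
  have hc0 : 0 ≤ c := LinearMap.singularValues_nonneg _ _
  set V := coker Xs i with hV
  have hVo : Vᗮ = LinearMap.ker (slice Xs i) := by rw [hV, coker, Submodule.orthogonal_orthogonal]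
  have hfin : j < finrank ℂ ↥((S ⊓ Vᗮ) ⊔ V) := by
    have h1 := Submodule.finrank_sup_add_finrank_inf_eq S Vᗮ
    have h2 := Submodule.finrank_le (S ⊔ Vᗮ)
    have h3 := Submodule.finrank_add_finrank_orthogonal V
    have h4 := Submodule.finrank_sup_add_finrank_inf_eq (S ⊓ Vᗮ) V
    have h5 : (S ⊓ Vᗮ) ⊓ V = ⊥ := (V.orthogonal_disjoint.symm.mono_left inf_le_right).eq_bot
    rw [h5, finrank_bot] at h4
    omega
  -- On `S ⊓ Vᗮ` the map of `Xs` vanishes, so Q stretches by at least c/κ; on V it is isometric,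
  -- with orthogonal images. Min-max applies on the sum, and the alternative 1 is excluded by `hj`.
  have hmin : min 1 (c / κ) ≤ (slice Q i).singularValues j := by
    refine le_singularValues _ _ hfin fun x hx => ?_
    obtain ⟨y, hy, z, hz, rfl⟩ := Submodule.mem_sup.1 hx
    have hzy : ⟪z, y⟫_ℂ = 0 := (Submodule.mem_orthogonal _ _).1 hy.2 z hz
    have hQzy : ⟪slice Q i z, slice Q i y⟫_ℂ = 0 := by
      rw [inner_map_map_of_norm_eq (h.norm_le i) (h.norm_apply_coker hn hz), hzy]
    have hy2 : c / κ * ‖y‖ ≤ ‖slice Q i y‖ := by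
      have h1 := hSle y hy.1
      have h2 : slice Xs i y = 0 := LinearMap.mem_ker.1 (hVo ▸ hy.2)
      rw [slice_add, slice_smul, LinearMap.add_apply, h2, zero_add, LinearMap.smul_apply,
        norm_smul, Complex.norm_real, Real.norm_eq_abs, abs_of_pos hκ] at h1
      rw [div_mul_eq_mul_div, div_le_iff₀ hκ]
      linarith
    have hm0 : 0 ≤ min 1 (c / κ) := le_min zero_le_one (by positivity)
    refine le_of_sq_le_sq ?_ (norm_nonneg _)
    rw [add_comm y z, map_add, mul_pow, norm_add_sq (𝕜 := ℂ), norm_add_sq (𝕜 := ℂ), hzy, hQzy,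
      h.norm_apply_coker hn hz]
    have h1 : min 1 (c / κ) ^ 2 ≤ 1 := pow_le_one₀ hm0 (min_le_left _ _)
    have h2 : (min 1 (c / κ) * ‖y‖) ^ 2 ≤ ‖slice Q i y‖ ^ 2 := by
      refine pow_le_pow_left₀ (by positivity) (le_trans ?_ hy2) 2
      gcongr
      exact min_le_right _ _
    rw [mul_pow] at h2
    have h3 := mul_le_of_le_one_left (sq_nonneg ‖z‖) h1
    simp only [map_zero, mul_zero, add_zero, mul_add]
    linarith
  rcases min_le_iff.1 hmin with h1 | h1
  · linarith
  · rw [div_le_iff₀ hκ] at h1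
    linarith

/-- Comparison of the compression of `P` to the support of `Xs` with its soft-thresholded leading
singular values. -/
theorem IsCertificate.frob_proj_le (h : IsCertificate Q Xs) {i : SliceIdx n}
    {b : OrthonormalBasis (Fin n₂) ℂ (EuclideanSpace ℂ (Fin n₂))}
    (hb : IsRightSVBasis (slice Xs i) (slice Xs i).singularValues b)
    (T : EuclideanSpace ℂ (Fin n₂) →ₗ[ℂ] EuclideanSpace ℂ (Fin n₁)) {r : ℕ} (hr : r ≤ min n₁ n₂)
    {s : ℝ} (hs : T.singularValues r ≤ s) :
    ∑ j ∈ Finset.univ.filter fun j : Fin n₂ => 0 < (slice Xs i).singularValues j,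
        (⟪slice Q i (b j), T (b j)⟫_ℂ).re ≤
      ∑ j ∈ Finset.range r, max 0 (T.singularValues j - s) +
        (Finset.univ.filter fun j : Fin n₂ => 0 < (slice Xs i).singularValues j).card * s := by
  have hs0 : 0 ≤ s := (T.singularValues_nonneg r).trans hs
  obtain ⟨u, v, hT⟩ := exists_isDiagIn T
  set z : ℕ → ℝ := fun j => max 0 (T.singularValues j - s) with hz
  let Z : EuclideanSpace ℂ (Fin n₂) →ₗ[ℂ] EuclideanSpace ℂ (Fin n₁) :=
    Matrix.toEuclideanLin (colMatrix u * diagRect ℂ n₁ n₂ z * (colMatrix v).conjTranspose)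
  have hZ : IsDiagIn Z z u v := (isDiagIn_iff _ z u v).2 rfl
  have hTZ : ∀ x, ‖(T - Z) x‖ ≤ s * ‖x‖ := (hT.sub hZ).norm_apply_le hs0 fun j _ =>
    abs_sub_max_le (T.singularValues_nonneg j) hs0
  -- The certificate cut down to the support of `Xs`: still a contraction, and its pairing with T is
  -- the sum on the left.
  let Q' : EuclideanSpace ℂ (Fin n₂) →ₗ[ℂ] EuclideanSpace ℂ (Fin n₁) :=
    slice Q i ∘ₗ (coker Xs i).starProjection.toLinearMap
  have hQ' : ∀ x, ‖Q' x‖ ≤ ‖x‖ := fun x =>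
    (h.norm_le i _).trans ((coker Xs i).norm_starProjection_apply_le x)
  have hQ'b : ∀ j : Fin n₂, Q' (b j) = if 0 < (slice Xs i).singularValues j then
      slice Q i (b j) else 0 := by
    intro j
    show slice Q i ((coker Xs i).starProjection (b j)) = _
    split_ifs with hj
    · rw [Submodule.starProjection_eq_self_iff.2 (mem_coker_of_pos hb hj)]
    · have h0 : (slice Xs i).singularValues j = 0 :=
        le_antisymm (not_lt.1 hj) (LinearMap.singularValues_nonneg _ _)
      have h1 : b j ∈ LinearMap.ker (slice Xs i) := by
        rw [LinearMap.mem_ker, ← norm_eq_zero, hb.norm_apply j h0.ge, h0]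
      have h2 : (coker Xs i).starProjection (b j) = 0 := by
        rw [Submodule.starProjection_apply_eq_zero_iff, coker, Submodule.orthogonal_orthogonal]
        exact h1
      rw [h2, map_zero]
  have hfrob : ∀ S : EuclideanSpace ℂ (Fin n₂) →ₗ[ℂ] EuclideanSpace ℂ (Fin n₁), frob Q' S =
      ∑ j ∈ Finset.univ.filter fun j : Fin n₂ => 0 < (slice Xs i).singularValues j,
        (⟪slice Q i (b j), S (b j)⟫_ℂ).re := by
    intro S
    rw [frob_eq_sum _ _ b, Finset.sum_filter]
    refine Finset.sum_congr rfl fun j _ => ?_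
    rw [hQ'b]
    split_ifs <;> simp
  -- T is split into its soft-thresholded part, handled by duality, and a remainder of operator norm
  -- at most s, handled vector by vector.
  have hsplit : frob Q' T = frob Q' Z + frob Q' (T - Z) := by
    rw [hfrob, hfrob, hfrob, ← Finset.sum_add_distrib]
    refine Finset.sum_congr rfl fun j _ => ?_
    rw [← Complex.add_re, ← inner_add_right]
    simp
  rw [← hfrob, hsplit]
  refine add_le_add ?_ ?_
  · refine (hZ.frob_le (fun j => le_max_left _ _) hQ').trans (le_of_eq ?_)
    refine (Finset.sum_subset (Finset.range_subset_range.2 hr) fun j _ hj => ?_).symm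
    refine max_eq_left ?_
    have := T.singularValues_antitone (show r ≤ j by simpa using hj)
    linarith
  · rw [hfrob, ← nsmul_eq_mul]
    refine Finset.sum_le_card_nsmul _ _ _ fun j _ => ?_
    refine (re_inner_le_norm (𝕜 := ℂ) _ _).trans ?_
    have h1 := hTZ (b j)
    have h2 := h.norm_le i (b j)
    rw [b.norm_eq_one] at h1 h2
    rw [mul_one] at h1
    exact (mul_le_mul h2 h1 (norm_nonneg _) zero_le_one).trans (by rw [one_mul])

theorem card_filter_singularValues_pos (X : Tensor n₁ n₂ n) (i : SliceIdx n) :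
    (Finset.univ.filter fun j : Fin n₂ => 0 < (slice X i).singularValues j).card =
      finrank ℂ (LinearMap.range (slice X i)) := by
  have h1 : finrank ℂ (LinearMap.range (slice X i)) ≤ n₂ := by
    simpa using LinearMap.finrank_range_le (slice X i)
  simp only [LinearMap.singularValues_pos_iff_lt_finrank_range]
  rw [Fin.card_filter_val_lt]
  omega

/-- Lower bound for the thresholded sums of a perturbation of `Xs + κ Q`. -/
theorem IsCertificate.le_thresholdSum (hn : ∀ j, 0 < n j) (h : IsCertificate Q Xs) {κ : ℝ}
    (P : Tensor n₁ n₂ n) {r : ℕ} (hr : r ≤ min n₁ n₂) {s : ℝ}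
    (hs : ∀ i, sval (fslice P i) r ≤ s) :
    numSlices n + (∑ i, (finrank ℂ (LinearMap.range (slice Xs i)) : ℝ)) * (κ - s) -
      ∑ i, √(finrank ℂ (LinearMap.range (slice Xs i))) *
        √(frob (slice (P - (Xs + κ • Q)) i) (slice (P - (Xs + κ • Q)) i)) ≤
      thresholdSum r P s := by
  have hN : (0 : ℝ) < numSlices n := by exact_mod_cast numSlices_pos hn
  set D := P - (Xs + κ • Q) with hD
  have hP : P = Xs + κ • Q + D := by rw [hD]; abel
  have hNsum : (numSlices n : ℝ) = ∑ i, ∑ j : Fin n₂, (slice Xs i).singularValues j := by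
    have := h.tnn_eq_one hn
    rw [tnn_eq] at this
    field_simp at this
    exact this.symm
  rw [hNsum, Finset.sum_mul, ← Finset.sum_add_distrib, ← Finset.sum_sub_distrib, thresholdSum]
  refine Finset.sum_le_sum fun i _ => ?_
  obtain ⟨b, hb⟩ := exists_isRightSVBasis (slice Xs i) (q := n₂) (by simp)
  have h1 := h.frob_proj_le hb (slice P i) hr (hs i)
  rw [card_filter_singularValues_pos] at h1
  set ρ := finrank ℂ (LinearMap.range (slice Xs i)) with hρ
  set K := Finset.univ.filter fun j : Fin n₂ => 0 < (slice Xs i).singularValues j with hK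
  -- On the support of `Xs`, `Xs + κ • Q` acts as (σ_j + κ)Q; testing against Q therefore recovers
  -- σ_j + κ up to the perturbation.
  have hterm : ∀ j ∈ K, (slice Xs i).singularValues j + κ - ‖slice D i (b j)‖ ≤
      (⟪slice Q i (b j), slice P i (b j)⟫_ℂ).re := by
    intro j hj
    have hj' : 0 < (slice Xs i).singularValues j := by simpa [hK] using hj
    have hQ1 : ‖slice Q i (b j)‖ = 1 := by rw [h.norm_apply_basis hn hb hj', b.norm_eq_one]
    have e : slice P i (b j) = (((slice Xs i).singularValues j + κ : ℝ) : ℂ) • slice Q i (b j) +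
        slice D i (b j) := by
      rw [hP, slice_add, slice_add, slice_smul, LinearMap.add_apply, LinearMap.add_apply,
        LinearMap.smul_apply, h.apply_eq hn hb j, ← add_smul]
      push_cast
      rfl
    have e2 : (⟪slice Q i (b j), slice Q i (b j)⟫_ℂ).re = 1 := by
      have : (⟪slice Q i (b j), slice Q i (b j)⟫_ℂ).re = ‖slice Q i (b j)‖ ^ 2 :=
        inner_self_eq_norm_sq (𝕜 := ℂ) _
      rw [this, hQ1, one_pow]
    rw [e, inner_add_right, inner_smul_right, Complex.add_re, Complex.re_ofReal_mul, e2, mul_one]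
    have h2 := norm_inner_le_norm (𝕜 := ℂ) (slice Q i (b j)) (slice D i (b j))
    rw [hQ1, one_mul] at h2
    have h3 := Complex.abs_re_le_norm ⟪slice Q i (b j), slice D i (b j)⟫_ℂ
    linarith [neg_abs_le (⟪slice Q i (b j), slice D i (b j)⟫_ℂ).re]
  have h2 := Finset.sum_le_sum hterm
  rw [Finset.sum_sub_distrib, Finset.sum_add_distrib, Finset.sum_const, nsmul_eq_mul,
    card_filter_singularValues_pos, ← hρ] at h2
  have h3 : ∑ j ∈ K, (slice Xs i).singularValues j =
      ∑ j : Fin n₂, (slice Xs i).singularValues j := by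
    refine Finset.sum_subset (Finset.subset_univ _) fun j _ hj => ?_
    refine le_antisymm ?_ (LinearMap.singularValues_nonneg _ _)
    simpa [hK] using hj
  have h4 : ∑ j ∈ K, ‖slice D i (b j)‖ ≤ √ρ * √(frob (slice D i) (slice D i)) := by
    rw [← Real.sqrt_mul (Nat.cast_nonneg _)]
    refine Real.le_sqrt_of_sq_le ?_
    refine (sq_sum_le_card_mul_sum_sq (s := K) (f := fun j => ‖slice D i (b j)‖)).trans ?_
    rw [card_filter_singularValues_pos, frob_self_eq_sum _ b]
    refine mul_le_mul_of_nonneg_left ?_ (Nat.cast_nonneg _)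
    exact Finset.sum_le_sum_of_subset_of_nonneg (Finset.subset_univ _) fun j _ _ => by positivity
  rw [h3] at h2
  have h5 : (ρ : ℝ) * (κ - s) = ρ * κ - ρ * s := by ring
  rw [h5]
  simp only [sval_fslice]
  linarith

end LocalTruncation

/-! ### Exact and truncated projections agree near the ideal gradient step. -/

section LocalEquivalence

variable {G Xs : Tensor n₁ n₂ n}

theorem sval_fslice_smul_le (c : ℝ) (G : Tensor n₁ n₂ n) (i : SliceIdx n) (j : ℕ) :
    (slice (c • G) i).singularValues j ≤ |c| * sval (fslice G i) j := by
  rw [slice_smul]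
  have := singularValues_smul_le (c : ℂ) (slice G i) j
  rwa [Complex.norm_real, Real.norm_eq_abs] at this

theorem IsCertificate.sval_eq_of_lt_rank (hn : ∀ j, 0 < n j) (hσ : 0 < sval (bdiag G) 0)
    (h : IsCertificate (-(1 / sval (bdiag G) 0) • G) Xs) {i : SliceIdx n} {j : ℕ}
    (hj : j < finrank ℂ (LinearMap.range (slice Xs i))) :
    sval (fslice G i) j = sval (bdiag G) 0 := by
  refine le_antisymm (sval_fslice_le_sval_bdiag G i j) ?_
  have h1 := (h.one_le_singularValues hn hj).trans (sval_fslice_smul_le _ G i j)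
  rw [abs_neg, abs_of_pos (by positivity), one_div, le_inv_mul_iff₀ hσ, mul_one] at h1
  exact h1

theorem IsCertificate.rank_slice_le (hn : ∀ j, 0 < n j) (hσ : 0 < sval (bdiag G) 0)
    (h : IsCertificate (-(1 / sval (bdiag G) 0) • G) Xs) (i : SliceIdx n) :
    finrank ℂ (LinearMap.range (slice Xs i)) ≤ maxTopMult G := by
  refine le_trans (le_topMult fun j hj => ?_) (topMult_le_maxTopMult G i)
  rw [h.sval_eq_of_lt_rank hn hσ hj, h.sval_eq_of_lt_rank hn hσ (Nat.zero_lt_of_lt hj)]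
  exact ⟨rfl, hσ.ne'⟩

theorem IsCertificate.fslice_ne_zero (hn : ∀ j, 0 < n j) (hσ : 0 < sval (bdiag G) 0)
    (h : IsCertificate (-(1 / sval (bdiag G) 0) • G) Xs) {i : SliceIdx n}
    (hi : finrank ℂ (LinearMap.range (slice Xs i)) ≠ 0) : fslice G i ≠ 0 := by
  intro h0
  have h1 := h.sval_eq_of_lt_rank hn hσ (Nat.pos_of_ne_zero hi)
  rw [h0, sval, LinearEquiv.map_zero, LinearMap.singularValues_zero] at h1
  exact hσ.ne h1

/-- Slice ranks of X* are at most μ and vanish where the slice of G does. Cauchy–Schwarz over the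
remaining ν slices yields √(μν). -/
theorem IsCertificate.sum_sqrt_mul_sqrt_frob_le (hn : ∀ j, 0 < n j) (hσ : 0 < sval (bdiag G) 0)
    (h : IsCertificate (-(1 / sval (bdiag G) 0) • G) Xs) (D : Tensor n₁ n₂ n) :
    ∑ i, √(finrank ℂ (LinearMap.range (slice Xs i))) * √(frob (slice D i) (slice D i)) ≤
      √((maxTopMult G : ℝ) * (nnzb G : ℝ)) * (√(numSlices n) * ‖D‖) := by
  classical
  set I : Finset (SliceIdx n) := Finset.univ.filter fun i => fslice G i ≠ 0 with hI
  have hcard : nnzb G = I.card := by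
    rw [nnzb, Set.ncard_eq_toFinset_card']
    congr 1
    ext i
    simp [hI]
  have h1 : ∑ i, √(finrank ℂ (LinearMap.range (slice Xs i))) * √(frob (slice D i) (slice D i)) ≤
      ∑ i ∈ I, √(maxTopMult G) * √(frob (slice D i) (slice D i)) := by
    rw [← Finset.sum_subset (Finset.subset_univ I)]
    · refine Finset.sum_le_sum fun i _ => ?_
      gcongr
      exact h.rank_slice_le hn hσ i
    · intro i _ hi
      have : finrank ℂ (LinearMap.range (slice Xs i)) = 0 := by
        by_contra h0
        exact hi (by simpa [hI] using h.fslice_ne_zero hn hσ h0)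
      rw [this]
      simp
  have h2 : ∑ i ∈ I, √(frob (slice D i) (slice D i)) ≤ √(nnzb G) * (√(numSlices n) * ‖D‖) := by
    rw [← Real.sqrt_sq (norm_nonneg D), ← Real.sqrt_mul (Nat.cast_nonneg _),
      ← Real.sqrt_mul (Nat.cast_nonneg _), ← sum_frob_self hn, hcard]
    refine Real.le_sqrt_of_sq_le ?_
    refine (sq_sum_le_card_mul_sum_sq (s := I)
      (f := fun i => √(frob (slice D i) (slice D i)))).trans ?_
    refine mul_le_mul_of_nonneg_left ?_ (Nat.cast_nonneg _)
    rw [Finset.sum_congr rfl fun i _ => Real.sq_sqrt (frob_self_nonneg (slice D i))]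
    exact Finset.sum_le_sum_of_subset_of_nonneg (Finset.subset_univ _)
      fun i _ _ => frob_self_nonneg _
  refine h1.trans ?_
  rw [← Finset.mul_sum, Real.sqrt_mul (Nat.cast_nonneg _), mul_assoc]
  exact mul_le_mul_of_nonneg_left h2 (Real.sqrt_nonneg _)

/-- A truncation level at a perturbation of the gradient step from the minimizer, in terms of the
gap `δ(j)`. -/
theorem IsCertificate.exists_threshold (hn : ∀ j, 0 < n j) (hσ : 0 < sval (bdiag G) 0)
    (h : IsCertificate (-(1 / sval (bdiag G) 0) • G) Xs)
    (hsc : sval (bdiag G) (bdiag Xs).rank < sval (bdiag G) 0) {β : ℝ} (hβ : 0 < β) {r j : ℕ}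
    (hr : r ≤ min n₁ n₂) (hj : j ≤ r) (hgap : 0 < genGap G j) {P : Tensor n₁ n₂ n}
    (hP : √(numSlices n) * ‖P - (Xs - (1 / β) • G)‖ * (1 / √((r - j : ℕ) + 1 : ℝ) +
      √((maxTopMult G : ℝ) * (nnzb G : ℝ)) / (topMult (bdiag G) : ℝ)) ≤ genGap G j / β) :
    ∃ s, (∀ i, sval (fslice P i) r ≤ s) ∧ (numSlices n : ℝ) ≤ thresholdSum r P s := by
  set σ := sval (bdiag G) 0 with hσdef
  set Q := -(1 / σ) • G with hQ
  set κ : ℝ := σ / β with hκdef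
  have hκ : 0 < κ := by positivity
  have hPst : Xs - (1 / β) • G = Xs + κ • Q := by
    rw [hQ, smul_smul, sub_eq_add_neg, ← neg_smul]
    congr 2
    rw [hκdef]; field_simp
  rw [hPst] at hP
  set D := P - (Xs + κ • Q) with hD
  set x := √(numSlices n) * ‖D‖ with hx
  set w := 1 / √((r - j : ℕ) + 1 : ℝ) with hw
  set c := √((maxTopMult G : ℝ) * (nnzb G : ℝ)) with hc
  have hx0 : 0 ≤ x := by positivity
  have htop : 0 < topMult (bdiag G) := by
    refine le_topMult (m := 1) fun l hl => ?_
    have : l = 0 := by omega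
    subst this
    exact ⟨rfl, hσ.ne'⟩
  -- Strict complementarity enters here: σ₁(Ḡ) has multiplicity at most the rank of the block
  -- diagonal matrix of `Xs`.
  have hrank : (topMult (bdiag G) : ℝ) ≤ ∑ i, (finrank ℂ (LinearMap.range (slice Xs i)) : ℝ) := by
    exact_mod_cast (topMult_le hsc).trans (rank_bdiag_le Xs)
  set ρ := ∑ i, (finrank ℂ (LinearMap.range (slice Xs i)) : ℝ) with hρ
  -- Weyl with r = j + (r - j): the ideal step contributes its j-th value, the perturbation its (r -
  -- j)-th, at most its Frobenius norm over √(r - j + 1).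
  have hs : ∀ i, sval (fslice P i) r ≤ (σ - genGap G j) / β + w * x := by
    intro i
    have h1 := singularValues_add_le (slice (Xs + κ • Q) i) (slice D i) j (r - j)
    rw [← slice_add, show Xs + κ • Q + D = P by rw [hD]; abel, show j + (r - j) = r by omega] at h1
    have hG := sval_le_sub_genGap G i j
    rw [← hσdef] at hG
    have hQle : (slice Q i).singularValues j ≤ 1 / σ * sval (fslice G i) j := by
      have := sval_fslice_smul_le (-(1 / σ)) G i j
      rwa [abs_neg, abs_of_pos (by positivity)] at this
    have hQ1 : (slice Q i).singularValues j < 1 := by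
      refine hQle.trans_lt ?_
      rw [one_div, inv_mul_lt_iff₀ hσ, mul_one]
      linarith
    have h2 := h.singularValues_add_smul_le hn hκ hQ1
    have h3 : κ * (slice Q i).singularValues j ≤ (σ - genGap G j) / β := by
      calc κ * (slice Q i).singularValues j ≤ κ * (1 / σ * sval (fslice G i) j) := by gcongr
        _ = sval (fslice G i) j / β := by rw [hκdef]; field_simp
        _ ≤ _ := by gcongr
    have h4 : (slice D i).singularValues (r - j) ≤ w * x := by
      have h5 := sqrt_mul_singularValues_le (slice D i) (r - j)
      have h6 : √(frob (slice D i) (slice D i)) ≤ x := by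
        rw [hx, ← Real.sqrt_sq (norm_nonneg D), ← Real.sqrt_mul (Nat.cast_nonneg _),
          ← sum_frob_self hn]
        exact Real.sqrt_le_sqrt (Finset.single_le_sum
          (f := fun i => frob (slice D i) (slice D i))
          (fun i _ => frob_self_nonneg _) (Finset.mem_univ i))
      rw [hw, one_div, le_inv_mul_iff₀ (by positivity)]
      exact h5.trans h6
    rw [sval_fslice]
    linarith
  refine ⟨(σ - genGap G j) / β + w * x, hs, ?_⟩
  have h1 := h.le_thresholdSum hn P hr hs (κ := κ)
  have h2 := h.sum_sqrt_mul_sqrt_frob_le hn hσ D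
  rw [← hρ, ← hD] at h1
  have ht : (0 : ℝ) < topMult (bdiag G) := by exact_mod_cast htop
  have h3 : κ - ((σ - genGap G j) / β + w * x) = genGap G j / β - w * x := by
    rw [hκdef]; ring
  have h4 : c / topMult (bdiag G) * x ≤ genGap G j / β - w * x := by linarith
  have h5 : c * x ≤ ρ * (genGap G j / β - w * x) := by
    calc c * x = topMult (bdiag G) * (c / topMult (bdiag G) * x) := by field_simp
      _ ≤ ρ * (c / topMult (bdiag G) * x) := by gcongr
      _ ≤ _ := by gcongr
  rw [h3] at h1
  linarith

/-- Near a strictly complementary minimizer the truncated projections of gradient steps are the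
exact projections. -/
theorem isProj_iff_isTruncProj_of_dist_le (hn : ∀ j, 0 < n j) (hXs : Xs ∈ ball n₁ n₂ n)
    (hG : ∀ X ∈ ball n₁ n₂ n, 0 ≤ ⟪G, X - Xs⟫_ℝ)
    (hsc : sval (bdiag G) (bdiag Xs).rank < sval (bdiag G) 0) {β : ℝ} (hβ : 0 < β) {r : ℕ}
    (hμ : maxTopMult G ≤ r) (hr : r ≤ min n₁ n₂) {P : Tensor n₁ n₂ n}
    (hP : ‖P - (Xs - (1 / β) • G)‖ ≤ 2 * radius β G r) (Z : Tensor n₁ n₂ n) :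
    IsProj P Z ↔ IsTruncProj r P Z := by
  have hN : (0 : ℝ) < numSlices n := by exact_mod_cast numSlices_pos hn
  have hσ : 0 < sval (bdiag G) 0 := (sval_nonneg _ _).trans_lt hsc
  have h := isCertificate_of_inner_nonneg hn hXs hG hσ
  suffices hs : ∃ s, (∀ i, sval (fslice P i) r ≤ s) ∧ (numSlices n : ℝ) ≤ thresholdSum r P s by
    obtain ⟨s, hs, hsum⟩ := hs
    exact isProj_iff_isTruncProj hn hr hs hsum Z
  -- If μ = 0 all slices of `Xs` would have rank zero, and `hsc` would compare σ₁(Ḡ) with itself.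
  have hμ1 : 1 ≤ maxTopMult G := by
    by_contra h0
    have h1 : ∀ i, finrank ℂ (LinearMap.range (slice Xs i)) = 0 := fun i => by
      have := h.rank_slice_le hn hσ i
      omega
    have h2 := rank_bdiag_le Xs
    simp only [h1, Finset.sum_const_zero, Nat.le_zero] at h2
    rw [h2] at hsc
    exact lt_irrefl _ hsc
  set c := √((maxTopMult G : ℝ) * (nnzb G : ℝ)) / (topMult (bdiag G) : ℝ) with hc
  have hc0 : 0 ≤ c := by positivity
  have hgap := genGap_pos hn hσ hμ
  have key : ∀ j, j ≤ r → 0 < genGap G j → ∀ w : ℝ, 0 < w → w = 1 / √((r - j : ℕ) + 1 : ℝ) →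
      radius β G r = 1 / (2 * β * √(numSlices n)) * (genGap G j / (w + c)) →
      ∃ s, (∀ i, sval (fslice P i) r ≤ s) ∧ (numSlices n : ℝ) ≤ thresholdSum r P s := by
    intro j hj hgj w hw hweq hrad
    refine h.exists_threshold hn hσ hsc hβ hr hj hgj ?_
    rw [← hweq, ← hc]
    have h1 : √(numSlices n) * ‖P - (Xs - (1 / β) • G)‖ ≤ genGap G j / β / (w + c) := by
      calc √(numSlices n) * ‖P - (Xs - (1 / β) • G)‖
          ≤ √(numSlices n) * (2 * radius β G r) := by gcongr
        _ = genGap G j / β / (w + c) := by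
          rw [hrad]
          have : 0 < w + c := by positivity
          field_simp
    rwa [le_div_iff₀ (by positivity)] at h1
  -- Whichever entry of the maximum defines the radius determines the split: `j = r` or `j = r - μ +
  -- 1`. In the second case positivity of the gap is inherited from the smaller entry.
  rcases le_total (genGap G (r - maxTopMult G + 1) / (1 / √(maxTopMult G : ℝ) + c))
    (genGap G r / (1 + c)) with hle | hle
  · refine key r le_rfl hgap 1 one_pos (by simp) ?_
    rw [radius, ← hc, max_eq_left hle]
  · have hμ0 : (0 : ℝ) < maxTopMult G := by exact_mod_cast hμ1
    have hpos : 0 < genGap G (r - maxTopMult G + 1) := by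
      have h1 : 0 < genGap G (r - maxTopMult G + 1) / (1 / √(maxTopMult G : ℝ) + c) :=
        lt_of_lt_of_le (by positivity) hle
      exact (div_pos_iff_of_pos_right (by positivity)).1 h1
    refine key (r - maxTopMult G + 1) (by omega) hpos (1 / √(maxTopMult G : ℝ)) (by positivity) ?_ ?_
    · have : r - (r - maxTopMult G + 1) = maxTopMult G - 1 := by omega
      rw [this, Nat.cast_sub hμ1]
      simp
    · rw [radius, ← hc, max_eq_right hle]

end LocalEquivalence

/-! ### Existence, localization and convergence of the restarted method. -/

section RestartedMethod

theorem exists_isRestartedFGM (hn : ∀ j, 0 < n j) (f : Tensor n₁ n₂ n → ℝ) (β : ℝ) (K : ℕ)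
    (X₁ : Tensor n₁ n₂ n) : ∃ X x y, IsRestartedFGM IsProj f β K X₁ X x y := by
  choose pr hpr using exists_isProj (n₁ := n₁) (n₂ := n₂) hn
  -- Recursion from zero: `st X s` holds the pair of inner iterates with index `s + 1`, and `Xo t`
  -- is the outer iterate with index `t + 1`.
  let st : Tensor n₁ n₂ n → ℕ → Tensor n₁ n₂ n × Tensor n₁ n₂ n := fun X s =>
    Nat.rec (X, X) (fun s p =>
      (pr (p.2 - (1 / β) • ∇ f p.2),
        pr (p.2 - (1 / β) • ∇ f p.2) + ((theta (s + 1) - 1) / theta (s + 2)) •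
          (pr (p.2 - (1 / β) • ∇ f p.2) - p.1))) s
  let Xo : ℕ → Tensor n₁ n₂ n := fun t => Nat.rec X₁ (fun _ X => (st X K).1) t
  refine ⟨fun t => Xo (t - 1), fun t s => (st (Xo (t - 1)) (s - 1)).1,
    fun t s => (st (Xo (t - 1)) (s - 1)).2, rfl, fun _ _ => rfl, fun _ _ => rfl, ?_, ?_, ?_⟩
  · intro t _ s hs _
    obtain ⟨s, rfl⟩ := Nat.exists_eq_add_of_le' hs
    exact hpr _
  · intro t _ s hs _
    obtain ⟨s, rfl⟩ := Nat.exists_eq_add_of_le' hs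
    rfl
  · intro t ht
    obtain ⟨t, rfl⟩ := Nat.exists_eq_add_of_le' ht
    rfl

variable {f : Tensor n₁ n₂ n → ℝ} {β γ : ℝ} {Xs : Tensor n₁ n₂ n}

theorem IsProj.projGradStep (hn : ∀ j, 0 < n j) {y z : Tensor n₁ n₂ n}
    (h : IsProj (y - (1 / β) • ∇ f y) z) : ProjGradStep f β (ball n₁ n₂ n) y z :=
  ⟨h.1, fun _ hW => h.inner_le hn hW⟩

/-- The value estimate for the fast gradient method. -/
theorem fastGradient_value_le (hn : ∀ j, 0 < n j) (hβ : 0 < β)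
    (hconv : ∀ X Y, f X + ⟪∇ f X, Y - X⟫_ℝ ≤ f Y)
    (hdesc : ∀ X Y, f Y ≤ f X + ⟪∇ f X, Y - X⟫_ℝ + β / 2 * ‖Y - X‖ ^ 2)
    (hXs : Xs ∈ ball n₁ n₂ n) (hmin : ∀ X ∈ ball n₁ n₂ n, f Xs ≤ f X) {S : ℕ}
    {x y : ℕ → Tensor n₁ n₂ n} (hx1 : x 1 ∈ ball n₁ n₂ n) (hxy : y 1 = x 1)
    (hstep : ∀ s, 1 ≤ s → s ≤ S → IsProj (y s - (1 / β) • ∇ f (y s)) (x (s + 1)))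
    (hmom : ∀ s, 1 ≤ s → s < S →
      y (s + 1) = x (s + 1) + ((theta s - 1) / theta (s + 1)) • (x (s + 1) - x s))
    {s : ℕ} (hs : 1 ≤ s) (hsS : s ≤ S) :
    ((s : ℝ) + 1) ^ 2 * (f (x (s + 1)) - f Xs) ≤ 2 * β * ‖x 1 - Xs‖ ^ 2 := by
  have h1 := fastGradient_potential hβ hconv hdesc (convex_ball hn) hXs hx1 hxy
    (fun s hs hsS => (hstep s hs hsS).projGradStep hn) hmom s hs hsS
  have h2 : 0 ≤ f (x (s + 1)) - f Xs := sub_nonneg.2 (hmin _ (hstep s hs hsS).1)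
  have h3 : 0 ≤ β / 2 * ‖theta s • x (s + 1) - (theta s - 1) • x s - Xs‖ ^ 2 := by positivity
  have h4 : (((s : ℝ) + 1) / 2) ^ 2 * (f (x (s + 1)) - f Xs) ≤
      theta s ^ 2 * (f (x (s + 1)) - f Xs) := by
    gcongr
    exact half_le_theta s hs
  nlinarith

theorem momentum_coeff_mem (s : ℕ) (hs : 1 ≤ s) :
    0 ≤ (theta s - 1) / theta (s + 1) ∧ (theta s - 1) / theta (s + 1) ≤ 1 := by
  have h1 := theta_ge_one s hs
  have h2 := theta_ge_one (s + 1) (by omega)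
  have h3 := theta_le_theta_succ s hs
  exact ⟨div_nonneg (by linarith) (by linarith), (div_le_one (by linarith)).2 (by linarith)⟩

/-- All points at which the restarted method evaluates the gradient during one epoch are close to
the minimizer. -/
theorem norm_extrapolation_sub_le (hn : ∀ j, 0 < n j) (hβ : 0 < β)
    (hconv : ∀ X Y, f X + ⟪∇ f X, Y - X⟫_ℝ ≤ f Y)
    (hdesc : ∀ X Y, f Y ≤ f X + ⟪∇ f X, Y - X⟫_ℝ + β / 2 * ‖Y - X‖ ^ 2)
    (hXs : Xs ∈ ball n₁ n₂ n) (hmin : ∀ X ∈ ball n₁ n₂ n, f Xs ≤ f X)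
    (hγ : 0 < γ) (hγβ : γ ≤ 2 * Real.exp 1 ^ 2 * β) (hqg : QuadraticGrowth f Xs γ)
    {R : ℝ} (hR : 0 ≤ R) {S : ℕ} {x y : ℕ → Tensor n₁ n₂ n} (hx1 : x 1 ∈ ball n₁ n₂ n)
    (hxy : y 1 = x 1) (hdist : ‖x 1 - Xs‖ ^ 2 ≤ 2 * γ / (9 * β) * R ^ 2)
    (hstep : ∀ s, 1 ≤ s → s ≤ S → IsProj (y s - (1 / β) • ∇ f (y s)) (x (s + 1)))
    (hmom : ∀ s, 1 ≤ s → s ≤ S →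
      y (s + 1) = x (s + 1) + ((theta s - 1) / theta (s + 1)) • (x (s + 1) - x s)) :
    ‖y (S + 1) - Xs‖ ≤ 2 * R := by
  have he : Real.exp 1 ^ 2 ≤ 9 := by
    have h1 := Real.exp_one_lt_d9
    have h2 := Real.exp_pos 1
    nlinarith
  -- After at least one step the factor (s + 1)² ≥ 4 in the value bound, combined with quadratic
  -- growth, turns the starting distance into R/3.
  have hx : ∀ s, 1 ≤ s → s ≤ S → ‖x (s + 1) - Xs‖ ≤ R / 3 := by
    intro s hs hsS
    have h1 := fastGradient_value_le hn hβ hconv hdesc hXs hmin hx1 hxy hstep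
      (fun s hs hsS => hmom s hs hsS.le) hs hsS
    have h2 := hqg _ (hstep s hs hsS).1
    have h3 : (2 : ℝ) ^ 2 ≤ ((s : ℝ) + 1) ^ 2 := by
      have : (1 : ℝ) ≤ s := by exact_mod_cast hs
      gcongr
      linarith
    have h4 : 0 ≤ f (x (s + 1)) - f Xs := sub_nonneg.2 (hmin _ (hstep s hs hsS).1)
    have h5 : 4 * (f (x (s + 1)) - f Xs) ≤ 2 * β * (2 * γ / (9 * β) * R ^ 2) := by
      have h6 : 2 * β * ‖x 1 - Xs‖ ^ 2 ≤ 2 * β * (2 * γ / (9 * β) * R ^ 2) := by gcongr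
      nlinarith
    have h6 : 2 * β * (2 * γ / (9 * β) * R ^ 2) = 4 * γ * (R / 3) ^ 2 := by field_simp; ring
    have h7 : γ * ‖x (s + 1) - Xs‖ ^ 2 ≤ γ * (R / 3) ^ 2 := by linarith
    exact le_of_sq_le_sq (le_of_mul_le_mul_left h7 hγ) (by positivity)
  rcases Nat.eq_zero_or_pos S with rfl | hS
  · rw [zero_add, hxy]
    refine le_of_sq_le_sq (hdist.trans ?_) (by positivity)
    -- At the start of an epoch only 2γ/(9β) ≤ 4 is available, from γ ≤ 2e²β and e² ≤ 9.
    rw [mul_pow]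
    gcongr
    rw [div_le_iff₀ (by positivity)]
    nlinarith
  · obtain ⟨hc0, hc1⟩ := momentum_coeff_mem S hS
    have hS1 := hx S hS le_rfl
    -- For `S = 1` the momentum coefficient is zero, so the starting point, which need not be within
    -- R/3, does not enter.
    have hlast : ((theta S - 1) / theta (S + 1)) * ‖x (S + 1) - x S‖ ≤ R / 3 + R / 3 := by
      rcases Nat.lt_or_ge 1 S with h | h
      · obtain ⟨s, rfl⟩ := Nat.exists_eq_add_of_le' hS
        have h1 := hx s (by omega) (by omega)
        have h2 : ‖x (s + 1 + 1) - x (s + 1)‖ ≤ ‖x (s + 1 + 1) - Xs‖ + ‖x (s + 1) - Xs‖ := by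
          rw [norm_sub_rev (x (s + 1)) Xs]
          exact norm_sub_le_norm_sub_add_norm_sub _ _ _
        exact (mul_le_of_le_one_left (norm_nonneg _) hc1).trans (by linarith)
      · have : S = 1 := by omega
        subst this
        have : theta 1 = 1 := rfl
        rw [this, sub_self, zero_div, zero_mul]
        positivity
    have e : y (S + 1) - Xs = (x (S + 1) - Xs) +
        ((theta S - 1) / theta (S + 1)) • (x (S + 1) - x S) := by
      rw [hmom S hS le_rfl]; abel
    rw [e]
    refine (norm_add_le _ _).trans ?_
    rw [norm_smul, Real.norm_eq_abs, abs_of_nonneg hc0]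
    linarith

/-- Invariants of the restarted method, for any projection oracle that is exact near the
minimizer. -/
theorem IsRestartedFGM.invariant (hn : ∀ j, 0 < n j) (hβ : 0 < β)
    (hconv : ∀ X Y, f X + ⟪∇ f X, Y - X⟫_ℝ ≤ f Y)
    (hdesc : ∀ X Y, f Y ≤ f X + ⟪∇ f X, Y - X⟫_ℝ + β / 2 * ‖Y - X‖ ^ 2)
    (hXs : Xs ∈ ball n₁ n₂ n) (hmin : ∀ X ∈ ball n₁ n₂ n, f Xs ≤ f X)
    (hγ : 0 < γ) (hγβ : γ ≤ 2 * Real.exp 1 ^ 2 * β) (hqg : QuadraticGrowth f Xs γ)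
    {R : ℝ} (hR : 0 ≤ R) {proj : Tensor n₁ n₂ n → Tensor n₁ n₂ n → Prop}
    (hproj : ∀ y, ‖y - Xs‖ ≤ 2 * R → ∀ Z, proj (y - (1 / β) • ∇ f y) Z →
      IsProj (y - (1 / β) • ∇ f y) Z)
    {K : ℕ} (hK : 1 ≤ K) (hKγ : 2 * β * Real.exp 1 ^ 2 ≤ γ * (K : ℝ) ^ 2)
    {X₁ : Tensor n₁ n₂ n} (hX₁ : X₁ ∈ ball n₁ n₂ n)
    (hdist : ‖X₁ - Xs‖ ^ 2 ≤ 2 * γ / (9 * β) * R ^ 2) {X : ℕ → Tensor n₁ n₂ n}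
    {x y : ℕ → ℕ → Tensor n₁ n₂ n} (h : IsRestartedFGM proj f β K X₁ X x y) (t : ℕ) (ht : 1 ≤ t) :
    (X t ∈ ball n₁ n₂ n ∧ ‖X t - Xs‖ ^ 2 ≤ 2 * γ / (9 * β) * R ^ 2 ∧
      f (X t) - f Xs ≤ Real.exp (-2 * ((t : ℝ) - 1)) * (f X₁ - f Xs)) ∧
    ∀ s, 1 ≤ s → s ≤ K → ‖y t s - Xs‖ ≤ 2 * R ∧
      IsProj (y t s - (1 / β) • ∇ f (y t s)) (x t (s + 1)) := by
  have hinner : ∀ t, 1 ≤ t → X t ∈ ball n₁ n₂ n → ‖X t - Xs‖ ^ 2 ≤ 2 * γ / (9 * β) * R ^ 2 →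
      ∀ s, 1 ≤ s → s ≤ K → ‖y t s - Xs‖ ≤ 2 * R ∧
        IsProj (y t s - (1 / β) • ∇ f (y t s)) (x t (s + 1)) := by
    intro t ht hXt hd s
    -- Exactness of all earlier projections places the next extrapolated point within 2R, which in
    -- turn makes its projection exact.
    induction s using Nat.strong_induction_on with
    | _ s ih =>
      intro hs hsK
      obtain ⟨S, rfl⟩ := Nat.exists_eq_add_of_le' hs
      have hx1 := h.restart_x t ht
      have hy : ‖y t (S + 1) - Xs‖ ≤ 2 * R := by
        refine norm_extrapolation_sub_le hn hβ hconv hdesc hXs hmin hγ hγβ hqg hR (x := x t)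
          (hx1 ▸ hXt) (by rw [h.restart_x t ht, h.restart_y t ht]) (hx1 ▸ hd) ?_ ?_
        · intro s hs hsS
          exact (ih s (by omega) hs (by omega)).2
        · intro s hs hsS
          exact h.momentum t ht s hs (by omega)
      exact ⟨hy, hproj _ hy _ (h.step t ht (S + 1) hs hsK)⟩
  suffices hout : X t ∈ ball n₁ n₂ n ∧ ‖X t - Xs‖ ^ 2 ≤ 2 * γ / (9 * β) * R ^ 2 ∧
      f (X t) - f Xs ≤ Real.exp (-2 * ((t : ℝ) - 1)) * (f X₁ - f Xs) from
    ⟨hout, hinner t ht hout.1 hout.2.1⟩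
  induction t, ht using Nat.le_induction with
  | base =>
    rw [h.init]
    exact ⟨hX₁, hdist, by simp⟩
  | succ t ht ih =>
    obtain ⟨hXt, hd, hval⟩ := ih
    have hin := hinner t ht hXt hd
    have hx1 := h.restart_x t ht
    have h1 := fastGradient_value_le hn hβ hconv hdesc hXs hmin (x := x t) (y := y t) (S := K)
      (hx1 ▸ hXt) (by rw [h.restart_x t ht, h.restart_y t ht])
      (fun s hs hsK => (hin s hs hsK).2) (fun s hs hsK => h.momentum t ht s hs hsK.le) hK le_rfl
    rw [← h.next t ht, hx1] at h1
    have hmem : X (t + 1) ∈ ball n₁ n₂ n := by rw [h.next t ht]; exact (hin K hK le_rfl).2.1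
    have hv0 : 0 ≤ f (X (t + 1)) - f Xs := sub_nonneg.2 (hmin _ hmem)
    have hK2 : (K : ℝ) ^ 2 ≤ ((K : ℝ) + 1) ^ 2 := by gcongr; linarith
    have he1 : 1 ≤ Real.exp 1 ^ 2 := one_le_pow₀ (Real.one_le_exp zero_le_one)
    -- By the choice of K the value gap after one epoch is at most γ‖X_t - X*‖²/e². Quadratic growth
    -- at X_{t+1} then keeps the distance from increasing, and at X_t it gives the factor e⁻².
    have hdec : Real.exp 1 ^ 2 * (f (X (t + 1)) - f Xs) ≤ γ * ‖X t - Xs‖ ^ 2 := by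
      have h2 : (K : ℝ) ^ 2 * (f (X (t + 1)) - f Xs) ≤ 2 * β * ‖X t - Xs‖ ^ 2 :=
        (mul_le_mul_of_nonneg_right hK2 hv0).trans h1
      have h3 : 2 * β * Real.exp 1 ^ 2 * (f (X (t + 1)) - f Xs) ≤
          γ * (K : ℝ) ^ 2 * (f (X (t + 1)) - f Xs) := mul_le_mul_of_nonneg_right hKγ hv0
      have h4 : γ * ((K : ℝ) ^ 2 * (f (X (t + 1)) - f Xs)) ≤ γ * (2 * β * ‖X t - Xs‖ ^ 2) := by
        gcongr
      have h5 : 2 * β * (Real.exp 1 ^ 2 * (f (X (t + 1)) - f Xs)) ≤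
          2 * β * (γ * ‖X t - Xs‖ ^ 2) := by linarith
      exact le_of_mul_le_mul_left h5 (by positivity)
    refine ⟨hmem, ?_, ?_⟩
    · have h2 := hqg _ hmem
      have h3 : γ * ‖X (t + 1) - Xs‖ ^ 2 ≤ γ * ‖X t - Xs‖ ^ 2 := by nlinarith
      exact (le_of_mul_le_mul_left h3 hγ).trans hd
    · have h2 := hqg _ hXt
      have h3 : Real.exp 1 ^ 2 * (f (X (t + 1)) - f Xs) ≤ f (X t) - f Xs := hdec.trans h2
      have h4 : Real.exp (-2 * (((t + 1 : ℕ) : ℝ) - 1)) * Real.exp 1 ^ 2 =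
          Real.exp (-2 * ((t : ℝ) - 1)) := by
        rw [← Real.exp_nat_mul, ← Real.exp_add]
        congr 1
        push_cast
        ring
      have h5 : Real.exp 1 ^ 2 * (f (X (t + 1)) - f Xs) ≤ Real.exp 1 ^ 2 *
          (Real.exp (-2 * (((t + 1 : ℕ) : ℝ) - 1)) * (f X₁ - f Xs)) := by
        rw [← mul_assoc, mul_comm (Real.exp 1 ^ 2) (Real.exp (-2 * (((t + 1 : ℕ) : ℝ) - 1))), h4]
        exact h3.trans hval
      exact le_of_mul_le_mul_left h5 (by positivity)

theorem IsRestartedFGM.mono {p q : Tensor n₁ n₂ n → Tensor n₁ n₂ n → Prop} {K : ℕ}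
    {X₁ : Tensor n₁ n₂ n} {X : ℕ → Tensor n₁ n₂ n} {x y : ℕ → ℕ → Tensor n₁ n₂ n}
    (h : IsRestartedFGM p f β K X₁ X x y)
    (hq : ∀ t, 1 ≤ t → ∀ s, 1 ≤ s → s ≤ K →
      q (y t s - (1 / β) • ∇ f (y t s)) (x t (s + 1))) : IsRestartedFGM q f β K X₁ X x y :=
  ⟨h.init, h.restart_x, h.restart_y, hq, h.momentum, h.next⟩

end RestartedMethod

end TNN

end

/-! ### The main theorem. -/

theorem mainTheorem5 {n₁ n₂ k m : ℕ} {n : Fin k → ℕ} (hn : ∀ j, 0 < n j)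
    (f : TNN.Tensor n₁ n₂ n → ℝ)
    (g : EuclideanSpace ℝ (Fin m) → ℝ)
    (A : TNN.Tensor n₁ n₂ n →ₗ[ℝ] EuclideanSpace ℝ (Fin m))
    (C : TNN.Tensor n₁ n₂ n)
    (hf : ∀ X, f X = g (A X) + inner ℝ C X)
    (α β : ℝ) (hα : 0 < α) (hβ : 0 < β)
    (hg : StrongConvexOn Set.univ α g)
    (hsmooth : TNN.IsSmooth β f)
    (Xs : TNN.Tensor n₁ n₂ n)
    (hopt : TNN.IsUniqueMinimizer f Xs)
    (hsc : TNN.StrictComplementarity f Xs) :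
    (∃ γ : ℝ, 0 < γ ∧ γ ≤ 2 * Real.exp 1 ^ 2 * β ∧ TNN.QuadraticGrowth f Xs γ) ∧
    ∀ γ : ℝ, 0 < γ → γ ≤ 2 * Real.exp 1 ^ 2 * β → TNN.QuadraticGrowth f Xs γ →
    ∀ K : ℕ, K = ⌈√(2 * β) * Real.exp 1 / √γ⌉₊ →
    ∀ r : ℕ, TNN.maxTopMult (gradient f Xs) ≤ r → r < min n₁ n₂ →
    ∀ X₁ ∈ TNN.ball n₁ n₂ n,
      ‖X₁ - Xs‖ ≤ √2 * min γ √γ / (3 * √β) * TNN.radius β (gradient f Xs) r →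
      (∃ X x y, TNN.IsRestartedFGM TNN.IsProj f β K X₁ X x y) ∧
      (∀ X x y, TNN.IsRestartedFGM TNN.IsProj f β K X₁ X x y ↔
        TNN.IsRestartedFGM (TNN.IsTruncProj r) f β K X₁ X x y) ∧
      (∀ X x y, TNN.IsRestartedFGM TNN.IsProj f β K X₁ X x y → ∀ t : ℕ, 1 ≤ t →
        f (X t) - f Xs ≤
          Real.exp (-(√(2 * γ) / (√β * Real.exp 1)) * ((t : ℝ) - 1)) * (f X₁ - f Xs)) := by
  obtain ⟨hd, hL⟩ := hsmooth
  have hconv : ∀ X Y, f X + ⟪∇ f X, Y - X⟫_ℝ ≤ f Y := fun X Y => by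
    have h1 := TNN.add_inner_gradient_add_le hf hg hd X Y
    have h2 : 0 ≤ α / 2 * ‖A (Y - X)‖ ^ 2 := by positivity
    linarith
  have hdesc := TNN.le_add_inner_gradient_add hd hL
  have hmin : ∀ Y ∈ TNN.ball n₁ n₂ n, f Xs ≤ f Y := fun Y hY => by
    by_cases h : Y = Xs
    · rw [h]
    · exact (hopt.2 Y hY h).le
  have hGn : ∀ X ∈ TNN.ball n₁ n₂ n, 0 ≤ ⟪∇ f Xs, X - Xs⟫_ℝ := fun X hX =>
    TNN.inner_gradient_nonneg_of_isMin hd (TNN.convex_ball hn) hopt.1 hmin hX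
  refine ⟨?_, ?_⟩
  · obtain ⟨γ, hγ, hqg⟩ := TNN.exists_quadraticGrowth hn hf hα hg hd hopt hsc
    refine ⟨min γ (2 * Real.exp 1 ^ 2 * β), lt_min hγ (by positivity), min_le_right _ _,
      fun X hX => le_trans ?_ (hqg X hX)⟩
    gcongr
    exact min_le_left _ _
  intro γ hγ hγβ hqg K hK r hμ hr X₁ hX₁ hdist
  set R := TNN.radius β (∇ f Xs) r with hRdef
  have hcoef : 0 < √2 * min γ √γ / (3 * √β) := by
    have : 0 < min γ √γ := lt_min hγ (Real.sqrt_pos.2 hγ)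
    positivity
  -- The starting condition bounds a norm by a positive multiple of R, so R cannot be negative.
  have hR : 0 ≤ R := by
    have h1 := (norm_nonneg _).trans hdist
    exact nonneg_of_mul_nonneg_right h1 hcoef
  have hdist2 : ‖X₁ - Xs‖ ^ 2 ≤ 2 * γ / (9 * β) * R ^ 2 := by
    have h1 : ‖X₁ - Xs‖ ≤ √2 * √γ / (3 * √β) * R := by
      refine hdist.trans ?_
      gcongr
      exact min_le_right _ _
    refine (pow_le_pow_left₀ (norm_nonneg _) h1 2).trans (le_of_eq ?_)
    rw [mul_pow, div_pow, mul_pow, mul_pow, Real.sq_sqrt hγ.le, Real.sq_sqrt hβ.le,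
      Real.sq_sqrt zero_le_two]
    norm_num
  -- Nonexpansiveness of the gradient step carries the bound 2R from y to the point being projected.
  have hlocal : ∀ y, ‖y - Xs‖ ≤ 2 * R → ∀ Z, TNN.IsProj (y - (1 / β) • ∇ f y) Z ↔
      TNN.IsTruncProj r (y - (1 / β) • ∇ f y) Z := fun y hy Z =>
    TNN.isProj_iff_isTruncProj_of_dist_le hn hopt.1 hGn (sub_pos.1 hsc.2) hβ hμ hr.le
      ((TNN.gradient_step_nonexpansive hβ hconv hdesc Xs y).trans hy) Z
  have hpos : 0 < √(2 * β) * Real.exp 1 / √γ := by positivity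
  have hK1 : 1 ≤ K := by rw [hK]; exact Nat.ceil_pos.2 hpos
  have hKγ : 2 * β * Real.exp 1 ^ 2 ≤ γ * (K : ℝ) ^ 2 := by
    have h1 : √(2 * β) * Real.exp 1 / √γ ≤ K := hK ▸ Nat.le_ceil _
    have h2 := pow_le_pow_left₀ hpos.le h1 2
    rwa [div_pow, mul_pow, Real.sq_sqrt (by positivity), Real.sq_sqrt hγ.le,
      div_le_iff₀' hγ] at h2
  refine ⟨TNN.exists_isRestartedFGM hn f β K X₁, fun X x y => ⟨fun h => ?_, fun h => ?_⟩,
    fun X x y h t ht => ?_⟩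
  · refine h.mono fun t ht s hs hsK => ?_
    obtain ⟨h1, h2⟩ := (h.invariant hn hβ hconv hdesc hopt.1 hmin hγ hγβ hqg hR
      (fun _ _ _ hZ => hZ) hK1 hKγ hX₁ hdist2 t ht).2 s hs hsK
    exact (hlocal _ h1 _).1 h2
  · refine h.mono fun t ht s hs hsK => ?_
    exact ((h.invariant hn hβ hconv hdesc hopt.1 hmin hγ hγβ hqg hR
      (fun y hy Z hZ => (hlocal y hy Z).2 hZ) hK1 hKγ hX₁ hdist2 t ht).2 s hs hsK).2
  · refine (h.invariant hn hβ hconv hdesc hopt.1 hmin hγ hγβ hqg hR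
      (fun _ _ _ hZ => hZ) hK1 hKγ hX₁ hdist2 t ht).1.2.2.trans ?_
    have h0 : 0 ≤ f X₁ - f Xs := sub_nonneg.2 (hmin X₁ hX₁)
    have ht1 : (0 : ℝ) ≤ (t : ℝ) - 1 := sub_nonneg.2 (by exact_mod_cast ht)
    have hrate : √(2 * γ) / (√β * Real.exp 1) ≤ 2 := by
      rw [div_le_iff₀ (by positivity)]
      refine Real.sqrt_le_iff.2 ⟨by positivity, ?_⟩
      rw [mul_pow, mul_pow, Real.sq_sqrt hβ.le]
      linarith
    gcongr
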